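/- **Notation and definitions.** A dyadic interval is an interval $I=[2^k m,2^k(m+1)]$ with $k,m\in\mathbb Z$; its length is $|I|=2^k$, and for $n\in\mathbb Z$ we put $I_n=[2^k(m-n),2^k(m+1-n)]$. Let $M\in\mathbb N$ and let $C=(C_{\alpha,N})_{\alpha,N\ge 0}$ be real constants. A smooth function $\varphi:\mathbb R\to\mathbb C$ is a *bump adapted to $I$* (of order $M$, with constants $C$) if $$|\partial^\alpha\varphi(x)|\le C_{\alpha,N}\,\frac1{|I|^{\alpha}}\,\frac{1}{\left(1+\frac{\mathrm{dist}(x,I)}{|I|}\right)^{N}}\qquad\text{for all } x\in\mathbb R,\ 0\le\alpha\le M,\ N\ge 0,$$ and $\Phi=|I|^{-1/2}\varphi$ is then called an *$L^2$-normalized bump adapted to $I$*. A family $(\Phi_J)_{J\in\mathcal J}$ of $L^2$-normalized bumps adapted to dyadic intervals $J$ is of *$\psi$ type* (with constant $A$) if for each $J\in\mathcal J$ there is an interval $\omega_J$, depending only on $|J|$, such that $\mathrm{supp}\,\widehat{\Phi_J}\subseteq\omega_J$ and both $|\omega_J|$ and $\mathrm{dist}(0,\omega_J)$ lie between $A^{-1}|J|^{-1}$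 and $A|J|^{-1}$. Write $\langle f,\Phi\rangle=\int_{\mathbb R}f\,\overline{\Phi}\,dx$ and $\langle n\rangle=2+|n|$. **Theorem.** There is an $M\in\mathbb N$ such that the following holds. Let $1<p,q<\infty$ and $0<r<\infty$ with $1/p+1/q=1/r$, and let constants $C=(C_{\alpha,N})$ and $A$ be given. Then there is a constant $K>0$, depending only on $p,q,C,A$, such that for all $n_1,n_2\in\mathbb Z$, every finite collection $\mathcal I$ of dyadic intervals, and all families $(\Phi^1_{I_{n_1}})_{I\in\mathcal I}$, $(\Phi^2_{I_{n_2}})_{I\in\mathcal I}$, $(\Phi^3_I)_{I\in\mathcal I}$ of $L^2$-normalized bumps (of order $M$, with constants $C$) adapted to $I_{n_1}$, $I_{n_2}$ and $I$ respectively, at least two of which are of $\psi$ type with constant $A$, the bilinear operator $$T_{\mathcal I}(f,g)=\sum_{I\in\mathcal I}\frac1{|I|^{1/2}}\,\langle f,\Phi^1_{I_{n_1}}\rangle\,\langle g,\Phi^2_{I_{n_2}}\rangle\,\Phi^3_I$$ maps $L^p(\mathbb R)\times L^q(\mathbb R)$ into $L^r(\mathbb R)$ and satisfies $$\|T_{\mathcal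 I}(f,g)\|_{L^r}\le K\,\log\langle n_1\rangle\,\log\langle n_2\rangle\,\|f\|_{L^p}\,\|g\|_{L^q}\qquad\text{for all } f\in L^p(\mathbb R),\ g\in L^q(\mathbb R).$$ -/

import Mathlib

open MeasureTheory
open scoped ContDiff FourierTransform ComplexConjugate

noncomputable section

/-- A dyadic interval `[2^k m, 2^k (m+1)]` of the real line, recorded by its (unique) pair of
integers `k` and `m`. -/
@[ext]
structure DyadicInterval where
  /-- the scale: the length of the interval is `2^k` -/
  k : ℤ
  /-- the position at that scale -/
  m : ℤ

namespace DyadicInterval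

/-- The length `|I| = 2^k`. -/
def length (I : DyadicInterval) : ℝ := (2 : ℝ) ^ I.k

/-- The underlying closed interval. -/
def toSet (I : DyadicInterval) : Set ℝ :=
  Set.Icc ((2 : ℝ) ^ I.k * (I.m : ℝ)) ((2 : ℝ) ^ I.k * ((I.m : ℝ) + 1))

/-- The dyadic interval `I_n = [2^k (m - n), 2^k (m + 1 - n)]`, lying `n` units of length `|I|`
away from `I = [2^k m, 2^k (m + 1)]`. -/
def shift (I : DyadicInterval) (n : ℤ) : DyadicInterval := ⟨I.k, I.m - n⟩

end DyadicInterval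

/-- `φ` is a bump adapted to `I`, with `M` controlled derivatives and with constants `C α N`:
`φ` is smooth and
`|∂^α φ (x)| ≤ C α N * |I|^(-α) * (1 + dist (x, I) / |I|)^(-N)` for all `α ≤ M` and all `N`. -/
def IsBump (M : ℕ) (C : ℕ → ℕ → ℝ) (I : DyadicInterval) (φ : ℝ → ℂ) : Prop :=
  ContDiff ℝ ∞ φ ∧
    ∀ α : ℕ, α ≤ M → ∀ (N : ℕ) (x : ℝ),
      ‖iteratedDeriv α φ x‖ ≤
        C α N * (1 / I.length ^ α) * (1 / (1 + Metric.infDist x I.toSet / I.length) ^ N)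

/-- `Φ` is an `L²`-normalized bump adapted to `I`: `Φ = |I|^(-1/2) φ` for a bump `φ` adapted
to `I`. -/
def IsL2Bump (M : ℕ) (C : ℕ → ℕ → ℝ) (I : DyadicInterval) (Φ : ℝ → ℂ) : Prop :=
  ∃ φ : ℝ → ℂ, IsBump M C I φ ∧
    ∀ x : ℝ, Φ x = ((I.length ^ (-(1 / 2) : ℝ) : ℝ) : ℂ) * φ x

/-- `(Φ J)` for `J ∈ 𝓙` is a sequence of `L²`-normalized bumps adapted to the intervals `J`, with
the same constants for all `J`. -/
def IsL2BumpFamily (M : ℕ) (C : ℕ → ℕ → ℝ) (𝓙 : Set DyadicInterval)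
    (Φ : DyadicInterval → ℝ → ℂ) : Prop :=
  ∀ J ∈ 𝓙, IsL2Bump M C J (Φ J)

/-- The sequence `(Φ J)`, `J ∈ 𝓙`, is of `ψ` type, with implicit constant `A`: for each `J` the
Fourier transform of `Φ J` is supported in an interval `ω_J = [lo |J|, hi |J|]`, depending only
on `|J|`, with `|ω_J| ∼ |J|⁻¹ ∼ dist (0, ω_J)`. -/
def IsPsiType (A : ℝ) (𝓙 : Set DyadicInterval) (Φ : DyadicInterval → ℝ → ℂ) : Prop :=
  ∃ lo hi : ℝ → ℝ, ∀ J ∈ 𝓙,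
    lo J.length ≤ hi J.length ∧
    tsupport (𝓕 (Φ J)) ⊆ Set.Icc (lo J.length) (hi J.length) ∧
    A⁻¹ * (J.length)⁻¹ ≤ hi J.length - lo J.length ∧
    hi J.length - lo J.length ≤ A * (J.length)⁻¹ ∧
    A⁻¹ * (J.length)⁻¹ ≤ Metric.infDist 0 (Set.Icc (lo J.length) (hi J.length)) ∧
    Metric.infDist 0 (Set.Icc (lo J.length) (hi J.length)) ≤ A * (J.length)⁻¹

/-- The pairing `⟨f, Φ⟩ = ∫ f(x) conj(Φ(x)) dx`. -/
def pairing (f Φ : ℝ → ℂ) : ℂ := ∫ x : ℝ, f x * conj (Φ x)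

/-- The discrete bilinear model operator
`T(f, g) = ∑_{I ∈ 𝓘} |I|^(-1/2) ⟨f, Φ¹_{I_{n₁}}⟩ ⟨g, Φ²_{I_{n₂}}⟩ Φ³_I`. -/
def modelOperator (𝓘 : Finset DyadicInterval) (n₁ n₂ : ℤ) (Φ₁ Φ₂ Φ₃ : DyadicInterval → ℝ → ℂ)
    (f g : ℝ → ℂ) (x : ℝ) : ℂ :=
  ∑ I ∈ 𝓘, ((I.length ^ (-(1 / 2) : ℝ) : ℝ) : ℂ) *
    pairing f (Φ₁ (I.shift n₁)) * pairing g (Φ₂ (I.shift n₂)) * Φ₃ I x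

end

open scoped ENNReal NNReal

noncomputable section

namespace Paraproduct

/-! ### Powers of two in `ℝ≥0∞` and sums over dyadic levels -/

/-! Families of `ψ` type are handled by square functions and the remaining family by a maximal
function or by its decay; Hölder's inequality then combines the pieces. If the first two families
are of `ψ` type, the decay of the third factor and Cauchy-Schwarz over the intervals bound the
operator pointwise by a product of two square functions with tails
(`exists_lintegral_modelOperator_le`). If the third family and one other are of `ψ` type, the `L^r`
norm of the output is bounded, for every `r > 0`, by that of the square function of its coefficients
(`exists_lintegral_synthesis_le`). This square function is at most a shifted square function of one
argument times a shifted maximal function of the other (`exists_lintegral_modelOperator_le'`); the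
two possible choices are exchanged by `modelOperator_swap`.

The logarithm has a geometric source, `volume_iUnion_shift_below_le`. The subintervals of `P` of
relative length `2 ^ (-j)`, moved by `n` units of their length, lie in one translate of `P`. Once `2
^ j` exceeds `|n|` that translate stays near `P`, so only about `log |n|` scales produce new
territory. Hence shifting a family enlarges its union by at most a logarithm, and the shifted
maximal function is of weak type (1,1) with a logarithmic constant. The other logarithms are derived
from this one.

On the Hilbert space side, the Fourier supports of a family of `ψ` type are disjoint at distant
scales, so the Gram matrix is concentrated near the diagonal and Schur's test gives an `L²` bound
for superpositions (`exists_synthesisBound`). Duality turns it into a bound for coefficients, and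
decay localizes it to the intervals below a given one (`exists_sum_pairing_sq_le_local`).

The shifted square function has norm `O(log)` on `L^p` for all `1 < p < ∞`
(`exists_lintegral_shiftSum_coeffSq_le`). At `p = 2` the shift is invisible. For `p > 2`, testing
against a dual function reduces to a Carleson embedding and the shifted maximal theorem. For `p <
2`, a Calderón-Zygmund decomposition at each dyadic height treats the unshifted square function, and
the shift is inserted afterwards.

That insertion and the synthesis bound for `r ≤ 1` both rest on `level_decomposition`. The intervals
are sorted by the largest dyadic level that the step function `U = ∑ c J 1_J` exceeds on more than
half of `J`. On one level the coefficients have mass at most a multiple of that level times the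
measure of the union, while the union is controlled by the level set of `U`. A Hölder bound on each
level then sums to `∫ U ^ s`. For `r > 1` the synthesis bound is dual to the square function bound.
-/

/-- The power `2 ^ t`, as an extended nonnegative real. -/
def twoPow (t : ℝ) : ℝ≥0∞ := (2 : ℝ≥0∞) ^ t

lemma twoPow_eq_ofReal (t : ℝ) : twoPow t = ENNReal.ofReal ((2 : ℝ) ^ t) := by
  rw [twoPow, ← ENNReal.ofReal_rpow_of_pos (by norm_num)]
  norm_num

lemma twoPow_ne_zero (t : ℝ) : twoPow t ≠ 0 := by
  rw [twoPow_eq_ofReal]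
  simpa using Real.rpow_pos_of_pos (by norm_num) t

lemma twoPow_ne_top (t : ℝ) : twoPow t ≠ ⊤ := by
  rw [twoPow_eq_ofReal]; exact ENNReal.ofReal_ne_top

lemma twoPow_add (s t : ℝ) : twoPow (s + t) = twoPow s * twoPow t :=
  ENNReal.rpow_add _ _ (by norm_num) (by norm_num)

lemma twoPow_rpow (s t : ℝ) : twoPow s ^ t = twoPow (s * t) :=
  (ENNReal.rpow_mul _ _ _).symm

lemma twoPow_pow (s : ℝ) (n : ℕ) : twoPow s ^ n = twoPow (s * n) := by
  rw [← ENNReal.rpow_natCast, twoPow_rpow]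

lemma twoPow_zero : twoPow 0 = 1 := by simp [twoPow]

lemma twoPow_one : twoPow 1 = 2 := by simp [twoPow]

lemma twoPow_inv (s : ℝ) : (twoPow s)⁻¹ = twoPow (-s) := (ENNReal.rpow_neg _ _).symm

lemma twoPow_strictMono : StrictMono twoPow := by
  intro s t h
  rw [twoPow_eq_ofReal, twoPow_eq_ofReal]
  exact (ENNReal.ofReal_lt_ofReal_iff (by positivity)).2
    (Real.rpow_lt_rpow_of_exponent_lt (by norm_num) h)

lemma twoPow_le {s t : ℝ} : twoPow s ≤ twoPow t ↔ s ≤ t := twoPow_strictMono.le_iff_le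

lemma twoPow_lt {s t : ℝ} : twoPow s < twoPow t ↔ s < t := twoPow_strictMono.lt_iff_lt

lemma exists_eq_twoPow {t : ℝ≥0∞} (h0 : t ≠ 0) (ht : t ≠ ⊤) : ∃ τ, t = twoPow τ := by
  have hp : 0 < t.toReal := ENNReal.toReal_pos h0 ht
  refine ⟨Real.logb 2 t.toReal, ?_⟩
  rw [twoPow_eq_ofReal, Real.rpow_logb (by norm_num) (by norm_num) hp, ENNReal.ofReal_toReal ht]

/-- The sum of a geometric series of ratio `2 ^ (-a)`. -/
def geomConst (a : ℝ) : ℝ≥0∞ := ∑' i : ℕ, twoPow (-a) ^ i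

lemma geomConst_ne_top {a : ℝ} (ha : 0 < a) : geomConst a ≠ ⊤ := by
  rw [geomConst, ENNReal.tsum_geometric]
  refine ENNReal.inv_ne_top.2 ?_
  rw [Ne, tsub_eq_zero_iff_le, not_le, ← twoPow_zero, twoPow_lt]
  linarith

lemma one_le_geomConst (a : ℝ) : 1 ≤ geomConst a := by
  simpa [-ENNReal.tsum_geometric, geomConst] using
    ENNReal.le_tsum (f := fun i : ℕ => twoPow (-a) ^ i) 0

lemma tsum_int_le (k₀ : ℤ) (a : ℝ) :
    ∑' k : ℤ, (if k ≤ k₀ then twoPow (k * a) else 0) = twoPow (k₀ * a) * geomConst a := by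
  have hinj : Function.Injective (fun i : ℕ => k₀ - (i : ℤ)) := by
    intro i j h; simpa using h
  rw [← hinj.tsum_eq, geomConst, ← ENNReal.tsum_mul_left]
  · refine tsum_congr fun i => ?_
    simp only [sub_le_self_iff, Nat.cast_nonneg, if_true]
    rw [twoPow_pow, ← twoPow_add]
    congr 1; push_cast; ring
  · intro k hk
    have : k ≤ k₀ := by
      by_contra h
      simp [h] at hk
    exact ⟨(k₀ - k).toNat, by simp; omega⟩

lemma tsum_level_le {a : ℝ} (ha : 0 < a) (t : ℝ≥0∞) :
    ∑' k : ℤ, (if twoPow k ≤ t then twoPow (k * a) else 0) ≤ geomConst a * t ^ a := by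
  rcases eq_or_ne t ⊤ with rfl | ht
  · rw [ENNReal.top_rpow_of_pos ha, ENNReal.mul_top (by have := one_le_geomConst a; positivity)]
    exact le_top
  rcases eq_or_ne t 0 with rfl | h0
  · simp [twoPow_ne_zero]
  obtain ⟨τ, rfl⟩ := exists_eq_twoPow h0 ht
  have : ∀ k : ℤ, twoPow k ≤ twoPow τ ↔ k ≤ ⌊τ⌋ := fun k => by rw [twoPow_le, Int.le_floor]
  simp only [this]
  rw [tsum_int_le, mul_comm, twoPow_rpow]
  gcongr
  exact twoPow_le.2 (by gcongr; exact Int.floor_le τ)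

lemma tsum_level_lt_le {a : ℝ} (ha : 0 < a) (t : ℝ≥0∞) :
    ∑' k : ℤ, (if twoPow k < t then twoPow (k * a) else 0) ≤ geomConst a * t ^ a := by
  refine le_trans (ENNReal.tsum_le_tsum fun k => ?_) (tsum_level_le ha t)
  split_ifs with h1 h2
  · exact le_rfl
  · exact absurd h1.le h2
  · exact zero_le
  · exact le_rfl

/-- The inversion `t ↦ t⁻¹`, `k ↦ -k` reduces this to `tsum_level_le`; inversion in `ℝ≥0∞` also
covers the endpoints `0` and `⊤`. -/
lemma tsum_level_neg_le {b : ℝ} (hb : 0 < b) {t : ℝ≥0∞} :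
    ∑' k : ℤ, (if t ≤ twoPow k then twoPow (-(k * b)) else 0) ≤ geomConst b * t ^ (-b) := by
  have h := tsum_level_le hb t⁻¹
  rw [← (Equiv.neg ℤ).tsum_eq] at h
  rw [ENNReal.rpow_neg, ← ENNReal.inv_rpow]
  refine le_trans (le_of_eq (tsum_congr fun k => ?_)) h
  simp only [Equiv.neg_apply, Int.cast_neg, ← twoPow_inv, ENNReal.inv_le_inv, neg_mul]

/-- A single term suffices: the largest power of two strictly below `t` is at least `t / 2`, which
costs the factor `2 ^ a`. -/
lemma le_tsum_level {a : ℝ} (ha : 0 < a) (t : ℝ≥0∞) :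
    t ^ a ≤ twoPow a * ∑' k : ℤ, (if twoPow k < t then twoPow (k * a) else 0) := by
  rcases eq_or_ne t ⊤ with rfl | ht
  · have : ∑' k : ℤ, (if twoPow k < ⊤ then twoPow (k * a) else 0) = ⊤ := by
      refine eq_top_iff.2 ((ENNReal.tsum_const_eq_top_of_ne_zero (α := ℕ)
        (c := 1) one_ne_zero).symm.le.trans ?_)
      have hinj : Function.Injective (fun i : ℕ => (i : ℤ)) := Nat.cast_injective
      refine le_trans ?_ (ENNReal.tsum_comp_le_tsum_of_injective hinj _)
      refine ENNReal.tsum_le_tsum fun i => ?_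
      rw [if_pos (twoPow_ne_top _).lt_top, ← twoPow_zero, twoPow_le]
      positivity
    rw [this, ENNReal.mul_top (twoPow_ne_zero _)]
    exact le_top
  rcases eq_or_ne t 0 with rfl | h0
  · simp [ENNReal.zero_rpow_of_pos ha]
  obtain ⟨τ, rfl⟩ := exists_eq_twoPow h0 ht
  -- The index `⌈τ⌉ - 1`, not `⌊τ⌋`, is needed because the level condition is strict.
  have hk := ENNReal.le_tsum
    (f := fun k : ℤ => if twoPow k < twoPow τ then twoPow (k * a) else 0) (⌈τ⌉ - 1)
  have hlt : (((⌈τ⌉ - 1 : ℤ)) : ℝ) < τ := by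
    have := Int.ceil_lt_add_one τ
    push_cast; linarith
  rw [if_pos (twoPow_lt.2 hlt)] at hk
  refine le_trans ?_ (mul_le_mul_right hk _)
  rw [twoPow_rpow, ← twoPow_add, twoPow_le]
  have := Int.le_ceil τ
  push_cast
  nlinarith

section LayerCake

variable {α : Type*} [MeasurableSpace α] {μ : Measure α}

/-- Dyadic layer cake: with the reverse bound `tsum_le_lintegral_rpow`, every strong type estimate
reduces to distribution functions at powers of two. -/
lemma lintegral_rpow_le_tsum {h : α → ℝ≥0∞} (hh : Measurable h) {a : ℝ} (ha : 0 < a) :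
    ∫⁻ x, h x ^ a ∂μ ≤ twoPow a * ∑' k : ℤ, twoPow (k * a) * μ {x | twoPow k < h x} := by
  calc ∫⁻ x, h x ^ a ∂μ
      ≤ ∫⁻ x, twoPow a * ∑' k : ℤ, {x | twoPow k < h x}.indicator
          (fun _ => twoPow (k * a)) x ∂μ := by
        refine lintegral_mono fun x => ?_
        simpa [Set.indicator_apply] using le_tsum_level ha (h x)
    _ = _ := by
        rw [lintegral_const_mul' _ _ (twoPow_ne_top _), lintegral_tsum]
        · congr 1
          refine tsum_congr fun k => ?_
          rw [lintegral_indicator_const (measurableSet_lt measurable_const hh)]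
        · exact fun k => (measurable_const.indicator
            (measurableSet_lt measurable_const hh)).aemeasurable

lemma tsum_le_lintegral_rpow {h : α → ℝ≥0∞} (hh : Measurable h) {a : ℝ} (ha : 0 < a) :
    ∑' k : ℤ, twoPow (k * a) * μ {x | twoPow k < h x} ≤ geomConst a * ∫⁻ x, h x ^ a ∂μ := by
  calc ∑' k : ℤ, twoPow (k * a) * μ {x | twoPow k < h x}
      = ∫⁻ x, ∑' k : ℤ, {x | twoPow k < h x}.indicator (fun _ => twoPow (k * a)) x ∂μ := by
        rw [lintegral_tsum]
        · refine tsum_congr fun k => ?_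
          rw [lintegral_indicator_const (measurableSet_lt measurable_const hh)]
        · exact fun k => (measurable_const.indicator
            (measurableSet_lt measurable_const hh)).aemeasurable
    _ ≤ ∫⁻ x, geomConst a * h x ^ a ∂μ := by
        refine lintegral_mono fun x => ?_
        simpa [Set.indicator_apply] using tsum_level_lt_le ha (h x)
    _ = _ := lintegral_const_mul' _ _ (geomConst_ne_top ha)

end LayerCake

/-! ### Sums over the integers with polynomial decay -/

/-- The weight `1 / (1 + |n|)`. -/
def wt (n : ℤ) : ℝ≥0∞ := ((1 + n.natAbs : ℕ) : ℝ≥0∞)⁻¹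

lemma wt_ne_zero (n : ℤ) : wt n ≠ 0 := ENNReal.inv_ne_zero.2 (ENNReal.natCast_ne_top _)

lemma wt_ne_top (n : ℤ) : wt n ≠ ⊤ := ENNReal.inv_ne_top.2 (by positivity)

lemma wt_le_one (n : ℤ) : wt n ≤ 1 := by
  rw [wt, ENNReal.inv_le_one]
  exact_mod_cast Nat.le_add_right 1 _

lemma wt_neg (n : ℤ) : wt (-n) = wt n := by simp [wt]

lemma wt_eq_ofReal (n : ℤ) : wt n = ENNReal.ofReal (1 / (1 + |(n : ℝ)|)) := by
  rw [wt, one_div, ENNReal.ofReal_inv_of_pos (by positivity)]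
  congr 1
  rw [← ENNReal.ofReal_natCast]
  congr 1
  push_cast
  rw [Nat.cast_natAbs, Int.cast_abs]

lemma wt_pow_le {N M : ℕ} (h : N ≤ M) (n : ℤ) : wt n ^ M ≤ wt n ^ N :=
  pow_le_pow_right_of_le_one' (wt_le_one n) h

/-- The sum of the weights `1 / (1 + |n|) ^ 2`. -/
def wtSum : ℝ≥0∞ := ∑' n : ℤ, wt n ^ 2

lemma wtSum_ne_top : wtSum ≠ ⊤ := by
  have h1 : Summable fun n : ℕ => (1 / (1 + (n : ℝ))) ^ 2 := by
    have := (summable_nat_add_iff 1).2 (Real.summable_one_div_nat_pow (p := 2).2 (by norm_num))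
    refine this.congr fun n => ?_
    push_cast; rw [one_div_pow, add_comm]
  have h2 : Summable fun n : ℤ => (1 / (1 + |(n : ℝ)|)) ^ 2 := by
    refine Summable.of_nat_of_neg ?_ ?_
    · simpa using h1
    · simpa using h1
  rw [wtSum]
  have h3 : ∀ n : ℤ, wt n ^ 2 = ENNReal.ofReal ((1 / (1 + |(n : ℝ)|)) ^ 2) := fun n => by
    rw [wt_eq_ofReal, ENNReal.ofReal_pow (by positivity)]
  simp only [h3]
  rw [← ENNReal.ofReal_tsum_of_nonneg (fun n => by positivity) h2]
  exact ENNReal.ofReal_ne_top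

lemma tsum_wt_sub (i : ℤ) : ∑' n : ℤ, wt (n - i) ^ 2 = wtSum :=
  (Equiv.subRight i).tsum_eq (fun n => wt n ^ 2)

/-- A substitute for the triangle inequality valid for all `s > 0`. Two powers of the weight turn
the sum into a supremum, which commutes with `t ↦ t ^ s` and is then bounded by a sum. -/
lemma rpow_tsum_wt_le {s : ℝ} (hs : 0 < s) (b : ℕ) (t : ℤ → ℝ≥0∞) :
    (∑' m : ℤ, wt m ^ (2 + b) * t m) ^ s ≤
      wtSum ^ s * ∑' m : ℤ, (wt m ^ b) ^ s * t m ^ s := by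
  have h1 : ∑' m : ℤ, wt m ^ (2 + b) * t m ≤ wtSum * ⨆ m, wt m ^ b * t m := by
    rw [wtSum, ← ENNReal.tsum_mul_right]
    refine ENNReal.tsum_le_tsum fun m => ?_
    rw [pow_add, mul_assoc]
    gcongr
    exact le_iSup (fun m => wt m ^ b * t m) m
  calc (∑' m : ℤ, wt m ^ (2 + b) * t m) ^ s ≤ (wtSum * ⨆ m, wt m ^ b * t m) ^ s := by gcongr
    _ = wtSum ^ s * (⨆ m, wt m ^ b * t m) ^ s := ENNReal.mul_rpow_of_nonneg _ _ hs.le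
    _ = wtSum ^ s * ⨆ m, (wt m ^ b * t m) ^ s := by
        congr 1
        exact (ENNReal.orderIsoRpow s hs).map_iSup _
    _ ≤ _ := by
        gcongr
        refine iSup_le fun m => ?_
        rw [ENNReal.mul_rpow_of_nonneg _ _ hs.le]
        exact ENNReal.le_tsum (f := fun m => (wt m ^ b) ^ s * t m ^ s) m

/-! ### The logarithmic factor -/

/-- The logarithm to base two of `2 + |n|`. -/
def lg (n : ℤ) : ℝ≥0∞ := ENNReal.ofReal (Real.logb 2 (2 + |(n : ℝ)|))

lemma one_le_logb (n : ℤ) : 1 ≤ Real.logb 2 (2 + |(n : ℝ)|) := by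
  rw [Real.le_logb_iff_rpow_le (by norm_num) (by positivity)]
  simp

lemma one_le_lg (n : ℤ) : 1 ≤ lg n := by
  rw [lg, ENNReal.one_le_ofReal]; exact one_le_logb n

lemma lg_ne_top (n : ℤ) : lg n ≠ ⊤ := ENNReal.ofReal_ne_top

lemma lg_neg (n : ℤ) : lg (-n) = lg n := by simp [lg]

lemma lg_zero : lg 0 = 1 := by simp [lg]

/-- Since `2 + |n + m| ≤ (2 + |n|)(1 + |m|)`, the logarithm grows slowly in `m`. One power of the
weight `wt m` therefore pays for replacing the shift `n + m` by `n` in the tail sums. -/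
lemma lg_add_le (n m : ℤ) : lg (n + m) ≤ 2 * lg n * (wt m)⁻¹ := by
  have hn := one_le_logb n
  have hm : (wt m)⁻¹ = ENNReal.ofReal (1 + |(m : ℝ)|) := by
    rw [wt_eq_ofReal, one_div, ENNReal.ofReal_inv_of_pos (by positivity), inv_inv]
  have h2 : (2 : ℝ≥0∞) = ENNReal.ofReal 2 := by simp
  rw [hm, lg, lg, h2, ← ENNReal.ofReal_mul (by norm_num), ← ENNReal.ofReal_mul (by positivity)]
  refine ENNReal.ofReal_le_ofReal ?_
  have h3 : Real.logb 2 (2 + |((n + m : ℤ) : ℝ)|)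
      ≤ Real.logb 2 (2 + |(n : ℝ)|) + Real.logb 2 (1 + |(m : ℝ)|) := by
    rw [← Real.logb_mul (by positivity) (by positivity)]
    refine Real.logb_le_logb_of_le (by norm_num) (by positivity) ?_
    push_cast
    have := abs_add_le (n : ℝ) m
    nlinarith [abs_nonneg (n : ℝ), abs_nonneg (m : ℝ),
      mul_nonneg (abs_nonneg (n : ℝ)) (abs_nonneg (m : ℝ))]
  have h4 : Real.logb 2 (1 + |(m : ℝ)|) ≤ 2 * |(m : ℝ)| := by
    rw [Real.logb, div_le_iff₀ (Real.log_pos (by norm_num))]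
    have h5 := Real.log_le_sub_one_of_pos (show 0 < 1 + |(m : ℝ)| by positivity)
    have h6 := Real.log_two_gt_d9
    nlinarith [abs_nonneg (m : ℝ)]
  nlinarith [abs_nonneg (m : ℝ)]

/-! ### Half-open dyadic intervals -/

/-- The position of the dyadic interval of length `2 ^ k` that contains `x`. -/
def idx (k : ℤ) (x : ℝ) : ℤ := ⌊x / (2 : ℝ) ^ k⌋

/-- The half-open version of a dyadic interval. -/
def dset (J : DyadicInterval) : Set ℝ := {x | idx J.k x = J.m}

lemma mem_dset {J : DyadicInterval} {x : ℝ} : x ∈ dset J ↔ idx J.k x = J.m := Iff.rfl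

lemma idx_eq_iff {k m : ℤ} {x : ℝ} :
    idx k x = m ↔ (2 : ℝ) ^ k * m ≤ x ∧ x < (2 : ℝ) ^ k * (m + 1) := by
  have : (0 : ℝ) < 2 ^ k := by positivity
  rw [idx, Int.floor_eq_iff, le_div_iff₀ this, div_lt_iff₀ this, mul_comm, mul_comm (_ + 1)]

lemma dset_eq (J : DyadicInterval) :
    dset J = Set.Ico ((2 : ℝ) ^ J.k * J.m) ((2 : ℝ) ^ J.k * (J.m + 1)) := by
  ext x; exact idx_eq_iff

lemma measurableSet_dset (J : DyadicInterval) : MeasurableSet (dset J) := by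
  rw [dset_eq]; exact measurableSet_Ico

lemma measurable_idx (k : ℤ) : Measurable (idx k) :=
  Int.measurable_floor.comp (measurable_id.div_const _)

lemma twoPow_intCast (k : ℤ) : twoPow k = ENNReal.ofReal ((2 : ℝ) ^ k) := by
  rw [twoPow_eq_ofReal, Real.rpow_intCast]

lemma volume_dset (J : DyadicInterval) : volume (dset J) = twoPow J.k := by
  rw [dset_eq, Real.volume_Ico, twoPow_intCast]; congr 1; ring

/-- Nesting of the dyadic grids: the index at a coarser scale is an integer quotient of the finer
one, so it depends only on the finer cell. -/
lemma idx_add (k : ℤ) (j : ℕ) (x : ℝ) : idx (k + j) x = idx k x / 2 ^ j := by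
  have h := Int.floor_div_natCast (x / (2 : ℝ) ^ k) (2 ^ j)
  rw [idx, idx, zpow_add₀ (by norm_num), zpow_natCast, ← div_div]
  push_cast at h
  exact h

lemma idx_congr {k l : ℤ} (h : k ≤ l) {x y : ℝ} (hxy : idx k x = idx k y) :
    idx l x = idx l y := by
  obtain ⟨j, rfl⟩ := Int.le.dest h
  rw [idx_add, idx_add, hxy]

lemma left_mem_dset (J : DyadicInterval) : (2 : ℝ) ^ J.k * J.m ∈ dset J := by
  have : (0 : ℝ) < 2 ^ J.k := by positivity
  rw [dset_eq]; constructor <;> nlinarith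

/-- `Below J P` says that the dyadic interval `J` is contained in `P`. -/
def Below (J P : DyadicInterval) : Prop := J.k ≤ P.k ∧ dset J ⊆ dset P

lemma below_refl (J : DyadicInterval) : Below J J := ⟨le_rfl, subset_rfl⟩

lemma Below.trans {I J P : DyadicInterval} (h : Below I J) (h' : Below J P) : Below I P :=
  ⟨h.1.trans h'.1, h.2.trans h'.2⟩

lemma below_of_mem {J P : DyadicInterval} (h : J.k ≤ P.k) {x : ℝ} (hJ : x ∈ dset J)
    (hP : x ∈ dset P) : Below J P := by
  refine ⟨h, fun y hy => ?_⟩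
  rw [mem_dset] at *
  rw [← hP]
  exact idx_congr h (hy.trans hJ.symm)

lemma eq_of_mem {J P : DyadicInterval} (h : J.k = P.k) {x : ℝ} (hJ : x ∈ dset J)
    (hP : x ∈ dset P) : J = P := by
  rw [mem_dset] at *
  ext
  · exact h
  · rw [← hJ, ← hP, h]

lemma disjoint_of_k_eq {J P : DyadicInterval} (h : J.k = P.k) (hne : J ≠ P) :
    Disjoint (dset J) (dset P) :=
  Set.disjoint_left.2 fun _ hJ hP => hne (eq_of_mem h hJ hP)

lemma Below.eq_of_k_eq {J P : DyadicInterval} (h : Below J P) (hk : J.k = P.k) : J = P :=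
  eq_of_mem hk (left_mem_dset J) (h.2 (left_mem_dset J))

instance : DecidableEq DyadicInterval := Classical.decEq _

instance : Countable DyadicInterval :=
  Function.Injective.countable (f := fun J : DyadicInterval => (J.k, J.m)) fun J P h => by
    ext
    · exact (Prod.ext_iff.1 h).1
    · exact (Prod.ext_iff.1 h).2

lemma shift_shift (J : DyadicInterval) (n m : ℤ) : (J.shift n).shift m = J.shift (n + m) := by
  ext <;> simp [DyadicInterval.shift, sub_sub]

lemma shift_zero (J : DyadicInterval) : J.shift 0 = J := by
  ext <;> simp [DyadicInterval.shift]

lemma shift_injective (n : ℤ) : Function.Injective (fun J : DyadicInterval => J.shift n) := by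
  intro J P h
  have := congrArg (fun J : DyadicInterval => J.shift (-n)) h
  simpa [shift_shift, shift_zero] using this

lemma shift_k (J : DyadicInterval) (n : ℤ) : (J.shift n).k = J.k := rfl

lemma shift_m (J : DyadicInterval) (n : ℤ) : (J.shift n).m = J.m - n := rfl

lemma lintegral_eq_tsum_dset (k : ℤ) (g : ℝ → ℝ≥0∞) :
    ∫⁻ x, g x = ∑' m : ℤ, ∫⁻ x in dset ⟨k, m⟩, g x := by
  rw [← lintegral_iUnion (fun m => measurableSet_dset _)]
  · have : ⋃ m : ℤ, dset ⟨k, m⟩ = Set.univ := by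
      ext x; simp [mem_dset]
    rw [this, Measure.restrict_univ]
  · intro m m' h
    exact disjoint_of_k_eq rfl (by simpa using h)

/-- The union of a family of dyadic intervals. -/
def dUnion (D : Set DyadicInterval) : Set ℝ := ⋃ J ∈ D, dset J

lemma mem_dUnion {D : Set DyadicInterval} {x : ℝ} : x ∈ dUnion D ↔ ∃ J ∈ D, x ∈ dset J := by
  simp [dUnion]

lemma measurableSet_dUnion (D : Set DyadicInterval) : MeasurableSet (dUnion D) :=
  MeasurableSet.iUnion fun J => MeasurableSet.iUnion fun _ => measurableSet_dset J

lemma dset_subset_dUnion {D : Set DyadicInterval} {J : DyadicInterval} (h : J ∈ D) :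
    dset J ⊆ dUnion D := fun _ hx => mem_dUnion.2 ⟨J, h, hx⟩

/-- The maximal elements of a family of dyadic intervals. -/
def maximals (D : Set DyadicInterval) : Set DyadicInterval :=
  {P | P ∈ D ∧ ∀ Q ∈ D, Below P Q → Q = P}

lemma pairwiseDisjoint_maximals (D : Set DyadicInterval) :
    (maximals D).PairwiseDisjoint dset := by
  intro P hP Q hQ hne
  refine Set.disjoint_left.2 fun x hxP hxQ => hne ?_
  rcases le_total P.k Q.k with h | h
  · exact (hP.2 Q hQ.1 (below_of_mem h hxP hxQ)).symm
  · exact hQ.2 P hP.1 (below_of_mem h hxQ hxP)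

/-- A bound on the scales excludes infinite increasing chains; among the members of `D` above `J`,
one of the greatest scale is maximal. -/
lemma exists_maximals {D : Set DyadicInterval} {K : ℤ} (hK : ∀ J ∈ D, J.k ≤ K)
    {J : DyadicInterval} (hJ : J ∈ D) : ∃ P ∈ maximals D, Below J P := by
  obtain ⟨k, ⟨P, hPD, hJP, rfl⟩, hmax⟩ := Int.exists_greatest_of_bdd
    (P := fun k => ∃ P ∈ D, Below J P ∧ P.k = k)
    ⟨K, by rintro _ ⟨P, hP, -, rfl⟩; exact hK P hP⟩ ⟨J.k, J, hJ, below_refl J, rfl⟩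
  refine ⟨P, ⟨hPD, fun Q hQ hPQ => ?_⟩, hJP⟩
  have := hmax Q.k ⟨Q, hQ, hJP.trans hPQ, rfl⟩
  exact (hPQ.eq_of_k_eq (le_antisymm hPQ.1 this)).symm

lemma dUnion_maximals {D : Set DyadicInterval} {K : ℤ} (hK : ∀ J ∈ D, J.k ≤ K) :
    dUnion (maximals D) = dUnion D := by
  ext x
  simp only [mem_dUnion]
  constructor
  · rintro ⟨J, hJ, hx⟩
    exact ⟨J, hJ.1, hx⟩
  · rintro ⟨J, hJ, hx⟩
    obtain ⟨P, hP, hJP⟩ := exists_maximals hK hJ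
    exact ⟨P, hP, hJP.2 hx⟩

lemma lintegral_dUnion_maximals (D : Set DyadicInterval) (g : ℝ → ℝ≥0∞) :
    ∫⁻ x in dUnion (maximals D), g x = ∑' P : maximals D, ∫⁻ x in dset P, g x := by
  rw [dUnion, lintegral_biUnion (Set.to_countable _) (fun J _ => measurableSet_dset J)
    (pairwiseDisjoint_maximals D)]

lemma volume_dUnion_maximals (D : Set DyadicInterval) :
    volume (dUnion (maximals D)) = ∑' P : maximals D, twoPow (P : DyadicInterval).k := by
  rw [dUnion, measure_biUnion (Set.to_countable _) (pairwiseDisjoint_maximals D)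
    (fun J _ => measurableSet_dset J)]
  simp only [volume_dset]

/-- If `g` has mean at least `c` over each interval of a family of bounded length, then it has mean
at least `c` over their union. -/
lemma mul_volume_dUnion_le {D : Set DyadicInterval} {K : ℤ} (hK : ∀ J ∈ D, J.k ≤ K)
    {g : ℝ → ℝ≥0∞} {c : ℝ≥0∞} (h : ∀ J ∈ D, c * twoPow J.k ≤ ∫⁻ x in dset J, g x) :
    c * volume (dUnion D) ≤ ∫⁻ x in dUnion D, g x := by
  rw [← dUnion_maximals hK, volume_dUnion_maximals, lintegral_dUnion_maximals,
    ← ENNReal.tsum_mul_left]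
  exact ENNReal.tsum_le_tsum fun P => h P P.2.1

/-! ### Shifted dyadic intervals -/

lemma add_mem_dset_iff {J : DyadicInterval} {n : ℤ} {x : ℝ} :
    x ∈ dset (J.shift n) ↔ x + n * (2 : ℝ) ^ J.k ∈ dset J := by
  rw [mem_dset, mem_dset, shift_k, shift_m, idx_eq_iff, idx_eq_iff]
  push_cast
  constructor <;> rintro ⟨h1, h2⟩ <;> constructor <;> nlinarith

/-- The union of the three neighbours of a dyadic interval. -/
def triple (P : DyadicInterval) : Set ℝ := {x | |idx P.k x - P.m| ≤ 1}

lemma measurableSet_triple (P : DyadicInterval) : MeasurableSet (triple P) :=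
  (measurable_idx P.k) (t := {i | |i - P.m| ≤ 1}) trivial

lemma triple_eq (P : DyadicInterval) :
    triple P = dset (P.shift (-1)) ∪ dset P ∪ dset (P.shift 1) := by
  ext x
  simp only [triple, Set.mem_ofPred_eq, Set.mem_union, mem_dset, shift_k, shift_m, abs_le]
  omega

lemma volume_triple_le (P : DyadicInterval) : volume (triple P) ≤ 3 * twoPow P.k := by
  rw [triple_eq]
  calc _ ≤ volume (dset (P.shift (-1))) + volume (dset P) + volume (dset (P.shift 1)) :=
        (measure_union_le _ _).trans (by gcongr; exact measure_union_le _ _)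
    _ = _ := by simp only [volume_dset, shift_k]; ring

lemma mem_triple_of_abs_le {P : DyadicInterval} {x y : ℝ} (hy : y ∈ dset P)
    (h : |x - y| ≤ (2 : ℝ) ^ P.k) : x ∈ triple P := by
  have h0 : (0 : ℝ) < 2 ^ P.k := by positivity
  rw [mem_dset, idx_eq_iff] at hy
  obtain ⟨h1, h2⟩ := idx_eq_iff.1 (rfl : idx P.k x = idx P.k x)
  rw [abs_le] at h
  have h3 : (2 : ℝ) ^ P.k * (idx P.k x : ℝ) < 2 ^ P.k * (P.m + 2) := by nlinarith
  have h4 : (2 : ℝ) ^ P.k * (P.m - 1 : ℝ) < 2 ^ P.k * (idx P.k x + 1) := by nlinarith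
  have h5 := lt_of_mul_lt_mul_left h3 h0.le
  have h6 := lt_of_mul_lt_mul_left h4 h0.le
  have h5' : idx P.k x < P.m + 2 := by exact_mod_cast h5
  have h6' : P.m - 1 < idx P.k x + 1 := by exact_mod_cast h6
  simp only [triple, Set.mem_ofPred_eq, abs_le]
  omega

/-- This is where the logarithm originates. All `J ⊆ P` with `|J| = 2 ^ (-j) |P|` are moved by the
same amount, so their shifts lie in one translate of `P`. The translates with `2 ^ j ≥ |n|` move by
at most `|P|` and stay in the triple of `P`. -/
lemma volume_iUnion_shift_below_le (P : DyadicInterval) (n : ℤ) :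
    volume (⋃ J ∈ {J | Below J P}, dset (J.shift n)) ≤ 5 * lg n * twoPow P.k := by
  -- This cutoff guarantees `|n| < 2 ^ j` for every `j ≥ L`.
  set L := Nat.log 2 n.natAbs + 1 with hL
  have hsub : (⋃ J ∈ {J | Below J P}, dset (J.shift n)) ⊆
      (⋃ j ∈ Finset.range L, (fun x => x + n * (2 : ℝ) ^ (P.k - j)) ⁻¹' dset P) ∪ triple P := by
    intro x hx
    simp only [Set.mem_iUnion, Set.mem_ofPred_eq] at hx
    obtain ⟨J, hJ, hx⟩ := hx
    have hy := hJ.2 (add_mem_dset_iff.1 hx)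
    obtain ⟨j, hj⟩ := Int.le.dest hJ.1
    have hk : J.k = P.k - j := by omega
    by_cases hjL : j < L
    · left
      simp only [Set.mem_iUnion]
      exact ⟨j, Finset.mem_range.2 hjL, by rw [← hk]; exact hy⟩
    · right
      refine mem_triple_of_abs_le hy ?_
      have h1 : n.natAbs < 2 ^ j :=
        (Nat.lt_pow_succ_log_self (by norm_num) _).trans_le
          (Nat.pow_le_pow_right (by norm_num) (not_lt.1 hjL))
      have h2 : |(n : ℝ)| ≤ 2 ^ j := by
        rw [← Int.cast_abs, Int.abs_eq_natAbs]
        exact_mod_cast h1.le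
      have h3 : (0 : ℝ) < 2 ^ J.k := by positivity
      rw [show x - (x + n * (2 : ℝ) ^ J.k) = -(n * (2 : ℝ) ^ J.k) by ring, abs_neg, abs_mul,
        abs_of_pos h3, ← hj, zpow_add₀ (by norm_num), zpow_natCast, mul_comm]
      gcongr
  -- Here `L` counts the translates of `P` and `3` the triple; the additive constants are absorbed
  -- because `lg n ≥ 1`.
  have hlog : (L : ℝ≥0∞) + 3 ≤ 5 * lg n := by
    have h1 : (Nat.log 2 n.natAbs : ℝ) ≤ Real.logb 2 (2 + |(n : ℝ)|) := by
      rcases Nat.eq_zero_or_pos n.natAbs with h | h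
      · rw [h]; simp; linarith [one_le_logb n]
      · refine (Real.natLog_le_logb _ _).trans ?_
        refine Real.logb_le_logb_of_le (by norm_num) (by exact_mod_cast h) ?_
        rw [Nat.cast_natAbs, Int.cast_abs]; linarith
    have h2 := one_le_logb n
    have h3 : (L : ℝ≥0∞) + 3 = ENNReal.ofReal (Nat.log 2 n.natAbs + 4 : ℝ) := by
      rw [show (Nat.log 2 n.natAbs + 4 : ℝ) = ((L + 3 : ℕ) : ℝ) by rw [hL]; push_cast; ring,
        ENNReal.ofReal_natCast]
      push_cast; rfl
    have h5 : (5 : ℝ≥0∞) = ENNReal.ofReal 5 := by simp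
    rw [h3, lg, h5, ← ENNReal.ofReal_mul (by norm_num)]
    refine ENNReal.ofReal_le_ofReal ?_
    linarith
  calc _ ≤ volume (⋃ j ∈ Finset.range L,
          (fun x => x + n * (2 : ℝ) ^ (P.k - j)) ⁻¹' dset P) + volume (triple P) :=
        (measure_mono hsub).trans (measure_union_le _ _)
    _ ≤ ∑ j ∈ Finset.range L, twoPow P.k + 3 * twoPow P.k := by
        refine add_le_add ((measure_biUnion_finset_le _ _).trans_eq ?_) (volume_triple_le P)
        refine Finset.sum_congr rfl fun j _ => ?_
        rw [measure_preimage_add_right, volume_dset]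
    _ = (L + 3) * twoPow P.k := by
        rw [Finset.sum_const, Finset.card_range, nsmul_eq_mul]; ring
    _ ≤ _ := by gcongr

/-- Shifting all the intervals of a family by `n` units of their length enlarges the union at most
by a factor of order `log (2 + |n|)`. -/
lemma volume_dUnion_shift_le {D : Set DyadicInterval} {K : ℤ} (hK : ∀ J ∈ D, J.k ≤ K) (n : ℤ) :
    volume (⋃ J ∈ D, dset (J.shift n)) ≤ 5 * lg n * volume (dUnion D) := by
  have hsub : (⋃ J ∈ D, dset (J.shift n)) ⊆
      ⋃ P : maximals D, ⋃ J ∈ {J | Below J P}, dset (J.shift n) := by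
    intro x hx
    simp only [Set.mem_iUnion] at hx ⊢
    obtain ⟨J, hJ, hx⟩ := hx
    obtain ⟨P, hP, hJP⟩ := exists_maximals hK hJ
    exact ⟨⟨P, hP⟩, J, hJP, hx⟩
  refine (measure_mono hsub).trans ((measure_iUnion_le _).trans ?_)
  rw [← dUnion_maximals hK, volume_dUnion_maximals, ← ENNReal.tsum_mul_left]
  exact ENNReal.tsum_le_tsum fun P => volume_iUnion_shift_below_le P n

lemma dUnion_image_shift (D : Set DyadicInterval) (n : ℤ) :
    dUnion ((fun J => J.shift n) '' D) = ⋃ J ∈ D, dset (J.shift n) := by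
  simp [dUnion]

/-- The weak type estimate for shifted averages. -/
lemma mul_volume_dUnion_le_lintegral {D : Set DyadicInterval} {n : ℤ} {g : ℝ → ℝ≥0∞} {c : ℝ≥0∞}
    (h : ∀ J ∈ D, c * twoPow J.k ≤ ∫⁻ x in dset (J.shift n), g x) :
    c * volume (dUnion D) ≤ 5 * lg n * ∫⁻ x, g x := by
  -- Maximal elements require bounded scales, so the estimate is first proved for truncated families
  -- and then passed to the monotone limit.
  have hb : ∀ K : ℕ, c * volume (dUnion {J ∈ D | J.k ≤ K}) ≤ 5 * lg n * ∫⁻ x, g x := by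
    intro K
    set E := (fun J : DyadicInterval => J.shift n) '' {J ∈ D | J.k ≤ K} with hE
    have hEK : ∀ J ∈ E, J.k ≤ K := by
      rintro _ ⟨J, hJ, rfl⟩; exact hJ.2
    have h1 : c * volume (dUnion E) ≤ ∫⁻ x in dUnion E, g x := by
      refine mul_volume_dUnion_le hEK ?_
      rintro _ ⟨J, hJ, rfl⟩
      exact h J hJ.1
    -- The means are large on the shifted intervals, whose union is therefore small; shifting back
    -- by `-n` recovers the original family at the cost of the logarithm.
    have h2 := volume_dUnion_shift_le hEK (-n)
    have h3 : (⋃ J ∈ E, dset (J.shift (-n))) = dUnion {J ∈ D | J.k ≤ K} := by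
      rw [← dUnion_image_shift, hE, Set.image_image]
      simp [shift_shift, shift_zero]
    rw [h3, lg_neg] at h2
    calc _ ≤ c * (5 * lg n * volume (dUnion E)) := by gcongr
      _ = 5 * lg n * (c * volume (dUnion E)) := by ring
      _ ≤ 5 * lg n * ∫⁻ x, g x := by
          gcongr
          exact h1.trans (setLIntegral_le_lintegral _ _)
  have hU : dUnion D = ⋃ K : ℕ, dUnion {J ∈ D | J.k ≤ K} := by
    ext x
    simp only [mem_dUnion, Set.mem_iUnion, Set.mem_ofPred_eq]
    constructor
    · rintro ⟨J, hJ, hx⟩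
      exact ⟨J.k.toNat, J, ⟨hJ, Int.self_le_toNat _⟩, hx⟩
    · rintro ⟨K, J, ⟨hJ, -⟩, hx⟩
      exact ⟨J, hJ, hx⟩
  rw [hU, Monotone.measure_iUnion, ENNReal.mul_iSup]
  · exact iSup_le hb
  · intro K K' hKK' x hx
    obtain ⟨J, ⟨hJ, hJK⟩, hx⟩ := mem_dUnion.1 hx
    exact mem_dUnion.2 ⟨J, ⟨hJ, hJK.trans (by exact_mod_cast hKK')⟩, hx⟩

/-! ### Shifted maximal functions -/

/-- The shifted dyadic maximal function: the supremum, over the intervals `P ∋ x` of a family, of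
the mean of `h` over the shift of `P` by `n` units of its length. -/
def maxFn (D : Set DyadicInterval) (n : ℤ) (h : ℝ → ℝ≥0∞) (x : ℝ) : ℝ≥0∞ :=
  ⨆ P ∈ D, (dset P).indicator (fun _ => twoPow (-P.k) * ∫⁻ y in dset (P.shift n), h y) x

lemma measurable_maxFn (D : Set DyadicInterval) (n : ℤ) (h : ℝ → ℝ≥0∞) :
    Measurable (maxFn D n h) :=
  Measurable.iSup fun P => Measurable.iSup fun _ =>
    measurable_const.indicator (measurableSet_dset P)

lemma le_maxFn {D : Set DyadicInterval} {n : ℤ} {h : ℝ → ℝ≥0∞} {x : ℝ} {P : DyadicInterval}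
    (hP : P ∈ D) (hx : x ∈ dset P) :
    twoPow (-P.k) * ∫⁻ y in dset (P.shift n), h y ≤ maxFn D n h x := by
  refine le_trans ?_ (le_iSup₂ (f := fun P (_ : P ∈ D) => (dset P).indicator
    (fun _ => twoPow (-P.k) * ∫⁻ y in dset (P.shift n), h y) x) P hP)
  rw [Set.indicator_of_mem hx]

/-- Superlevel sets of the maximal function are unions of dyadic intervals, so the weak type
estimate for unions applies directly. -/
lemma lt_maxFn_iff {D : Set DyadicInterval} {n : ℤ} {h : ℝ → ℝ≥0∞} {x : ℝ} {c : ℝ≥0∞} :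
    c < maxFn D n h x ↔ x ∈ dUnion
      {P ∈ D | c < twoPow (-P.k) * ∫⁻ y in dset (P.shift n), h y} := by
  simp only [maxFn, lt_iSup_iff, mem_dUnion, Set.mem_ofPred_eq, exists_prop]
  constructor
  · rintro ⟨P, hP, hx⟩
    by_cases hxP : x ∈ dset P
    · exact ⟨P, ⟨hP, by rwa [Set.indicator_of_mem hxP] at hx⟩, hxP⟩
    · rw [Set.indicator_of_notMem hxP] at hx
      simp at hx
  · rintro ⟨P, ⟨hP, hx⟩, hxP⟩
    exact ⟨P, hP, by rwa [Set.indicator_of_mem hxP]⟩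

lemma twoPow_mul_neg (t : ℝ) : twoPow t * twoPow (-t) = 1 := by
  rw [← twoPow_add, add_neg_cancel, twoPow_zero]

/-- Truncation at half the height: the part of `h` below `2 ^ k` contributes at most half of a mean
exceeding `2 ^ (k + 1)`, so the part above `2 ^ k` still has mean at least `2 ^ k`. -/
lemma volume_lt_maxFn_le (D : Set DyadicInterval) (n k : ℤ) {h : ℝ → ℝ≥0∞} (hh : Measurable h) :
    twoPow k * volume {x | twoPow (k + 1) < maxFn D n h x} ≤
      5 * lg n * ∫⁻ x, {x | twoPow k < h x}.indicator h x := by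
  simp only [lt_maxFn_iff, Set.ofPred_mem_eq]
  refine mul_volume_dUnion_le_lintegral ?_
  rintro J ⟨-, hJ⟩
  have hm : MeasurableSet {x | twoPow k < h x} := measurableSet_lt measurable_const hh
  have h1 : ∫⁻ y in dset (J.shift n), h y ≤
      twoPow k * twoPow J.k + ∫⁻ y in dset (J.shift n), {x | twoPow k < h x}.indicator h y := by
    calc ∫⁻ y in dset (J.shift n), h y
        ≤ ∫⁻ y in dset (J.shift n), (twoPow k + {x | twoPow k < h x}.indicator h y) := by
          refine lintegral_mono fun y => ?_
          by_cases hy : twoPow k < h y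
          · rw [Set.indicator_of_mem (by exact hy)]; exact le_add_self
          · exact (not_lt.1 hy).trans le_self_add
      _ = _ := by
          rw [lintegral_add_left measurable_const, setLIntegral_const, volume_dset, shift_k]
  have h2 : twoPow (k + 1) * twoPow J.k < ∫⁻ y in dset (J.shift n), h y := by
    have := ENNReal.mul_lt_mul_left (twoPow_ne_zero J.k) (twoPow_ne_top _) hJ
    rwa [mul_right_comm, mul_comm (twoPow (-(J.k : ℝ))), twoPow_mul_neg, one_mul] at this
  rw [twoPow_add, twoPow_one] at h2
  have h3 := h2.le.trans h1
  rw [show twoPow k * 2 * twoPow J.k = twoPow k * twoPow J.k + twoPow k * twoPow J.k by ring] at h3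
  exact (ENNReal.add_le_add_iff_left
    (ENNReal.mul_ne_top (twoPow_ne_top _) (twoPow_ne_top _))).1 h3

/-- Marcinkiewicz interpolation by hand between the weak (1,1) bound and the trivial `L^∞` bound:
the truncated estimates are summed over all heights, and the series in `k` converges because `p >
1`. -/
lemma lintegral_maxFn_rpow_le {p : ℝ} (hp : 1 < p) (D : Set DyadicInterval) (n : ℤ)
    {h : ℝ → ℝ≥0∞} (hh : Measurable h) :
    ∫⁻ x, maxFn D n h x ^ p ≤
      twoPow (2 * p) * 5 * geomConst (p - 1) * lg n * ∫⁻ x, h x ^ p := by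
  have hp0 : 0 < p := by linarith
  refine (lintegral_rpow_le_tsum (measurable_maxFn D n h) hp0).trans ?_
  -- The truncated estimate speaks of the height `2 ^ (k + 1)`, hence the change of index.
  rw [← (Equiv.addRight (1 : ℤ)).tsum_eq]
  have hterm : ∀ k : ℤ, twoPow (((Equiv.addRight (1 : ℤ)) k : ℤ) * p) *
      volume {x | twoPow ((Equiv.addRight (1 : ℤ)) k : ℤ) < maxFn D n h x} ≤
      twoPow p * 5 * lg n * ∫⁻ x, twoPow (k * (p - 1)) * {x | twoPow k < h x}.indicator h x := by
    intro k
    have hk := volume_lt_maxFn_le D n k hh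
    rw [lintegral_const_mul' _ _ (twoPow_ne_top _)]
    simp only [Equiv.coe_addRight, Int.cast_add, Int.cast_one]
    calc _ = twoPow p * twoPow (k * (p - 1)) *
          (twoPow k * volume {x | twoPow (k + 1) < maxFn D n h x}) := by
          rw [← mul_assoc, ← twoPow_add, ← twoPow_add]; congr 2; ring
      _ ≤ twoPow p * twoPow (k * (p - 1)) *
          (5 * lg n * ∫⁻ x, {x | twoPow k < h x}.indicator h x) := by gcongr
      _ = _ := by ring
  calc _ ≤ twoPow p * ∑' k : ℤ, twoPow p * 5 * lg n *
          ∫⁻ x, twoPow (k * (p - 1)) * {x | twoPow k < h x}.indicator h x := by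
        exact mul_le_mul_right (ENNReal.tsum_le_tsum hterm) _
    _ = twoPow p * (twoPow p * 5 * lg n * ∫⁻ x, ∑' k : ℤ,
          twoPow (k * (p - 1)) * {x | twoPow k < h x}.indicator h x) := by
        rw [ENNReal.tsum_mul_left, lintegral_tsum]
        exact fun k => (measurable_const.mul
          (hh.indicator (measurableSet_lt measurable_const hh))).aemeasurable
    _ ≤ twoPow p * (twoPow p * 5 * lg n * ∫⁻ x, geomConst (p - 1) * h x ^ p) := by
        gcongr with x
        calc ∑' k : ℤ, twoPow (k * (p - 1)) * {x | twoPow k < h x}.indicator h x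
            = (∑' k : ℤ, (if twoPow k < h x then twoPow (k * (p - 1)) else 0)) * h x := by
              rw [← ENNReal.tsum_mul_right]
              refine tsum_congr fun k => ?_
              by_cases hk : twoPow k < h x <;> simp [hk]
          _ ≤ geomConst (p - 1) * h x ^ (p - 1) * h x := by
              gcongr; exact tsum_level_lt_le (by linarith) _
          _ = geomConst (p - 1) * h x ^ p := by
              rw [mul_assoc]
              congr 1
              conv_lhs => rw [← ENNReal.rpow_one (h x), ← ENNReal.rpow_mul, one_mul]
              rw [← ENNReal.rpow_add_of_nonneg _ _ (by linarith) (by norm_num)]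
              congr 1; ring
    _ = _ := by
        rw [lintegral_const_mul' _ _ (geomConst_ne_top (by linarith)),
          show 2 * p = p + p by ring, twoPow_add]
        ring

/-! ### Maximal functions with tails -/

/-- The decaying weight attached to a dyadic interval. -/
def wtAt (P : DyadicInterval) (y : ℝ) : ℝ≥0∞ := wt (idx P.k y - P.m)

lemma measurable_wtAt (P : DyadicInterval) : Measurable (wtAt P) :=
  (measurable_from_top (f := fun i : ℤ => wt (i - P.m))).comp (measurable_idx P.k)

lemma wtAt_of_mem_shift {P : DyadicInterval} {i : ℤ} {y : ℝ} (h : y ∈ dset (P.shift i)) :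
    wtAt P y = wt i := by
  rw [mem_dset, shift_k, shift_m] at h
  rw [wtAt, h, show P.m - i - P.m = -i by ring, wt_neg]

lemma lintegral_mul_wtAt (P : DyadicInterval) (N : ℕ) (h : ℝ → ℝ≥0∞) :
    ∫⁻ y, h y * wtAt P y ^ N = ∑' i : ℤ, wt i ^ N * ∫⁻ y in dset (P.shift i), h y := by
  rw [lintegral_eq_tsum_dset P.k, ← (Equiv.subLeft P.m).tsum_eq]
  refine tsum_congr fun i => ?_
  rw [← lintegral_const_mul' _ _ (ENNReal.pow_ne_top (wt_ne_top i))]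
  refine setLIntegral_congr_fun (measurableSet_dset _) fun y hy => ?_
  rw [wtAt_of_mem_shift (i := i) hy, mul_comm]

lemma lintegral_wtAt_sq (P : DyadicInterval) :
    ∫⁻ y, wtAt P y ^ 2 = wtSum * twoPow P.k := by
  have := lintegral_mul_wtAt P 2 (fun _ => 1)
  simp only [one_mul, setLIntegral_one, volume_dset, shift_k] at this
  rw [this, ENNReal.tsum_mul_right, wtSum]

lemma wtAt_le_one (P : DyadicInterval) (y : ℝ) : wtAt P y ≤ 1 := wt_le_one _

/-- The shifted maximal function in which the mean over an interval is replaced by a mean with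
respect to a polynomially decaying weight. -/
def tailMax (D : Set DyadicInterval) (n : ℤ) (h : ℝ → ℝ≥0∞) (x : ℝ) : ℝ≥0∞ :=
  ⨆ P ∈ D, (dset P).indicator
    (fun _ => twoPow (-P.k) * ∫⁻ y, h y * wtAt (P.shift n) y ^ 5) x

lemma measurable_tailMax (D : Set DyadicInterval) (n : ℤ) (h : ℝ → ℝ≥0∞) :
    Measurable (tailMax D n h) :=
  Measurable.iSup fun P => Measurable.iSup fun _ =>
    measurable_const.indicator (measurableSet_dset P)

lemma le_tailMax {D : Set DyadicInterval} {n : ℤ} {h : ℝ → ℝ≥0∞} {x : ℝ} {P : DyadicInterval}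
    (hP : P ∈ D) (hx : x ∈ dset P) :
    twoPow (-P.k) * ∫⁻ y, h y * wtAt (P.shift n) y ^ 5 ≤ tailMax D n h x := by
  refine le_trans ?_ (le_iSup₂ (f := fun P (_ : P ∈ D) => (dset P).indicator
    (fun _ => twoPow (-P.k) * ∫⁻ y, h y * wtAt (P.shift n) y ^ 5) x) P hP)
  rw [Set.indicator_of_mem hx]

/-- The weight is constant on each translate of `P.shift n`, so a weighted mean is a combination of
means over further shifts. The exponent is written `2 + 3` for `rpow_tsum_wt_le`. -/
lemma tailMax_le_tsum (D : Set DyadicInterval) (n : ℤ) (h : ℝ → ℝ≥0∞) (x : ℝ) :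
    tailMax D n h x ≤ ∑' i : ℤ, wt i ^ (2 + 3) * maxFn D (n + i) h x := by
  refine iSup₂_le fun P hP => ?_
  by_cases hx : x ∈ dset P
  · rw [Set.indicator_of_mem hx, lintegral_mul_wtAt, ← ENNReal.tsum_mul_left]
    refine ENNReal.tsum_le_tsum fun i => ?_
    rw [shift_shift, mul_left_comm]
    gcongr
    exact le_maxFn hP hx
  · rw [Set.indicator_of_notMem hx]
    exact zero_le

/-- The tails involve all shifts `n + i`, whose bounds grow like `lg (n + i)`; the decay in `i`
absorbs this growth and leaves only `lg n`. -/
lemma exists_lintegral_tailMax_rpow_le {p : ℝ} (hp : 1 < p) :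
    ∃ C : ℝ≥0∞, C ≠ ⊤ ∧ ∀ (D : Set DyadicInterval) (n : ℤ) (h : ℝ → ℝ≥0∞), Measurable h →
      ∫⁻ x, tailMax D n h x ^ p ≤ C * lg n * ∫⁻ x, h x ^ p := by
  have hp0 : 0 < p := by linarith
  set K := twoPow (2 * p) * 5 * geomConst (p - 1) with hK
  have hKt : K ≠ ⊤ := ENNReal.mul_ne_top (ENNReal.mul_ne_top (twoPow_ne_top _) (by norm_num))
    (geomConst_ne_top (by linarith))
  refine ⟨wtSum ^ p * (2 * K * wtSum), ENNReal.mul_ne_top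
    (ENNReal.rpow_ne_top_of_nonneg hp0.le wtSum_ne_top)
    (ENNReal.mul_ne_top (ENNReal.mul_ne_top (by norm_num) hKt) wtSum_ne_top),
    fun D n h hh => ?_⟩
  calc ∫⁻ x, tailMax D n h x ^ p
      ≤ ∫⁻ x, wtSum ^ p * ∑' i : ℤ, (wt i ^ 3) ^ p * maxFn D (n + i) h x ^ p := by
        refine lintegral_mono fun x => ?_
        refine le_trans ?_ (rpow_tsum_wt_le hp0 3 _)
        gcongr
        exact tailMax_le_tsum D n h x
    _ = wtSum ^ p * ∑' i : ℤ, (wt i ^ 3) ^ p * ∫⁻ x, maxFn D (n + i) h x ^ p := by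
        rw [lintegral_const_mul' _ _ (ENNReal.rpow_ne_top_of_nonneg hp0.le wtSum_ne_top),
          lintegral_tsum]
        · congr 1
          refine tsum_congr fun i => ?_
          rw [lintegral_const_mul _ ((measurable_maxFn D (n + i) h).pow_const p)]
        · exact fun i => (((measurable_maxFn D (n + i) h).pow_const p).const_mul _).aemeasurable
    _ ≤ wtSum ^ p * ∑' i : ℤ, wt i ^ 2 * (2 * K * lg n * ∫⁻ x, h x ^ p) := by
        refine mul_le_mul_right (ENNReal.tsum_le_tsum fun i => ?_) _
        -- Of the three remaining powers, one cancels the loss in `lg_add_le` and two make the sum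
        -- over `i` finite.
        have h1 : (wt i ^ 3) ^ p ≤ wt i ^ 3 :=
          ENNReal.rpow_le_self_of_le_one (pow_le_one₀ zero_le (wt_le_one i)) hp.le
        calc (wt i ^ 3) ^ p * ∫⁻ x, maxFn D (n + i) h x ^ p
            ≤ wt i ^ 3 * (K * (2 * lg n * (wt i)⁻¹) * ∫⁻ x, h x ^ p) := by
              gcongr
              refine (lintegral_maxFn_rpow_le hp D (n + i) hh).trans ?_
              gcongr
              exact lg_add_le n i
          _ = wt i ^ 2 * (wt i * (wt i)⁻¹) * (2 * K * lg n * ∫⁻ x, h x ^ p) := by ring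
          _ = _ := by rw [ENNReal.mul_inv_cancel (wt_ne_zero i) (wt_ne_top i), mul_one]
    _ = _ := by
        rw [ENNReal.tsum_mul_right, ← wtSum]; ring

/-! ### A decomposition of families of dyadic intervals by levels -/

/-- The step function `∑ c J 1_J`. -/
def dsum (D : Finset DyadicInterval) (c : DyadicInterval → ℝ≥0∞) (x : ℝ) : ℝ≥0∞ :=
  ∑ J ∈ D, (dset J).indicator (fun _ => c J) x

lemma measurable_dsum (D : Finset DyadicInterval) (c : DyadicInterval → ℝ≥0∞) :
    Measurable (dsum D c) :=
  Finset.measurable_fun_sum _ fun J _ => measurable_const.indicator (measurableSet_dset J)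

lemma lintegral_dsum_mul (D : Finset DyadicInterval) (c : DyadicInterval → ℝ≥0∞)
    {g : ℝ → ℝ≥0∞} (hg : Measurable g) :
    ∫⁻ x, dsum D c x * g x = ∑ J ∈ D, c J * ∫⁻ x in dset J, g x := by
  simp only [dsum, Finset.sum_mul]
  rw [lintegral_finsetSum _ fun J _ => by
    exact (measurable_const.indicator (measurableSet_dset J)).mul hg]
  refine Finset.sum_congr rfl fun J _ => ?_
  rw [← lintegral_const_mul _ hg, ← lintegral_indicator (measurableSet_dset J)]
  refine lintegral_congr fun x => ?_
  by_cases hx : x ∈ dset J <;> simp [hx]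

lemma lintegral_dsum (D : Finset DyadicInterval) (c : DyadicInterval → ℝ≥0∞) :
    ∫⁻ x, dsum D c x = ∑ J ∈ D, c J * twoPow J.k := by
  simpa [volume_dset] using lintegral_dsum_mul D c (g := fun _ => 1) measurable_const

lemma le_dsum {D : Finset DyadicInterval} {c : DyadicInterval → ℝ≥0∞} {J : DyadicInterval}
    (hJ : J ∈ D) {x : ℝ} (hx : x ∈ dset J) : c J ≤ dsum D c x := by
  have := Finset.single_le_sum (f := fun J => (dset J).indicator (fun _ => c J) x)
    (fun _ _ => zero_le) hJ
  rwa [Set.indicator_of_mem hx] at this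

lemma dsum_mono {D E : Finset DyadicInterval} (h : D ⊆ E) (c : DyadicInterval → ℝ≥0∞) (x : ℝ) :
    dsum D c x ≤ dsum E c x :=
  Finset.sum_le_sum_of_subset h

lemma dsum_eq_zero {D : Finset DyadicInterval} {c : DyadicInterval → ℝ≥0∞} {x : ℝ}
    (hx : x ∉ dUnion D) : dsum D c x = 0 :=
  Finset.sum_eq_zero fun _ hJ => Set.indicator_of_notMem
    (fun h => hx (dset_subset_dUnion (Finset.mem_coe.2 hJ) h)) _

lemma volume_dUnion_ne_top (D : Finset DyadicInterval) : volume (dUnion D) ≠ ⊤ := by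
  refine ne_top_of_le_ne_top ?_ (measure_biUnion_finset_le D dset)
  exact ENNReal.sum_ne_top.2 fun _ _ => by rw [volume_dset]; exact twoPow_ne_top _

lemma exists_k_le (D : Finset DyadicInterval) : ∃ K : ℤ, ∀ J ∈ (D : Set DyadicInterval), J.k ≤ K := by
  obtain ⟨K, hK⟩ := (D.image DyadicInterval.k).bddAbove
  exact ⟨K, fun J hJ => hK (Finset.mem_coe.2 (Finset.mem_image_of_mem _ hJ))⟩

lemma exists_int_le_twoPow {t : ℝ≥0∞} (ht : t ≠ ⊤) : ∃ k : ℤ, t ≤ twoPow k := by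
  rcases eq_or_ne t 0 with rfl | h0
  · exact ⟨0, zero_le⟩
  obtain ⟨τ, rfl⟩ := exists_eq_twoPow h0 ht
  exact ⟨⌈τ⌉, twoPow_le.2 (Int.le_ceil τ)⟩

lemma exists_int_twoPow_lt {t : ℝ≥0∞} (h0 : t ≠ 0) (ht : t ≠ ⊤) : ∃ k : ℤ, twoPow k < t := by
  obtain ⟨τ, rfl⟩ := exists_eq_twoPow h0 ht
  exact ⟨⌈τ⌉ - 1, twoPow_lt.2 (by push_cast; linarith [Int.ceil_lt_add_one τ])⟩

lemma le_two_mul_of_add_eq {a b t : ℝ≥0∞} (ht : t ≠ ⊤) (h : a + b = t) (hb : 2 * b ≤ t) :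
    t ≤ 2 * a := by
  refine (ENNReal.add_le_add_iff_right ht).1 ?_
  calc t + t = 2 * a + 2 * b := by rw [← h]; ring
    _ ≤ 2 * a + t := by gcongr

lemma apply_biUnion_le_sum {ι : Type*} {X : Finset DyadicInterval → ℝ≥0∞} (h0 : X ∅ = 0)
    (hX : ∀ F G, X (F ∪ G) ≤ X F + X G) (T : Finset ι) (F : ι → Finset DyadicInterval) :
    X (T.biUnion F) ≤ ∑ k ∈ T, X (F k) := by
  classical
  induction T using Finset.induction_on with
  | empty => simp [h0]
  | insert a T ha ih =>
    rw [Finset.biUnion_insert, Finset.sum_insert ha]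
    exact (hX _ _).trans (by gcongr)

/-- The families of a level decomposition are controlled by the measure of their union. -/
lemma sum_mul_twoPow_le_of_level {F D : Finset DyadicInterval} (hFD : F ⊆ D)
    (c : DyadicInterval → ℝ≥0∞) (k : ℤ)
    (h : ∀ J ∈ F, 2 * volume (dset J ∩ {x | twoPow (k + 1) < dsum D c x}) ≤ twoPow J.k) :
    ∑ J ∈ F, c J * twoPow J.k ≤ 4 * twoPow k * volume (dUnion F) := by
  set L := {x | dsum D c x ≤ twoPow (k + 1)} with hL
  have hLm : MeasurableSet L := measurableSet_le (measurable_dsum D c) measurable_const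
  have hLc : {x | twoPow (k + 1) < dsum D c x} = Lᶜ := by ext x; simp [hL]
  calc ∑ J ∈ F, c J * twoPow J.k
      -- At least half of each `J` lies in `L`, so mass on `J` may be replaced by mass on `J ∩ L`,
      -- where the full step function is bounded by `2 ^ (k + 1)`.
      ≤ ∑ J ∈ F, c J * (2 * volume (dset J ∩ L)) := by
        refine Finset.sum_le_sum fun J hJ => ?_
        gcongr
        have h1 := measure_inter_add_sdiff (μ := volume) (dset J) hLm
        rw [volume_dset, Set.sdiff_eq, ← hLc] at h1
        exact le_two_mul_of_add_eq (twoPow_ne_top _) h1 (h J hJ)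
    _ = 2 * ∫⁻ x, dsum F c x * L.indicator 1 x := by
        rw [lintegral_dsum_mul _ _ (measurable_one.indicator hLm), Finset.mul_sum]
        refine Finset.sum_congr rfl fun J _ => ?_
        rw [lintegral_indicator_one hLm, Measure.restrict_apply hLm, Set.inter_comm]
        ring
    _ ≤ 2 * ∫⁻ x, (dUnion (F : Set DyadicInterval)).indicator (fun _ => twoPow (k + 1)) x := by
        gcongr with x
        by_cases hx : x ∈ dUnion (F : Set DyadicInterval)
        · rw [Set.indicator_of_mem hx]
          by_cases hxL : x ∈ L
          · simpa [hxL] using (dsum_mono hFD c x).trans hxL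
          · simp [hxL]
        · simp [dsum_eq_zero hx]
    _ = _ := by
        rw [lintegral_indicator_const (measurableSet_dUnion _), twoPow_add, twoPow_one]
        ring

/-- The function `2 * 1_{u > 2 ^ k}` has mean at least one over each interval of `F`, so the
unshifted weak type estimate applies. -/
lemma volume_dUnion_le_of_level {F : Finset DyadicInterval} {u : ℝ → ℝ≥0∞} (hu : Measurable u)
    (k : ℤ) (h : ∀ J ∈ F, twoPow J.k < 2 * volume (dset J ∩ {x | twoPow k < u x})) :
    volume (dUnion F) ≤ 2 * volume {x | twoPow k < u x} := by
  obtain ⟨K, hK⟩ := exists_k_le F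
  have hm : MeasurableSet {x | twoPow k < u x} := measurableSet_lt measurable_const hu
  have := mul_volume_dUnion_le hK (c := 1)
    (g := fun x => 2 * {x | twoPow k < u x}.indicator 1 x) (fun J hJ => by
      rw [lintegral_const_mul _ (measurable_one.indicator hm), lintegral_indicator_one hm,
        Measure.restrict_apply hm, one_mul, Set.inter_comm]
      exact (h J hJ).le)
  rw [one_mul] at this
  refine this.trans ((setLIntegral_le_lintegral _ _).trans ?_)
  rw [lintegral_const_mul _ (measurable_one.indicator hm), lintegral_indicator_one hm]

/-- A subadditive functional of families of dyadic intervals that satisfies a Hölder type bound is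
controlled by the integral of a power of `∑ c J 1_J`. -/
lemma level_decomposition {s : ℝ} (hs : 0 < s) (hs1 : s < 1) (D : Finset DyadicInterval)
    {c : DyadicInterval → ℝ≥0∞} (hc : ∀ J ∈ D, c J ≠ ⊤) {X : Finset DyadicInterval → ℝ≥0∞}
    {B : ℝ≥0∞} (hX : ∀ F G, X (F ∪ G) ≤ X F + X G)
    (hB : ∀ F ⊆ D, X F ≤
      B * volume (dUnion F) ^ (1 - s) * (∑ J ∈ F, c J * twoPow J.k) ^ s) :
    X D ≤ 2 * 4 ^ s * geomConst s * B * ∫⁻ x, dsum D c x ^ s := by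
  classical
  set U := dsum D c with hU
  have hUm : Measurable U := measurable_dsum D c
  -- `Q J k` says that `U` exceeds `2 ^ k` on more than half of `J`. The level of `J` is the last
  -- `k` for which this holds.
  let Q : DyadicInterval → ℤ → Prop := fun J k =>
    twoPow J.k < 2 * volume (dset J ∩ {x | twoPow k < U x})
  have hlev : ∀ J : DyadicInterval, ∃ k : ℤ, J ∈ D → c J ≠ 0 → Q J k ∧ ¬ Q J (k + 1) := by
    intro J
    by_cases hJ : J ∈ D ∧ c J ≠ 0
    swap
    · exact ⟨0, fun h h' => absurd ⟨h, h'⟩ hJ⟩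
    -- On `J` one has `U ≥ c J > 0`, so any `k` with `2 ^ k < c J` qualifies; above the total of the
    -- coefficients no `k` does.
    have hne : ∃ k, Q J k := by
      obtain ⟨k, hk⟩ := exists_int_twoPow_lt hJ.2 (hc J hJ.1)
      refine ⟨k, ?_⟩
      have : dset J ∩ {x | twoPow k < U x} = dset J :=
        Set.inter_eq_left.2 fun x hx => hk.trans_le (le_dsum hJ.1 hx)
      simp only [Q]
      rw [this, volume_dset, two_mul]
      exact ENNReal.lt_add_right (twoPow_ne_top _) (twoPow_ne_zero _)
    obtain ⟨S, hS⟩ : ∃ S : ℤ, ∑ J ∈ D, c J ≤ twoPow S :=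
      exists_int_le_twoPow (ENNReal.sum_ne_top.2 hc)
    have hbd : ∀ k, Q J k → k ≤ S := by
      intro k hk
      by_contra hlt
      have : {x | twoPow k < U x} = ∅ := by
        ext x
        simp only [Set.mem_ofPred_eq, Set.mem_empty_iff_false, iff_false, not_lt]
        calc U x ≤ ∑ J ∈ D, c J := Finset.sum_le_sum fun J _ => Set.indicator_le_self _ _ x
          _ ≤ twoPow S := hS
          _ ≤ twoPow k := twoPow_le.2 (by exact_mod_cast (not_le.1 hlt).le)
      simp [Q, this] at hk
    obtain ⟨k, hk, hmax⟩ := Int.exists_greatest_of_bdd ⟨S, hbd⟩ hne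
    exact ⟨k, fun _ _ => ⟨hk, fun h => by have := hmax _ h; omega⟩⟩
  choose lev hlev using hlev
  have h0 : X ∅ = 0 := by
    have := hB ∅ (Finset.empty_subset _)
    simpa [ENNReal.zero_rpow_of_pos hs] using this
  -- Intervals with zero coefficient need not have a level. The Hölder bound makes `X` vanish on
  -- them, since `s > 0`.
  have hzero : X (D.filter fun J => c J = 0) = 0 := by
    have := hB _ (Finset.filter_subset (fun J => c J = 0) D)
    rw [Finset.sum_eq_zero (fun J hJ => by rw [(Finset.mem_filter.1 hJ).2, zero_mul]),
      ENNReal.zero_rpow_of_pos hs, mul_zero] at this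
    simpa using this
  set E := D.filter fun J => c J ≠ 0 with hE
  have hXE : X D ≤ X E := by
    have := hX (D.filter fun J => c J = 0) E
    rwa [hzero, zero_add, hE, Finset.filter_union_filter_not_eq] at this
  set T := E.image lev with hT
  have hEU : T.biUnion (fun k => E.filter fun J => lev J = k) = E := by
    ext J
    simp only [Finset.mem_biUnion, Finset.mem_filter, hT]
    exact ⟨fun ⟨_, _, h, _⟩ => h, fun h => ⟨lev J, Finset.mem_image_of_mem _ h, h, rfl⟩⟩
  have hterm : ∀ k : ℤ, X (E.filter fun J => lev J = k) ≤
      2 * 4 ^ s * B * (twoPow (k * s) * volume {x | twoPow k < U x}) := by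
    intro k
    set F := E.filter fun J => lev J = k with hF
    have hFD : F ⊆ D := (Finset.filter_subset _ _).trans (Finset.filter_subset _ _)
    have hFQ : ∀ J ∈ F, Q J k ∧ ¬ Q J (k + 1) := by
      intro J hJ
      obtain ⟨hJE, rfl⟩ := Finset.mem_filter.1 hJ
      exact hlev J (Finset.mem_filter.1 hJE).1 (Finset.mem_filter.1 hJE).2
    have h1 := volume_dUnion_le_of_level (F := F) hUm k fun J hJ => (hFQ J hJ).1
    have h2 := sum_mul_twoPow_le_of_level hFD c k fun J hJ => by
      have := not_lt.1 (hFQ J hJ).2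
      push_cast at this
      exact this
    set v := volume (dUnion (F : Set DyadicInterval)) with hv
    calc X F ≤ B * v ^ (1 - s) * (∑ J ∈ F, c J * twoPow J.k) ^ s := hB F hFD
      _ ≤ B * v ^ (1 - s) * (4 * twoPow k * v) ^ s := by gcongr
      _ = B * 4 ^ s * twoPow (k * s) * (v ^ (1 - s) * v ^ s) := by
          rw [ENNReal.mul_rpow_of_nonneg _ _ hs.le, ENNReal.mul_rpow_of_nonneg _ _ hs.le,
            twoPow_rpow]
          ring
      -- The exponents `1 - s` and `s` recombine to one power of the measure of the union; this
      -- homogeneity lets the levels sum to a layer cake.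
      _ = B * 4 ^ s * twoPow (k * s) * v := by
          rw [← ENNReal.rpow_add_of_nonneg _ _ (by linarith) hs.le]; simp
      _ ≤ B * 4 ^ s * twoPow (k * s) * (2 * volume {x | twoPow k < U x}) := by gcongr
      _ = _ := by ring
  calc X D ≤ ∑ k ∈ T, X (E.filter fun J => lev J = k) := by
        refine hXE.trans ?_
        conv_lhs => rw [← hEU]
        exact apply_biUnion_le_sum h0 hX T _
    _ ≤ ∑ k ∈ T, 2 * 4 ^ s * B * (twoPow (k * s) * volume {x | twoPow k < U x}) :=
        Finset.sum_le_sum fun k _ => hterm k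
    _ ≤ 2 * 4 ^ s * B * ∑' k : ℤ, twoPow (k * s) * volume {x | twoPow k < U x} := by
        rw [← Finset.mul_sum]
        gcongr
        exact ENNReal.sum_le_tsum T
    _ ≤ 2 * 4 ^ s * B * (geomConst s * ∫⁻ x, U x ^ s) := by
        gcongr
        exact tsum_le_lintegral_rpow hUm hs
    _ = _ := by ring

lemma lintegral_rpow_le_of_support {s : ℝ} (hs : 0 < s) (hs1 : s < 1) {E : Set ℝ}
    (hE : MeasurableSet E) {v : ℝ → ℝ≥0∞} (hv : AEMeasurable v) (h : ∀ x ∉ E, v x = 0) :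
    ∫⁻ x, v x ^ s ≤ volume E ^ (1 - s) * (∫⁻ x, v x) ^ s := by
  have := ENNReal.lintegral_mul_norm_pow_le (μ := volume) (p := 1 - s) (q := s)
    (f := E.indicator 1) (g := v)
    (measurable_one.indicator hE).aemeasurable hv (by linarith) hs.le (by ring)
  rw [lintegral_indicator_one hE] at this
  refine le_trans (lintegral_mono fun x => ?_) this
  by_cases hx : x ∈ E
  · simp [hx]
  · simp [h x hx, ENNReal.zero_rpow_of_pos hs]

/-- The step function `∑ c J 1_{J.shift n}`. -/
def shiftSum (D : Finset DyadicInterval) (n : ℤ) (c : DyadicInterval → ℝ≥0∞) (x : ℝ) : ℝ≥0∞ :=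
  ∑ J ∈ D, (dset (J.shift n)).indicator (fun _ => c J) x

lemma measurable_shiftSum (D : Finset DyadicInterval) (n : ℤ) (c : DyadicInterval → ℝ≥0∞) :
    Measurable (shiftSum D n c) :=
  Finset.measurable_fun_sum _ fun _ _ => measurable_const.indicator (measurableSet_dset _)

lemma shiftSum_zero (D : Finset DyadicInterval) (c : DyadicInterval → ℝ≥0∞) :
    shiftSum D 0 c = dsum D c := by
  ext x; simp [shiftSum, dsum, shift_zero]

lemma lintegral_shiftSum_mul (D : Finset DyadicInterval) (n : ℤ) (c : DyadicInterval → ℝ≥0∞)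
    {g : ℝ → ℝ≥0∞} (hg : Measurable g) :
    ∫⁻ x, shiftSum D n c x * g x = ∑ J ∈ D, c J * ∫⁻ x in dset (J.shift n), g x := by
  simp only [shiftSum, Finset.sum_mul]
  rw [lintegral_finsetSum _ fun J _ => by
    exact (measurable_const.indicator (measurableSet_dset _)).mul hg]
  refine Finset.sum_congr rfl fun J _ => ?_
  rw [← lintegral_const_mul _ hg, ← lintegral_indicator (measurableSet_dset _)]
  refine lintegral_congr fun x => ?_
  by_cases hx : x ∈ dset (J.shift n) <;> simp [hx]

lemma lintegral_shiftSum (D : Finset DyadicInterval) (n : ℤ) (c : DyadicInterval → ℝ≥0∞) :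
    ∫⁻ x, shiftSum D n c x = ∑ J ∈ D, c J * twoPow J.k := by
  simpa [volume_dset, shift_k] using lintegral_shiftSum_mul D n c (g := fun _ => 1) measurable_const

lemma sum_union_le (F G : Finset DyadicInterval) (u : DyadicInterval → ℝ≥0∞) :
    ∑ J ∈ F ∪ G, u J ≤ ∑ J ∈ F, u J + ∑ J ∈ G, u J := by
  rw [← Finset.sum_union_inter]
  exact le_self_add

/-- Shifting the intervals of a step function by `n` units costs at most a factor `log (2 + |n|)`
in `L^s`, `s < 1`. -/
lemma lintegral_shiftSum_rpow_le {s : ℝ} (hs : 0 < s) (hs1 : s < 1) (D : Finset DyadicInterval)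
    (n : ℤ) {c : DyadicInterval → ℝ≥0∞} (hc : ∀ J ∈ D, c J ≠ ⊤) :
    ∫⁻ x, shiftSum D n c x ^ s ≤
      2 * 4 ^ s * geomConst s * (5 * lg n) * ∫⁻ x, dsum D c x ^ s := by
  classical
  -- The functional is subadditive because `t ↦ t ^ s` is. Its Hölder bound holds because shifting
  -- preserves the integral of the step function and enlarges the support only by a logarithm.
  refine level_decomposition hs hs1 D hc (X := fun F => ∫⁻ x, shiftSum F n c x ^ s) ?_ ?_
  · intro F G
    rw [← lintegral_add_left ((measurable_shiftSum F n c).pow_const s)]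
    refine lintegral_mono fun x => ?_
    refine le_trans ?_ (ENNReal.rpow_add_le_add_rpow _ _ hs.le hs1.le)
    gcongr
    exact sum_union_le F G _
  · intro F _
    obtain ⟨K, hK⟩ := exists_k_le F
    have hE : MeasurableSet (⋃ J ∈ (F : Set DyadicInterval), dset (J.shift n)) := by
      rw [← dUnion_image_shift]; exact measurableSet_dUnion _
    refine (lintegral_rpow_le_of_support hs hs1 hE
      (measurable_shiftSum F n c).aemeasurable ?_).trans ?_
    · intro x hx
      refine Finset.sum_eq_zero fun J hJ => Set.indicator_of_notMem (fun h => hx ?_) _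
      exact Set.mem_biUnion (Finset.mem_coe.2 hJ) h
    · rw [lintegral_shiftSum]
      gcongr
      calc volume (⋃ J ∈ (F : Set DyadicInterval), dset (J.shift n)) ^ (1 - s)
          ≤ (5 * lg n * volume (dUnion F)) ^ (1 - s) := by
            gcongr
            exact volume_dUnion_shift_le hK n
        _ = (5 * lg n) ^ (1 - s) * volume (dUnion F) ^ (1 - s) :=
            ENNReal.mul_rpow_of_nonneg _ _ (by linarith)
        _ ≤ _ := by
            gcongr
            refine (ENNReal.rpow_le_rpow_of_exponent_le ?_ (by linarith)).trans_eq
              (ENNReal.rpow_one _)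
            exact one_le_mul (by norm_num) (one_le_lg n)

/-! ### Bumps and their decay -/

/-- The quantitative properties of an `L²`-normalized bump that the estimates use: polynomial
decay of all orders away from `J`, and a Lipschitz bound at the scale of `J`. -/
structure IsMolecule (B : ℕ → ℝ≥0) (J : DyadicInterval) (Φ : ℝ → ℂ) : Prop where
  continuous : Continuous Φ
  decay : ∀ (N : ℕ) (y : ℝ), ‖Φ y‖ₑ ≤ B N * twoPow (-(J.k / 2)) * wtAt J y ^ N
  lipschitz : ∀ y z : ℝ, idx J.k y = idx J.k z →
    ‖Φ y - Φ z‖ₑ ≤ B 2 * twoPow (-(J.k / 2)) * (twoPow (-J.k) * ENNReal.ofReal |y - z|) *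
      wtAt J y ^ 2

lemma DyadicInterval.length_eq (J : DyadicInterval) : J.length = (2 : ℝ) ^ J.k := rfl

lemma le_infDist_toSet (J : DyadicInterval) (y : ℝ) :
    (2 : ℝ) ^ J.k * (|((idx J.k y - J.m : ℤ) : ℝ)| - 1) ≤ Metric.infDist y J.toSet := by
  have h0 : (0 : ℝ) < 2 ^ J.k := by positivity
  have hne : J.toSet.Nonempty := ⟨(2 : ℝ) ^ J.k * J.m, le_rfl, by nlinarith⟩
  obtain ⟨h1, h2⟩ := idx_eq_iff.1 (rfl : idx J.k y = idx J.k y)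
  rw [Metric.le_infDist hne]
  rintro z ⟨hz1, hz2⟩
  rw [Real.dist_eq]
  rcases abs_cases (((idx J.k y - J.m : ℤ) : ℝ)) with ⟨h, -⟩ | ⟨h, -⟩ <;> rw [h] <;> push_cast
  · exact le_trans (by nlinarith) (le_abs_self _)
  · exact le_trans (by nlinarith) (neg_le_abs _)

lemma one_div_le_two_mul_wtAt (J : DyadicInterval) (y : ℝ) :
    1 / (1 + Metric.infDist y J.toSet / J.length) ≤
      2 * (1 / (1 + |((idx J.k y - J.m : ℤ) : ℝ)|)) := by
  have h0 : (0 : ℝ) < 2 ^ J.k := by positivity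
  have h1 := le_infDist_toSet J y
  have h2 : 0 ≤ Metric.infDist y J.toSet := Metric.infDist_nonneg
  have h3 : |((idx J.k y - J.m : ℤ) : ℝ)| - 1 ≤ Metric.infDist y J.toSet / J.length := by
    rw [DyadicInterval.length_eq, le_div_iff₀ h0]; linarith
  have h4 : 0 ≤ Metric.infDist y J.toSet / J.length := by
    rw [DyadicInterval.length_eq]; positivity
  rw [mul_one_div, div_le_div_iff₀ (by linarith) (by positivity)]
  linarith

lemma ofReal_bump_le {c : ℝ} (J : DyadicInterval) (N : ℕ) (y : ℝ) :
    ENNReal.ofReal (c * (1 / (1 + Metric.infDist y J.toSet / J.length) ^ N)) ≤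
      ((2 ^ N * Real.toNNReal c : ℝ≥0) : ℝ≥0∞) * wtAt J y ^ N := by
  have h4 : 0 ≤ Metric.infDist y J.toSet / J.length := by
    rw [DyadicInterval.length_eq]; have := Metric.infDist_nonneg (x := y) (s := J.toSet); positivity
  rw [wtAt, wt_eq_ofReal, ← ENNReal.ofReal_pow (by positivity), ENNReal.coe_mul, ENNReal.coe_pow,
    ENNReal.coe_ofNat, ← ENNReal.ofReal,
    show (2 : ℝ≥0∞) ^ N = ENNReal.ofReal (2 ^ N) by rw [ENNReal.ofReal_pow (by norm_num)]; simp,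
    mul_comm (ENNReal.ofReal _) (ENNReal.ofReal c), mul_assoc,
    ← ENNReal.ofReal_mul (by positivity), ← mul_pow, ENNReal.ofReal_mul' (by positivity),
    ← one_div_pow]
  gcongr
  exact one_div_le_two_mul_wtAt J y

/-- The constants of the molecules obtained from bumps with constants `C`. -/
def moleculeConst (C : ℕ → ℕ → ℝ) (N : ℕ) : ℝ≥0 :=
  2 ^ N * (Real.toNNReal (C 0 N) + Real.toNNReal (C 1 N))

lemma enorm_ofReal_rpow (J : DyadicInterval) :
    ‖((J.length ^ (-(1 / 2) : ℝ) : ℝ) : ℂ)‖ₑ = twoPow (-(J.k / 2)) := by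
  rw [← ofReal_norm, Complex.norm_real, Real.norm_of_nonneg
    (by rw [DyadicInterval.length_eq]; positivity), twoPow_eq_ofReal, DyadicInterval.length_eq,
    ← Real.rpow_intCast, ← Real.rpow_mul (by norm_num)]
  congr 2; ring

/-- The Lipschitz bound is the mean value inequality on a dyadic cell of the length of `J`, where
the weight is constant. One controlled derivative is enough for this. -/
lemma IsL2Bump.isMolecule {M : ℕ} (hM : 1 ≤ M) {C : ℕ → ℕ → ℝ} {J : DyadicInterval}
    {Φ : ℝ → ℂ} (h : IsL2Bump M C J Φ) : IsMolecule (moleculeConst C) J Φ := by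
  obtain ⟨φ, ⟨hφ, hb⟩, hΦ⟩ := h
  have h0 : (0 : ℝ) < 2 ^ J.k := by positivity
  have hΦ' : Φ = fun x => ((J.length ^ (-(1 / 2) : ℝ) : ℝ) : ℂ) * φ x := funext hΦ
  refine ⟨?_, fun N y => ?_, fun y z hyz => ?_⟩
  · rw [hΦ']; exact continuous_const.mul hφ.continuous
  · rw [hΦ, enorm_mul, enorm_ofReal_rpow, mul_assoc, mul_left_comm]
    gcongr
    have h1 := hb 0 (Nat.zero_le _) N y
    rw [iteratedDeriv_zero, pow_zero, div_one, mul_one] at h1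
    rw [← ofReal_norm]
    refine (ENNReal.ofReal_le_ofReal h1).trans ((ofReal_bump_le J N y).trans ?_)
    gcongr
    rw [moleculeConst]
    gcongr
    exact le_self_add
  · rw [hΦ, hΦ, ← mul_sub, enorm_mul, enorm_ofReal_rpow, mul_assoc, mul_assoc, mul_left_comm]
    gcongr
    set s : Set ℝ := dset ⟨J.k, idx J.k y⟩ with hs
    have hconv : Convex ℝ s := by rw [hs, dset_eq]; exact convex_Ico _ _
    have hw : ∀ x ∈ s, wtAt J x = wtAt J y := fun x hx => by
      rw [wtAt, wtAt, mem_dset.1 hx]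
    set c := C 1 2 * (1 / J.length) with hc
    set b := (((2 ^ 2 * Real.toNNReal c : ℝ≥0) : ℝ≥0∞) * wtAt J y ^ 2) with hb'
    have hbt : b ≠ ⊤ := ENNReal.mul_ne_top ENNReal.coe_ne_top
      (ENNReal.pow_ne_top (wt_ne_top _))
    have hder : ∀ x ∈ s, ‖deriv φ x‖ ≤ b.toReal := by
      intro x hx
      have h1 := hb 1 hM 2 x
      rw [iteratedDeriv_one, pow_one] at h1
      rw [← ENNReal.ofReal_le_iff_le_toReal hbt, hb', ← hw x hx]
      exact (ENNReal.ofReal_le_ofReal h1).trans (ofReal_bump_le J 2 x)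
    have hmv := hconv.norm_image_sub_le_of_norm_deriv_le
      (fun x _ => (hφ.differentiable (by simp)).differentiableAt) hder
      (show z ∈ s from hyz.symm) (show y ∈ s from rfl)
    rw [← ofReal_norm]
    refine (ENNReal.ofReal_le_ofReal hmv).trans ?_
    rw [ENNReal.ofReal_mul ENNReal.toReal_nonneg, ENNReal.ofReal_toReal hbt, Real.norm_eq_abs, hb',
      hc, moleculeConst, mul_comm (C 1 2),
      Real.toNNReal_mul (by rw [DyadicInterval.length_eq]; positivity)]
    have h2 : ((Real.toNNReal (1 / J.length) : ℝ≥0) : ℝ≥0∞) = twoPow (-J.k) := by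
      rw [twoPow_eq_ofReal, DyadicInterval.length_eq, ENNReal.ofReal, Real.rpow_neg (by norm_num),
        Real.rpow_intCast, one_div]
    calc _ = ((2 ^ 2 * Real.toNNReal (C 1 2) : ℝ≥0) : ℝ≥0∞) *
          (twoPow (-J.k) * ENNReal.ofReal |y - z| * wtAt J y ^ 2) := by
          rw [← h2]; push_cast; ring
      _ ≤ _ := by
          gcongr
          exact le_add_self

lemma IsMolecule.measurable {B : ℕ → ℝ≥0} {J : DyadicInterval} {Φ : ℝ → ℂ}
    (h : IsMolecule B J Φ) : Measurable Φ := h.continuous.measurable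

/-- For small `s` a high order of decay is chosen, so that the `s`-th power still decays
quadratically and is integrable. -/
lemma IsMolecule.lintegral_rpow_le {B : ℕ → ℝ≥0} {J : DyadicInterval} {Φ : ℝ → ℂ}
    (h : IsMolecule B J Φ) {s : ℝ} (hs : 0 < s) {N : ℕ} (hN : 2 ≤ N * s) :
    ∫⁻ x, ‖Φ x‖ₑ ^ s ≤ (B N * twoPow (-(J.k / 2))) ^ s * (wtSum * twoPow J.k) := by
  rw [← lintegral_wtAt_sq, ← lintegral_const_mul' _ _
    (ENNReal.rpow_ne_top_of_nonneg hs.le (ENNReal.mul_ne_top ENNReal.coe_ne_top (twoPow_ne_top _)))]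
  refine lintegral_mono fun x => ?_
  calc ‖Φ x‖ₑ ^ s ≤ (B N * twoPow (-(J.k / 2)) * wtAt J x ^ N) ^ s := by
        gcongr; exact h.decay N x
    _ = (B N * twoPow (-(J.k / 2))) ^ s * wtAt J x ^ ((N : ℝ) * s) := by
        rw [ENNReal.mul_rpow_of_nonneg _ _ hs.le, ← ENNReal.rpow_natCast, ← ENNReal.rpow_mul]
    _ ≤ _ := by
        gcongr
        rw [← ENNReal.rpow_natCast]
        exact ENNReal.rpow_le_rpow_of_exponent_ge (wtAt_le_one _ _) (by exact_mod_cast hN)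

lemma IsMolecule.lintegral_le {B : ℕ → ℝ≥0} {J : DyadicInterval} {Φ : ℝ → ℂ}
    (h : IsMolecule B J Φ) : ∫⁻ x, ‖Φ x‖ₑ ≤ B 2 * wtSum * twoPow (J.k / 2) := by
  have := h.lintegral_rpow_le one_pos (N := 2) (by norm_num)
  simp only [ENNReal.rpow_one] at this
  refine this.trans_eq ?_
  have h2 : twoPow (J.k / 2) = twoPow (-(J.k / 2)) * twoPow J.k := by
    rw [← twoPow_add]; congr 1; ring
  rw [h2]; ring

lemma IsMolecule.lintegral_rpow_lt_top {B : ℕ → ℝ≥0} {J : DyadicInterval} {Φ : ℝ → ℂ}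
    (h : IsMolecule B J Φ) {s : ℝ} (hs : 0 < s) : ∫⁻ x, ‖Φ x‖ₑ ^ s < ⊤ := by
  obtain ⟨N, hN⟩ := exists_nat_gt (2 / s)
  refine (h.lintegral_rpow_le hs (N := N) ((div_le_iff₀ hs).1 hN.le)).trans_lt ?_
  exact ENNReal.mul_lt_top (ENNReal.rpow_lt_top_of_nonneg hs.le
    (ENNReal.mul_ne_top ENNReal.coe_ne_top (twoPow_ne_top _)))
    (ENNReal.mul_lt_top wtSum_ne_top.lt_top (twoPow_ne_top _).lt_top)

lemma IsMolecule.memLp {B : ℕ → ℝ≥0} {J : DyadicInterval} {Φ : ℝ → ℂ}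
    (h : IsMolecule B J Φ) {s : ℝ} (hs : 0 < s) : MemLp Φ (ENNReal.ofReal s) := by
  refine ⟨h.continuous.aestronglyMeasurable, ?_⟩
  rw [eLpNorm_lt_top_iff_lintegral_rpow_enorm_lt_top (by simpa using hs) ENNReal.ofReal_ne_top,
    ENNReal.toReal_ofReal hs.le]
  exact h.lintegral_rpow_lt_top hs

lemma IsMolecule.integrable {B : ℕ → ℝ≥0} {J : DyadicInterval} {Φ : ℝ → ℂ}
    (h : IsMolecule B J Φ) : Integrable Φ := by
  rw [← memLp_one_iff_integrable]
  simpa using h.memLp one_pos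

/-! ### Almost orthogonality -/

/-- Parseval's identity for functions with disjoint frequency supports. Compact support makes the
continuous function `𝓕 Ψ` integrable, so Fourier inversion holds for `Ψ`. -/
lemma integral_mul_conj_eq_zero {Φ Ψ : ℝ → ℂ} (hΦ : Integrable Φ) (hΨ : Integrable Ψ)
    (hΨc : Continuous Ψ) {a b : ℝ} (hsupp : tsupport (𝓕 Ψ) ⊆ Set.Icc a b)
    (h : ∀ ξ, 𝓕 Φ ξ = 0 ∨ 𝓕 Ψ ξ = 0) : ∫ x, Φ x * conj (Ψ x) = 0 := by
  have hcont : Continuous (𝓕 Ψ) :=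
    VectorFourier.fourierIntegral_continuous Real.continuous_fourierChar
      (by exact continuous_inner) hΨ
  have hcomp : HasCompactSupport (𝓕 Ψ) :=
    HasCompactSupport.of_support_subset_isCompact isCompact_Icc
      ((subset_tsupport _).trans hsupp)
  have hint : Integrable (𝓕 Ψ) := hcont.integrable_of_hasCompactSupport hcomp
  have hinv : 𝓕⁻ (𝓕 Ψ) = Ψ := hΨc.fourierInv_fourier_eq hΨ hint
  have key : ∫ ξ, inner ℂ (𝓕 Φ ξ) (𝓕 Ψ ξ) = ∫ x, inner ℂ (Φ x) (𝓕⁻ (𝓕 Ψ) x) := by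
    simpa using! VectorFourier.integral_sesq_fourierIntegral_eq_neg_flip (innerSL ℂ)
      (L := innerₗ ℝ) Real.continuous_fourierChar continuous_inner hΦ hint
  rw [hinv] at key
  have hz : ∫ ξ, inner ℂ (𝓕 Φ ξ) (𝓕 Ψ ξ) = 0 := by
    rw [← integral_zero ℝ ℂ]
    congr with ξ
    rcases h ξ with h | h <;> simp [h]
  rw [hz] at key
  have := congrArg conj key
  rw [← integral_conj, map_zero] at this
  rw [this]
  congr with x
  simp [mul_comm]

/-- The Fourier support of a family of `ψ` type stays away from zero and infinity. -/
lemma exists_fourier_support {A : ℝ} :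
    ∃ b : ℝ, 0 < b ∧ ∀ (S : Set DyadicInterval) (Φ : DyadicInterval → ℝ → ℂ),
      (∀ J ∈ S, Integrable (Φ J)) → IsPsiType A S Φ → ∀ J ∈ S, ∀ ξ, 𝓕 (Φ J) ξ ≠ 0 →
        (2 : ℝ) ^ (-b) ≤ |ξ| * J.length ∧ |ξ| * J.length ≤ 2 ^ b := by
  -- For `A ≤ 0` the frequency interval degenerates to `{0}`. A continuous function supported at one
  -- point vanishes, so the claim is vacuous and any `b` works.
  rcases le_or_gt A 0 with hA | hA
  · refine ⟨1, one_pos, fun S Φ hΦ hψ J hJ ξ hξ => absurd ?_ hξ⟩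
    obtain ⟨lo, hi, h⟩ := hψ
    obtain ⟨h1, h2, -, h4, -, h6⟩ := h J hJ
    have hl : (0 : ℝ) < J.length⁻¹ := by rw [DyadicInterval.length_eq]; positivity
    have hAl : A * J.length⁻¹ ≤ 0 := mul_nonpos_of_nonpos_of_nonneg hA hl.le
    have hlh : lo J.length = hi J.length := by linarith
    have h0 : Metric.infDist 0 (Set.Icc (lo J.length) (hi J.length)) = 0 :=
      le_antisymm (h6.trans hAl) Metric.infDist_nonneg
    rw [hlh, Set.Icc_self] at h0 h2
    rw [Metric.infDist_singleton, dist_eq_zero] at h0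
    rw [← h0] at h2
    have hcont : Continuous (𝓕 (Φ J)) :=
      VectorFourier.fourierIntegral_continuous Real.continuous_fourierChar
        (by exact continuous_inner) (hΦ J hJ)
    have := hcont.ext_on (dense_compl_singleton (0 : ℝ)) continuous_zero fun x hx => by
      by_contra hne
      exact hx (h2 (subset_tsupport _ hne))
    rw [this]; rfl
  · have hpos : 0 < 2 * A + A⁻¹ := by positivity
    have hlog : (2 : ℝ) ^ Real.logb 2 (2 * A + A⁻¹ + 2) = 2 * A + A⁻¹ + 2 :=
      Real.rpow_logb (by norm_num) (by norm_num) (by linarith)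
    -- The product `|ξ| |J|` is at least `A⁻¹` and at most `2A`: distance to the origin plus length
    -- of the interval. The summand `2` makes `b` positive.
    refine ⟨Real.logb 2 (2 * A + A⁻¹ + 2), Real.logb_pos (by norm_num) (by linarith),
      fun S Φ hΦ hψ J hJ ξ hξ => ?_⟩
    obtain ⟨lo, hi, h⟩ := hψ
    obtain ⟨h1, h2, -, h4, h5, h6⟩ := h J hJ
    have hl : 0 < J.length := by rw [DyadicInterval.length_eq]; positivity
    have hξ' : ξ ∈ Set.Icc (lo J.length) (hi J.length) := h2 (subset_tsupport _ hξ)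
    rw [Real.rpow_neg (by norm_num), hlog]
    have hinv : (2 * A + A⁻¹ + 2)⁻¹ ≤ A⁻¹ :=
      inv_anti₀ hA (by have : 0 < A⁻¹ := by positivity
                       linarith)
    constructor
    · refine hinv.trans ?_
      have h7 := h5.trans (Metric.infDist_le_dist_of_mem hξ')
      rw [Real.dist_eq, zero_sub, abs_neg, ← div_eq_mul_inv, div_le_iff₀ hl] at h7
      exact h7
    · obtain ⟨z, hz, hz'⟩ := isCompact_Icc.exists_infDist_eq_dist ⟨ξ, hξ'⟩ (0 : ℝ)
      rw [hz', Real.dist_eq, zero_sub, abs_neg] at h6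
      have h8 : |ξ| ≤ 2 * A * J.length⁻¹ := by
        have h9 : |ξ - z| ≤ hi J.length - lo J.length := by
          rw [abs_le]; constructor <;> linarith [hz.1, hz.2, hξ'.1, hξ'.2]
        have h10 := abs_sub_abs_le_abs_sub ξ z
        linarith
      rw [← div_eq_mul_inv, le_div_iff₀ hl] at h8
      have : 0 < A⁻¹ := by positivity
      linarith

/-- Intervals of equal length are distinguished by their position, so at a given point their weights
run through distinct terms of a convergent series. -/
lemma sum_filter_wtAt_le (D : Finset DyadicInterval) (k : ℤ) (y : ℝ) :
    ∑ J ∈ D.filter (fun J => J.k = k), wtAt J y ^ 2 ≤ wtSum := by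
  have hinj : Set.InjOn DyadicInterval.m (D.filter fun J => J.k = k : Finset DyadicInterval) := by
    intro J hJ P hP h
    simp only [Finset.coe_filter, Set.mem_ofPred_eq] at hJ hP
    ext
    · rw [hJ.2, hP.2]
    · exact h
  calc ∑ J ∈ D.filter (fun J => J.k = k), wtAt J y ^ 2
      = ∑ J ∈ D.filter (fun J => J.k = k), wt (J.m - idx k y) ^ 2 := by
        refine Finset.sum_congr rfl fun J hJ => ?_
        rw [wtAt, (Finset.mem_filter.1 hJ).2, ← wt_neg, neg_sub]
    _ = ∑ m ∈ (D.filter fun J => J.k = k).image DyadicInterval.m, wt (m - idx k y) ^ 2 :=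
        (Finset.sum_image (f := fun m => wt (m - idx k y) ^ 2) hinj).symm
    _ ≤ ∑' m : ℤ, wt (m - idx k y) ^ 2 := ENNReal.sum_le_tsum _
    _ = wtSum := tsum_wt_sub _

lemma sum_enorm_near_scale_le {B : ℕ → ℝ≥0} (D : Finset DyadicInterval)
    {Φ : DyadicInterval → ℝ → ℂ} (h : ∀ J ∈ D, IsMolecule B J (Φ J)) (k : ℤ) (c : ℕ) (y : ℝ) :
    ∑ J ∈ D.filter (fun J => |J.k - k| ≤ c), ‖Φ J y‖ₑ ≤
      B 2 * twoPow (-(k / 2)) * twoPow (c / 2) * ((2 * c + 1) * wtSum) := by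
  calc ∑ J ∈ D.filter (fun J => |J.k - k| ≤ c), ‖Φ J y‖ₑ
      ≤ ∑ J ∈ D.filter (fun J => |J.k - k| ≤ c),
          B 2 * twoPow (-(k / 2)) * twoPow (c / 2) * wtAt J y ^ 2 := by
        refine Finset.sum_le_sum fun J hJ => ?_
        obtain ⟨hJD, hJk⟩ := Finset.mem_filter.1 hJ
        refine ((h J hJD).decay 2 y).trans ?_
        rw [mul_assoc (B 2 : ℝ≥0∞) (twoPow _) (twoPow _), ← twoPow_add]
        gcongr
        rw [twoPow_le]
        have : (k : ℝ) - c ≤ J.k := by exact_mod_cast (by rw [abs_le] at hJk; omega : k - c ≤ J.k)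
        linarith
    _ = B 2 * twoPow (-(k / 2)) * twoPow (c / 2) *
          ∑ J ∈ D.filter (fun J => |J.k - k| ≤ c), wtAt J y ^ 2 := by rw [Finset.mul_sum]
    _ ≤ _ := by
        gcongr
        have hsub : D.filter (fun J => |J.k - k| ≤ c) ⊆
            (Finset.Icc (k - c) (k + c)).biUnion fun l => D.filter (fun J => J.k = l) := by
          intro J hJ
          obtain ⟨hJD, hJk⟩ := Finset.mem_filter.1 hJ
          rw [abs_le] at hJk
          simp only [Finset.mem_biUnion, Finset.mem_Icc, Finset.mem_filter]
          exact ⟨J.k, by omega, hJD, rfl⟩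
        calc _ ≤ ∑ J ∈ (Finset.Icc (k - c) (k + c)).biUnion
                (fun l => D.filter (fun J => J.k = l)), wtAt J y ^ 2 :=
              Finset.sum_le_sum_of_subset hsub
          _ ≤ ∑ l ∈ Finset.Icc (k - c) (k + c), ∑ J ∈ D.filter (fun J => J.k = l), wtAt J y ^ 2 :=
              apply_biUnion_le_sum (X := fun F => ∑ J ∈ F, wtAt J y ^ 2) (by simp)
                (fun F G => sum_union_le F G _) _ _
          _ ≤ ∑ l ∈ Finset.Icc (k - c) (k + c), wtSum :=
              Finset.sum_le_sum fun l _ => sum_filter_wtAt_le D l y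
          _ = _ := by
              rw [Finset.sum_const, Int.card_Icc, nsmul_eq_mul]
              congr 1
              rw [show (k + c + 1 - (k - c)).toNat = 2 * c + 1 by omega]
              push_cast; rfl

/-- The `L²` bound for superpositions of molecules. -/
def SynthesisBound (B₂ : ℝ≥0∞) (D : Finset DyadicInterval) (Φ : DyadicInterval → ℝ → ℂ) : Prop :=
  ∀ F ⊆ D, ∀ a : DyadicInterval → ℂ,
    ∫⁻ x, ‖∑ J ∈ F, a J * Φ J x‖ₑ ^ 2 ≤ B₂ * ∑ J ∈ F, ‖a J‖ₑ ^ 2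

lemma IsMolecule.integrable_mul_conj {B : ℕ → ℝ≥0} {J P : DyadicInterval} {Φ Ψ : ℝ → ℂ}
    (h : IsMolecule B J Φ) (h' : IsMolecule B P Ψ) :
    Integrable fun x => Φ x * conj (Ψ x) := by
  have h1 := h.memLp (s := 2) (by norm_num)
  have h2 := (h'.memLp (s := 2) (by norm_num)).star
  rw [show ENNReal.ofReal 2 = 2 by simp] at h1 h2
  exact h1.integrable_mul h2

lemma lintegral_enorm_sum_sq_le {B : ℕ → ℝ≥0} (F : Finset DyadicInterval)
    {Φ : DyadicInterval → ℝ → ℂ} (h : ∀ J ∈ F, IsMolecule B J (Φ J)) (a : DyadicInterval → ℂ) :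
    ∫⁻ x, ‖∑ J ∈ F, a J * Φ J x‖ₑ ^ 2 ≤
      ∑ J ∈ F, ∑ P ∈ F, ‖a J‖ₑ * ‖a P‖ₑ * ‖∫ x, Φ J x * conj (Φ P x)‖ₑ := by
  set f : ℝ → ℂ := fun x => ∑ J ∈ F, a J * Φ J x with hf
  have hexp : ∀ x, f x * conj (f x) =
      ∑ J ∈ F, ∑ P ∈ F, a J * conj (a P) * (Φ J x * conj (Φ P x)) := by
    intro x
    simp only [hf, map_sum, Finset.sum_mul_sum, map_mul]
    refine Finset.sum_congr rfl fun J _ => Finset.sum_congr rfl fun P _ => by ring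
  have hint : ∀ J ∈ F, ∀ P ∈ F,
      Integrable fun x => a J * conj (a P) * (Φ J x * conj (Φ P x)) :=
    fun J hJ P hP => ((h J hJ).integrable_mul_conj (h P hP)).const_mul _
  have hI : ∫ x, f x * conj (f x) =
      ∑ J ∈ F, ∑ P ∈ F, a J * conj (a P) * ∫ x, Φ J x * conj (Φ P x) := by
    simp only [hexp]
    rw [integral_finsetSum _ fun J hJ => integrable_finsetSum _ fun P hP => hint J hJ P hP]
    refine Finset.sum_congr rfl fun J hJ => ?_
    rw [integral_finsetSum _ fun P hP => hint J hJ P hP]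
    refine Finset.sum_congr rfl fun P _ => integral_const_mul _ _
  have hfi : Integrable fun x => f x * conj (f x) := by
    simp only [hexp]
    exact integrable_finsetSum _ fun J hJ => integrable_finsetSum _ fun P hP => hint J hJ P hP
  have hsq : ∀ x, f x * conj (f x) = ((‖f x‖ ^ 2 : ℝ) : ℂ) := fun x => by
    rw [RCLike.mul_conj]; simp
  have h1 : ∫⁻ x, ‖f x‖ₑ ^ 2 = ‖∫ x, f x * conj (f x)‖ₑ := by
    simp only [hsq] at hfi ⊢
    have hre : Integrable fun x => ‖f x‖ ^ 2 :=
      hfi.re.congr (Filter.Eventually.of_forall fun x => Complex.ofReal_re _)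
    rw [integral_complex_ofReal, ← ofReal_norm, Complex.norm_real, Real.norm_of_nonneg
      (integral_nonneg fun x => by positivity), ofReal_integral_eq_lintegral_ofReal hre
      (by exact Filter.Eventually.of_forall fun x => by positivity)]
    refine lintegral_congr fun x => ?_
    rw [ENNReal.ofReal_pow (norm_nonneg _), ofReal_norm]
  rw [h1, hI]
  refine (enorm_sum_le _ _).trans (Finset.sum_le_sum fun J _ =>
    (enorm_sum_le _ _).trans (Finset.sum_le_sum fun P _ => le_of_eq ?_))
  simp [enorm_mul]

/-- Schur's test for the Gram matrix. Entries between distant scales vanish by disjointness of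
Fourier supports; near the diagonal, decay alone bounds the row sums. No regularity of the molecules
beyond continuity enters. -/
lemma exists_synthesisBound (A : ℝ) (B : ℕ → ℝ≥0) :
    ∃ B₂ : ℝ≥0∞, B₂ ≠ ⊤ ∧ ∀ (D : Finset DyadicInterval) (Φ : DyadicInterval → ℝ → ℂ),
      (∀ J ∈ D, IsMolecule B J (Φ J)) → IsPsiType A (D : Set DyadicInterval) Φ →
        SynthesisBound B₂ D Φ := by
  obtain ⟨b, hb, hsupp⟩ := exists_fourier_support (A := A)
  -- A common frequency `ξ` confines both `|ξ| 2 ^ J.k` and `|ξ| 2 ^ P.k` to `[2 ^ (-b), 2 ^ b]`, so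
  -- the scales differ by at most `2 * b`.
  set c := ⌈2 * b⌉₊ with hc
  set K : ℝ≥0∞ := B 2 * wtSum * (B 2 * twoPow (c / 2) * ((2 * c + 1) * wtSum)) with hK
  have hKt : K ≠ ⊤ := by
    have h1 := wtSum_ne_top
    have h2 := twoPow_ne_top (c / 2)
    exact ENNReal.mul_ne_top (ENNReal.mul_ne_top ENNReal.coe_ne_top h1)
      (ENNReal.mul_ne_top (ENNReal.mul_ne_top ENNReal.coe_ne_top h2) (ENNReal.mul_ne_top
        (ENNReal.add_ne_top.2 ⟨ENNReal.mul_ne_top (by norm_num) (ENNReal.natCast_ne_top _),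
          ENNReal.one_ne_top⟩) h1))
  refine ⟨2 * K, ENNReal.mul_ne_top (by norm_num) hKt, fun D Φ hΦ hψ F hFD a => ?_⟩
  have hΦF : ∀ J ∈ F, IsMolecule B J (Φ J) := fun J hJ => hΦ J (hFD hJ)
  have hψ' := hψ
  obtain ⟨lo, hi, hlohi⟩ := hψ'
  set G : DyadicInterval → DyadicInterval → ℝ≥0∞ := fun J P =>
    if |P.k - J.k| ≤ c then ∫⁻ x, ‖Φ J x‖ₑ * ‖Φ P x‖ₑ else 0 with hG
  have hGsymm : ∀ J P, G J P = G P J := fun J P => by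
    simp only [hG, abs_sub_comm P.k J.k, mul_comm]
  have horth : ∀ J ∈ F, ∀ P ∈ F, ‖∫ x, Φ J x * conj (Φ P x)‖ₑ ≤ G J P := by
    intro J hJ P hP
    simp only [hG]
    split_ifs with hk
    · refine (enorm_integral_le_lintegral_enorm _).trans (le_of_eq ?_)
      simp [enorm_mul]
    · rw [integral_mul_conj_eq_zero (hΦF J hJ).integrable (hΦF P hP).integrable
        (hΦF P hP).continuous (hlohi P (hFD hP)).2.1, enorm_zero]
      intro ξ
      by_contra! hne
      have h1 := hsupp _ Φ (fun J hJ => (hΦ J hJ).integrable) hψ J (hFD hJ) ξ hne.1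
      have h2 := hsupp _ Φ (fun J hJ => (hΦ J hJ).integrable) hψ P (hFD hP) ξ hne.2
      apply hk
      have hξ : 0 < |ξ| := by
        rcases (abs_nonneg ξ).eq_or_lt with h | h
        · rw [← h, zero_mul] at h1
          linarith [h1.1, Real.rpow_pos_of_pos (show (0 : ℝ) < 2 by norm_num) (-b)]
        · exact h
      obtain ⟨t, ht⟩ : ∃ t : ℝ, |ξ| = 2 ^ t :=
        ⟨Real.logb 2 |ξ|, (Real.rpow_logb (by norm_num) (by norm_num) hξ).symm⟩
      have h2' : (1 : ℝ) < 2 := by norm_num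
      simp only [ht, DyadicInterval.length_eq, ← Real.rpow_intCast,
        ← Real.rpow_add (show (0 : ℝ) < 2 by norm_num), Real.rpow_le_rpow_left_iff h2'] at h1 h2
      have h3 : |((P.k - J.k : ℤ) : ℝ)| ≤ 2 * b := by
        push_cast; rw [abs_le]; constructor <;> linarith [h1.1, h1.2, h2.1, h2.2]
      have h4 := h3.trans (Nat.le_ceil (2 * b))
      exact_mod_cast h4
  have hrow : ∀ J ∈ F, ∑ P ∈ F, G J P ≤ K := by
    intro J hJ
    simp only [hG]
    rw [← Finset.sum_filter, ← lintegral_finsetSum' _ fun P hP => by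
      exact ((hΦF J hJ).measurable.enorm.mul
        (hΦF P (Finset.mem_filter.1 hP).1).measurable.enorm).aemeasurable]
    calc _ ≤ ∫⁻ x, ‖Φ J x‖ₑ *
          (B 2 * twoPow (-(J.k / 2)) * twoPow (c / 2) * ((2 * c + 1) * wtSum)) := by
          refine lintegral_mono fun x => ?_
          rw [← Finset.mul_sum]
          gcongr
          exact sum_enorm_near_scale_le F hΦF J.k c x
      _ ≤ (B 2 * wtSum * twoPow (J.k / 2)) *
          (B 2 * twoPow (-(J.k / 2)) * twoPow (c / 2) * ((2 * c + 1) * wtSum)) := by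
          rw [lintegral_mul_const _ (hΦF J hJ).measurable.enorm]
          gcongr
          exact (hΦF J hJ).lintegral_le
      _ = K * (twoPow (J.k / 2) * twoPow (-(J.k / 2))) := by rw [hK]; ring
      _ = K := by rw [twoPow_mul_neg, mul_one]
  calc ∫⁻ x, ‖∑ J ∈ F, a J * Φ J x‖ₑ ^ 2
      ≤ ∑ J ∈ F, ∑ P ∈ F, ‖a J‖ₑ * ‖a P‖ₑ * ‖∫ x, Φ J x * conj (Φ P x)‖ₑ :=
        lintegral_enorm_sum_sq_le F hΦF a
    _ ≤ ∑ J ∈ F, ∑ P ∈ F, (‖a J‖ₑ ^ 2 * G J P + ‖a P‖ₑ ^ 2 * G P J) := by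
        refine Finset.sum_le_sum fun J hJ => Finset.sum_le_sum fun P hP => ?_
        rw [← hGsymm J P, ← add_mul]
        gcongr
        · rcases le_total ‖a J‖ₑ ‖a P‖ₑ with hle | hle
          · exact (by gcongr : _ ≤ ‖a P‖ₑ * ‖a P‖ₑ).trans (by rw [← sq]; exact le_add_self)
          · exact (by gcongr : _ ≤ ‖a J‖ₑ * ‖a J‖ₑ).trans (by rw [← sq]; exact le_self_add)
        · exact horth J hJ P hP
    _ = 2 * ∑ J ∈ F, ‖a J‖ₑ ^ 2 * ∑ P ∈ F, G J P := by
        simp only [Finset.sum_add_distrib]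
        rw [Finset.sum_comm (f := fun J P => ‖a P‖ₑ ^ 2 * G P J), ← two_mul]
        simp only [Finset.mul_sum]
    _ ≤ 2 * ∑ J ∈ F, ‖a J‖ₑ ^ 2 * K := by
        refine mul_le_mul_right (Finset.sum_le_sum fun J hJ => ?_) _
        gcongr
        exact hrow J hJ
    _ = _ := by rw [← Finset.sum_mul]; ring

/-! ### Analysis coefficients: the `L²` bound -/

/-- A finite family of molecules whose superpositions satisfy an `L²` bound. -/
structure IsMoleculeFamily (B : ℕ → ℝ≥0) (B₂ : ℝ≥0∞) (D : Finset DyadicInterval)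
    (Φ : DyadicInterval → ℝ → ℂ) : Prop where
  isMolecule : ∀ J ∈ D, IsMolecule B J (Φ J)
  synthesis : SynthesisBound B₂ D Φ

/-- Absorption of a power of `Y` into the left side. Finiteness of `Y` is essential, so each
application first proves it for the finite family at hand. -/
lemma le_of_le_rpow_mul_rpow {Y Z : ℝ≥0∞} {θ : ℝ} (hθ : 0 < θ) (hθ1 : θ ≤ 1) (hY : Y ≠ ⊤)
    (h : Y ≤ Z ^ θ * Y ^ (1 - θ)) : Y ≤ Z := by
  rcases eq_or_ne Y 0 with rfl | h0
  · exact zero_le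
  have hsplit : Y ^ θ * Y ^ (1 - θ) = Y := by
    rw [← ENNReal.rpow_add_of_nonneg _ _ hθ.le (by linarith)]; simp
  rw [← ENNReal.rpow_le_rpow_iff hθ]
  refine (ENNReal.mul_le_mul_iff_left ?_ ?_).1 (hsplit.le.trans h)
  · exact (ENNReal.rpow_pos (pos_iff_ne_zero.2 h0) hY).ne'
  · exact ENNReal.rpow_ne_top_of_nonneg (by linarith) hY

lemma sum_conj_mul_pairing {F : Finset DyadicInterval} {Φ : DyadicInterval → ℝ → ℂ}
    {f : ℝ → ℂ} (hint : ∀ J ∈ F, Integrable fun x => f x * conj (Φ J x))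
    (a : DyadicInterval → ℂ) :
    ∑ J ∈ F, conj (a J) * pairing f (Φ J) = ∫ x, f x * conj (∑ J ∈ F, a J * Φ J x) := by
  simp only [map_sum, map_mul, Finset.mul_sum, pairing]
  rw [integral_finsetSum]
  · refine Finset.sum_congr rfl fun J _ => ?_
    rw [← integral_const_mul]
    congr with x
    ring
  · intro J hJ
    refine ((hint J hJ).const_mul (conj (a J))).congr (Filter.Eventually.of_forall fun x => ?_)
    simp only; ring

lemma enorm_conj (z : ℂ) : ‖conj z‖ₑ = ‖z‖ₑ := by
  rw [← ofReal_norm, ← ofReal_norm, RCLike.norm_conj]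

lemma enorm_pairing_le (f Φ : ℝ → ℂ) : ‖pairing f Φ‖ₑ ≤ ∫⁻ x, ‖f x‖ₑ * ‖Φ x‖ₑ := by
  refine (enorm_integral_le_lintegral_enorm _).trans (le_of_eq ?_)
  simp only [enorm_mul, enorm_conj]

lemma lintegral_mul_le_rpow {u v : ℝ → ℝ≥0∞} (hu : AEMeasurable u) (hv : AEMeasurable v)
    {a b θ : ℝ} (hθ : 0 ≤ θ) (hθ1 : θ ≤ 1) (ha : a * θ = 1) (hb : b * (1 - θ) = 1) :
    ∫⁻ x, u x * v x ≤ (∫⁻ x, u x ^ a) ^ θ * (∫⁻ x, v x ^ b) ^ (1 - θ) := by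
  have := ENNReal.lintegral_mul_norm_pow_le (hu.pow_const a) (hv.pow_const b) hθ
    (sub_nonneg.2 hθ1) (by ring) (μ := volume)
  simpa only [← ENNReal.rpow_mul, ha, hb, ENNReal.rpow_one] using this

lemma sq_lintegral_mul_le {u v : ℝ → ℝ≥0∞} (hu : AEMeasurable u) (hv : AEMeasurable v) :
    (∫⁻ x, u x * v x) ^ 2 ≤ (∫⁻ x, u x ^ 2) * ∫⁻ x, v x ^ 2 := by
  have h := lintegral_mul_le_rpow hu hv (a := 2) (b := 2) (θ := 1 / 2) (by norm_num) (by norm_num)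
    (by norm_num) (by norm_num)
  have h2 := pow_le_pow_left' h 2
  rw [mul_pow, ← ENNReal.rpow_natCast (_ ^ (1 / 2 : ℝ)), ← ENNReal.rpow_natCast
    (_ ^ (1 - 1 / 2 : ℝ)), ← ENNReal.rpow_mul, ← ENNReal.rpow_mul] at h2
  norm_num at h2
  exact h2

/-- Dual form of the synthesis bound. The sum `Y` is the pairing of `f` with the superposition whose
coefficients are those of `f`; Cauchy-Schwarz gives `Y ^ 2 ≤ B₂ * ‖f‖² * Y`, and `Y` is absorbed. -/
lemma sum_enorm_pairing_sq_le {B : ℕ → ℝ≥0} {B₂ : ℝ≥0∞} {D : Finset DyadicInterval}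
    {Φ : DyadicInterval → ℝ → ℂ} (h : IsMoleculeFamily B B₂ D Φ) {F : Finset DyadicInterval}
    (hF : F ⊆ D) {f : ℝ → ℂ} (hf : MemLp f 2) :
    ∑ J ∈ F, ‖pairing f (Φ J)‖ₑ ^ 2 ≤ B₂ * ∫⁻ x, ‖f x‖ₑ ^ 2 := by
  set Y := ∑ J ∈ F, ‖pairing f (Φ J)‖ₑ ^ 2 with hY
  set G : ℝ → ℂ := fun x => ∑ J ∈ F, pairing f (Φ J) * Φ J x with hG
  have hYt : Y ≠ ⊤ := ENNReal.sum_ne_top.2 fun J _ => ENNReal.pow_ne_top enorm_ne_top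
  have hGm : Continuous G := continuous_finsetSum _ fun J hJ =>
    continuous_const.mul (h.isMolecule J (hF hJ)).continuous
  have hint : ∀ J ∈ F, Integrable fun x => f x * conj (Φ J x) := fun J hJ => by
    have h2 := ((h.isMolecule J (hF hJ)).memLp (s := 2) (by norm_num)).star
    rw [show ENNReal.ofReal 2 = 2 by simp] at h2
    exact hf.integrable_mul h2
  have h1 : Y ≤ ∫⁻ x, ‖f x‖ₑ * ‖G x‖ₑ := by
    have h2 := sum_conj_mul_pairing hint (fun J => pairing f (Φ J))
    have h3 : ∑ J ∈ F, conj (pairing f (Φ J)) * pairing f (Φ J) =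
        ((∑ J ∈ F, ‖pairing f (Φ J)‖ ^ 2 : ℝ) : ℂ) := by
      push_cast
      exact Finset.sum_congr rfl fun J _ => by rw [RCLike.conj_mul]; simp
    have h4 : Y = ‖∑ J ∈ F, conj (pairing f (Φ J)) * pairing f (Φ J)‖ₑ := by
      rw [h3, ← ofReal_norm, Complex.norm_real, Real.norm_of_nonneg
        (Finset.sum_nonneg fun J _ => by positivity), ENNReal.ofReal_sum_of_nonneg
        (fun J _ => by positivity), hY]
      refine Finset.sum_congr rfl fun J _ => ?_
      rw [ENNReal.ofReal_pow (norm_nonneg _), ofReal_norm]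
    rw [h4, h2]
    exact enorm_pairing_le f G
  have h2 : Y ≤ (B₂ * ∫⁻ x, ‖f x‖ₑ ^ 2) ^ (1 / 2 : ℝ) * Y ^ (1 - 1 / 2 : ℝ) := by
    have h3 : Y ^ 2 ≤ B₂ * (∫⁻ x, ‖f x‖ₑ ^ 2) * Y := by
      calc Y ^ 2 ≤ (∫⁻ x, ‖f x‖ₑ * ‖G x‖ₑ) ^ 2 := by gcongr
        _ ≤ (∫⁻ x, ‖f x‖ₑ ^ 2) * ∫⁻ x, ‖G x‖ₑ ^ 2 :=
            sq_lintegral_mul_le hf.1.enorm hGm.measurable.enorm.aemeasurable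
        _ ≤ (∫⁻ x, ‖f x‖ₑ ^ 2) * (B₂ * Y) := by
            gcongr
            exact h.synthesis F hF _
        _ = _ := by ring
    have h4 := ENNReal.rpow_le_rpow h3 (show (0 : ℝ) ≤ 1 / 2 by norm_num)
    rw [ENNReal.mul_rpow_of_nonneg _ _ (by norm_num : (0 : ℝ) ≤ 1 / 2), ← ENNReal.rpow_natCast,
      ← ENNReal.rpow_mul] at h4
    norm_num at h4 ⊢
    exact h4
  exact le_of_le_rpow_mul_rpow (by norm_num) (by norm_num) hYt h2

/-! ### Localization to a dyadic interval -/

lemma inv_le_mul_inv_mul_inv {a c q t : ℝ≥0∞} (ha : a ≠ 0) (ha' : a ≠ ⊤) (hq : q ≠ 0)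
    (hq' : q ≠ ⊤) (ht : t ≠ 0) (ht' : t ≠ ⊤) (h : t * q ≤ c * a) : a⁻¹ ≤ c * t⁻¹ * q⁻¹ := by
  calc a⁻¹ = (t * t⁻¹) * (q * q⁻¹) * a⁻¹ := by
        rw [ENNReal.mul_inv_cancel ht ht', ENNReal.mul_inv_cancel hq hq', one_mul, one_mul]
    _ = (t * q) * (t⁻¹ * q⁻¹ * a⁻¹) := by ring
    _ ≤ (c * a) * (t⁻¹ * q⁻¹ * a⁻¹) := by gcongr
    _ = c * t⁻¹ * q⁻¹ * (a * a⁻¹) := by ring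
    _ = _ := by rw [ENNReal.mul_inv_cancel ha ha', mul_one]

/-- Away from the triple of `P`, the distances to `J` and to `P` are comparable. Measured in the
shorter unit `|J|` the distance is larger by the ratio of the lengths, so the weight gains that
ratio. -/
lemma wtAt_le_of_below {J P : DyadicInterval} (h : Below J P) {y : ℝ} (hy : y ∉ triple P) :
    wtAt J y ≤ 3 * twoPow (J.k - P.k) * wtAt P y := by
  obtain ⟨j, hj⟩ := Int.le.dest h.1
  have hPm : P.m = J.m / 2 ^ j := by
    have h1 := h.2 (left_mem_dset J)
    rw [mem_dset, ← hj, idx_add, mem_dset.1 (left_mem_dset J)] at h1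
    exact h1.symm
  have hPy : idx P.k y = idx J.k y / 2 ^ j := by rw [← hj, idx_add]
  set a := idx J.k y with ha
  set b := J.m with hb
  have hy' : 2 ≤ |a / 2 ^ j - b / 2 ^ j| := by
    simp only [triple, Set.mem_ofPred_eq, not_le, hPm, hPy] at hy
    omega
  have hp : (0 : ℤ) < 2 ^ j := by positivity
  -- Let `d ≥ 2` be the distance of the quotients. Rounding gives `2 ^ j * (d - 1) ≤ |a - b|`, and
  -- `1 + d ≤ 3 * (d - 1)` accounts for the factor three.
  have hnat : 2 ^ j * (1 + (a / 2 ^ j - b / 2 ^ j).natAbs) ≤ 3 * (1 + (a - b).natAbs) := by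
    have h1 := Int.emod_add_mul_ediv a (2 ^ j)
    have h2 := Int.emod_add_mul_ediv b (2 ^ j)
    have h3 := Int.emod_nonneg a hp.ne'
    have h4 := Int.emod_nonneg b hp.ne'
    have h5 := Int.emod_lt_of_pos a hp
    have h6 := Int.emod_lt_of_pos b hp
    have key : (2 : ℤ) ^ j * (1 + |a / 2 ^ j - b / 2 ^ j|) ≤ 3 * (1 + |a - b|) := by
      have h7 : (2 : ℤ) ^ j * |a / 2 ^ j - b / 2 ^ j| ≤ |a - b| + 2 ^ j := by
        have h8 : (2 : ℤ) ^ j * (a / 2 ^ j - b / 2 ^ j) =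
            (a - b) + (b % 2 ^ j - a % 2 ^ j) := by linarith
        rw [← abs_of_pos hp, ← abs_mul, abs_of_pos hp, h8]
        refine (abs_add_le _ _).trans ?_
        gcongr
        rw [abs_le]; constructor <;> linarith
      nlinarith
    zify
    exact key
  have hcast : twoPow j * ((1 + (a / 2 ^ j - b / 2 ^ j).natAbs : ℕ) : ℝ≥0∞) ≤
      3 * ((1 + (a - b).natAbs : ℕ) : ℝ≥0∞) := by
    have : twoPow j = ((2 ^ j : ℕ) : ℝ≥0∞) := by
      rw [twoPow, ENNReal.rpow_natCast]; push_cast; rfl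
    rw [this]
    exact_mod_cast hnat
  have hsub : (J.k : ℝ) - P.k = -(j : ℝ) := by
    rw [← hj]; push_cast; ring
  rw [wtAt, wtAt, ← ha, ← hb, hPy, hPm, hsub, ← twoPow_inv, wt, wt]
  exact inv_le_mul_inv_mul_inv (by positivity) (ENNReal.natCast_ne_top _) (by positivity)
    (ENNReal.natCast_ne_top _) (twoPow_ne_zero _) (twoPow_ne_top _) hcast

/-- Only two powers of the length ratio are kept, which suffices for summing over all `J` below `P`,
while all `N` powers of decay away from `P` are retained. -/
lemma wtAt_pow_le_of_below {J P : DyadicInterval} (h : Below J P) {y : ℝ}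
    (hy : y ∉ triple P) (N : ℕ) (hN : 2 ≤ N) :
    wtAt J y ^ N ≤ 3 ^ N * twoPow (2 * (J.k - P.k)) * wtAt P y ^ N := by
  have hle : twoPow (J.k - P.k) ≤ 1 := by
    rw [← twoPow_zero, twoPow_le]
    have : (J.k : ℝ) ≤ P.k := by exact_mod_cast h.1
    linarith
  calc wtAt J y ^ N ≤ (3 * twoPow (J.k - P.k) * wtAt P y) ^ N := by
        gcongr; exact wtAt_le_of_below h hy
    _ = 3 ^ N * twoPow (J.k - P.k) ^ N * wtAt P y ^ N := by rw [mul_pow, mul_pow]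
    _ ≤ _ := by
        gcongr
        rw [mul_comm (2 : ℝ), ← Nat.cast_ofNat, ← twoPow_pow]
        exact pow_le_pow_right_of_le_one' hle hN

lemma sum_eq_tsum_scale (F : Finset DyadicInterval) (u : DyadicInterval → ℝ≥0∞) :
    ∑ J ∈ F, u J = ∑' k : ℤ, ∑ J ∈ F.filter (fun J => J.k = k), u J := by
  rw [tsum_eq_sum (s := F.image DyadicInterval.k)]
  · exact (Finset.sum_fiberwise_of_maps_to (fun J hJ => Finset.mem_image_of_mem _ hJ) u).symm
  · intro k hk
    refine Finset.sum_eq_zero fun J hJ => ?_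
    obtain ⟨hJF, rfl⟩ := Finset.mem_filter.1 hJ
    exact absurd (Finset.mem_image_of_mem _ hJF) hk

lemma sum_twoPow_le_of_below {F : Finset DyadicInterval} {P : DyadicInterval}
    (h : ∀ J ∈ F, Below J P) (k : ℤ) :
    ∑ J ∈ F.filter (fun J => J.k = k), twoPow J.k ≤ if k ≤ P.k then twoPow P.k else 0 := by
  split_ifs with hk
  · rw [← volume_dset P, Finset.sum_congr rfl fun J _ => (volume_dset J).symm,
      ← measure_biUnion_finset _ fun J _ => measurableSet_dset J]
    · refine measure_mono (Set.iUnion₂_subset fun J hJ => (h J (Finset.mem_filter.1 hJ).1).2)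
    · intro J hJ Q hQ hne
      simp only [Finset.coe_filter, Set.mem_ofPred_eq] at hJ hQ
      exact disjoint_of_k_eq (hJ.2.trans hQ.2.symm) hne
  · rw [Finset.sum_eq_zero]
    intro J hJ
    obtain ⟨hJF, rfl⟩ := Finset.mem_filter.1 hJ
    exact absurd (h J hJF).1 hk

/-- At each scale the intervals are disjoint subsets of `P`, so their lengths total at most `|P|`.
The fourth power of the length ratio beats the factor `1 / |J|` and leaves a geometric series over
the scales. -/
lemma sum_scale_decay_le_of_below {F : Finset DyadicInterval} {P : DyadicInterval}
    (h : ∀ J ∈ F, Below J P) :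
    ∑ J ∈ F, twoPow (-J.k) * twoPow (4 * (J.k - P.k)) ≤ geomConst 2 * twoPow (-P.k) := by
  rw [sum_eq_tsum_scale]
  calc _ ≤ ∑' k : ℤ, twoPow (-(3 * P.k)) * (if k ≤ P.k then twoPow (k * 2) else 0) := by
        refine ENNReal.tsum_le_tsum fun k => ?_
        calc _ = twoPow (2 * k - 4 * P.k) * ∑ J ∈ F.filter (fun J => J.k = k), twoPow J.k := by
              rw [Finset.mul_sum]
              refine Finset.sum_congr rfl fun J hJ => ?_
              rw [(Finset.mem_filter.1 hJ).2, ← twoPow_add, ← twoPow_add]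
              congr 1; ring
          _ ≤ twoPow (2 * k - 4 * P.k) * if k ≤ P.k then twoPow P.k else 0 := by
              gcongr; exact sum_twoPow_le_of_below h k
          _ = _ := by
              split_ifs
              · rw [← twoPow_add, ← twoPow_add]; congr 1; ring
              · simp
    _ = _ := by
        rw [ENNReal.tsum_mul_left, tsum_int_le, ← mul_assoc, ← twoPow_add, mul_comm]
        congr 2; ring

lemma half_le_wtAt {P : DyadicInterval} {y : ℝ} (hy : y ∈ triple P) : 1 ≤ 2 * wtAt P y := by
  have h1 : (idx P.k y - P.m).natAbs ≤ 1 := by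
    simp only [triple, Set.mem_ofPred_eq, abs_le] at hy
    omega
  rw [wtAt, wt]
  have h2 : ((1 + (idx P.k y - P.m).natAbs : ℕ) : ℝ≥0∞) ≤ 2 := by exact_mod_cast (by omega)
  calc (1 : ℝ≥0∞) = 2 * 2⁻¹ := (ENNReal.mul_inv_cancel (by norm_num) (by norm_num)).symm
    _ ≤ _ := by gcongr

lemma add_sq_le_two_mul (a b : ℝ≥0∞) : (a + b) ^ 2 ≤ 2 * (a ^ 2 + b ^ 2) := by
  have := ENNReal.rpow_add_le_mul_rpow_add_rpow a b (p := 2) (by norm_num)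
  norm_num at this
  exact this

/-- The local `L²` bound: the coefficients of `f` over the intervals contained in `P` only see the
part of `f` near `P`. -/
lemma exists_sum_pairing_sq_le_local (B : ℕ → ℝ≥0) {B₂ : ℝ≥0∞} (hB₂ : B₂ ≠ ⊤) :
    ∃ C : ℝ≥0∞, C ≠ ⊤ ∧ ∀ (D : Finset DyadicInterval) (Φ : DyadicInterval → ℝ → ℂ),
      IsMoleculeFamily B B₂ D Φ → ∀ f : ℝ → ℂ, AEStronglyMeasurable f →
      (∀ J ∈ D, Integrable fun x => f x * conj (Φ J x)) →
      ∀ (P : DyadicInterval), ∀ F ⊆ D, (∀ J ∈ F, Below J P) →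
        ∑ J ∈ F, ‖pairing f (Φ J)‖ₑ ^ 2 ≤ C * ∫⁻ x, ‖f x‖ₑ ^ 2 * wtAt P x ^ 5 := by
  set C₂ : ℝ≥0∞ := (B 5 * 3 ^ 5) ^ 2 * (geomConst 2 * wtSum) with hC₂
  have hC₂t : C₂ ≠ ⊤ := ENNReal.mul_ne_top
    (ENNReal.pow_ne_top (ENNReal.mul_ne_top ENNReal.coe_ne_top (by norm_num)))
    (ENNReal.mul_ne_top (geomConst_ne_top (by norm_num)) wtSum_ne_top)
  -- The summand `1` keeps the constant nonzero, so that the case of an infinite right side is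
  -- trivial.
  refine ⟨2 * (B₂ * 2 ^ 5 + C₂) + 1, ENNReal.add_ne_top.2 ⟨ENNReal.mul_ne_top (by norm_num)
    (ENNReal.add_ne_top.2 ⟨ENNReal.mul_ne_top hB₂ (by norm_num), hC₂t⟩), ENNReal.one_ne_top⟩,
    fun D Φ h f hf hint P F hF hP => ?_⟩
  set I := ∫⁻ x, ‖f x‖ₑ ^ 2 * wtAt P x ^ 5 with hI
  have hTm := measurableSet_triple P
  have hnear : ∫⁻ x, ‖(triple P).indicator f x‖ₑ ^ 2 ≤ 2 ^ 5 * I := by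
    rw [hI, ← lintegral_const_mul' _ _ (by norm_num)]
    refine lintegral_mono fun x => ?_
    by_cases hx : x ∈ triple P
    · rw [Set.indicator_of_mem hx]
      calc ‖f x‖ₑ ^ 2 = ‖f x‖ₑ ^ 2 * 1 ^ 5 := by simp
        _ ≤ ‖f x‖ₑ ^ 2 * (2 * wtAt P x) ^ 5 := by gcongr; exact half_le_wtAt hx
        _ = _ := by ring
    · simp [hx]
  rcases eq_or_ne I ⊤ with hIt | hIt
  · rw [hIt, ENNReal.mul_top (by simp)]
    exact le_top
  have hfnear : MemLp ((triple P).indicator f) 2 := by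
    refine ⟨hf.indicator hTm, ?_⟩
    rw [eLpNorm_lt_top_iff_lintegral_rpow_enorm_lt_top (by norm_num) (by norm_num)]
    simp only [ENNReal.toReal_ofNat, ENNReal.rpow_ofNat]
    exact hnear.trans_lt (ENNReal.mul_lt_top (by norm_num) hIt.lt_top)
  -- The far part of `f` uses no orthogonality: each coefficient is small by decay, and the squares
  -- sum by `sum_scale_decay_le_of_below`.
  have hfar : ∀ J ∈ F, ‖pairing ((triple P)ᶜ.indicator f) (Φ J)‖ₑ ^ 2 ≤
      (B 5 * 3 ^ 5) ^ 2 * wtSum * twoPow P.k * I *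
        (twoPow (-J.k) * twoPow (4 * (J.k - P.k))) := by
    intro J hJ
    have h1 : ‖pairing ((triple P)ᶜ.indicator f) (Φ J)‖ₑ ≤
        B 5 * 3 ^ 5 * (twoPow (-(J.k / 2)) * twoPow (2 * (J.k - P.k))) *
          ∫⁻ x, ‖f x‖ₑ * wtAt P x ^ 5 := by
      refine (enorm_pairing_le _ _).trans ?_
      rw [← lintegral_const_mul' _ _ (ENNReal.mul_ne_top (ENNReal.mul_ne_top ENNReal.coe_ne_top
        (by norm_num)) (ENNReal.mul_ne_top (twoPow_ne_top _) (twoPow_ne_top _)))]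
      refine lintegral_mono fun x => ?_
      by_cases hx : x ∈ triple P
      · simp [hx]
      · rw [Set.indicator_of_mem (by exact hx)]
        calc ‖f x‖ₑ * ‖Φ J x‖ₑ
            ≤ ‖f x‖ₑ * (B 5 * twoPow (-(J.k / 2)) *
                (3 ^ 5 * twoPow (2 * (J.k - P.k)) * wtAt P x ^ 5)) := by
              gcongr
              refine ((h.isMolecule J (hF hJ)).decay 5 x).trans ?_
              gcongr
              exact wtAt_pow_le_of_below (hP J hJ) hx 5 (by norm_num)
          _ = _ := by ring
    have h2 : (∫⁻ x, ‖f x‖ₑ * wtAt P x ^ 5) ^ 2 ≤ I * (wtSum * twoPow P.k) := by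
      have h3 : ∀ x, wtAt P x ^ 5 ≤ (wtAt P x ^ 5) ^ (1 / 2 : ℝ) * (wtAt P x ^ 5) ^ (1 / 2 : ℝ) :=
        fun x => by
          rw [← ENNReal.rpow_add_of_nonneg _ _ (by norm_num) (by norm_num)]; norm_num
      have hsq : ∀ x, ((wtAt P x ^ 5) ^ (1 / 2 : ℝ)) ^ 2 = wtAt P x ^ 5 := fun x => by
        rw [← ENNReal.rpow_natCast (_ ^ (1 / 2 : ℝ)), ← ENNReal.rpow_mul]; norm_num
      have hm : Measurable fun x => (wtAt P x ^ 5) ^ (1 / 2 : ℝ) :=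
        ((measurable_wtAt P).pow_const 5).pow_const _
      calc (∫⁻ x, ‖f x‖ₑ * wtAt P x ^ 5) ^ 2
          ≤ (∫⁻ x, (‖f x‖ₑ * (wtAt P x ^ 5) ^ (1 / 2 : ℝ)) * (wtAt P x ^ 5) ^ (1 / 2 : ℝ)) ^ 2 := by
            refine pow_le_pow_left' (lintegral_mono fun x => ?_) 2
            rw [mul_assoc]
            exact mul_le_mul_right (h3 x) _
        _ ≤ (∫⁻ x, (‖f x‖ₑ * (wtAt P x ^ 5) ^ (1 / 2 : ℝ)) ^ 2) *
              ∫⁻ x, ((wtAt P x ^ 5) ^ (1 / 2 : ℝ)) ^ 2 :=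
            sq_lintegral_mul_le (hf.enorm.mul hm.aemeasurable) hm.aemeasurable
        _ ≤ I * (wtSum * twoPow P.k) := by
            rw [← lintegral_wtAt_sq]
            simp only [mul_pow, hsq]
            exact mul_le_mul' le_rfl (lintegral_mono fun x => wt_pow_le (by norm_num) _)
    calc _ ≤ (B 5 * 3 ^ 5 * (twoPow (-(J.k / 2)) * twoPow (2 * (J.k - P.k))) *
          ∫⁻ x, ‖f x‖ₑ * wtAt P x ^ 5) ^ 2 := by gcongr
      _ = (B 5 * 3 ^ 5) ^ 2 * (twoPow (-(J.k / 2)) ^ 2 * twoPow (2 * (J.k - P.k)) ^ 2) *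
          (∫⁻ x, ‖f x‖ₑ * wtAt P x ^ 5) ^ 2 := by ring
      _ ≤ (B 5 * 3 ^ 5) ^ 2 * (twoPow (-(J.k / 2)) ^ 2 * twoPow (2 * (J.k - P.k)) ^ 2) *
          (I * (wtSum * twoPow P.k)) := by gcongr
      _ = _ := by
          rw [twoPow_pow, twoPow_pow, show -((J.k : ℝ) / 2) * (2 : ℕ) = -J.k by push_cast; ring,
            show 2 * ((J.k : ℝ) - P.k) * (2 : ℕ) = 4 * (J.k - P.k) by push_cast; ring]
          ring
  have hsplit : ∀ J ∈ F, ‖pairing f (Φ J)‖ₑ ^ 2 ≤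
      2 * (‖pairing ((triple P).indicator f) (Φ J)‖ₑ ^ 2 +
        ‖pairing ((triple P)ᶜ.indicator f) (Φ J)‖ₑ ^ 2) := by
    intro J hJ
    refine le_trans ?_ (add_sq_le_two_mul _ _)
    gcongr
    have hi := hint J (hF hJ)
    have heq : ∀ s : Set ℝ, (fun x => s.indicator f x * conj (Φ J x)) =
        s.indicator fun x => f x * conj (Φ J x) := fun s => by
      ext x; by_cases hx : x ∈ s <;> simp [hx]
    have : pairing f (Φ J) = pairing ((triple P).indicator f) (Φ J) +
        pairing ((triple P)ᶜ.indicator f) (Φ J) := by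
      simp only [pairing, heq]
      rw [integral_indicator hTm, integral_indicator hTm.compl, integral_add_compl hTm hi]
    rw [this]
    exact enorm_add_le _ _
  calc ∑ J ∈ F, ‖pairing f (Φ J)‖ₑ ^ 2
      ≤ ∑ J ∈ F, 2 * (‖pairing ((triple P).indicator f) (Φ J)‖ₑ ^ 2 +
          ‖pairing ((triple P)ᶜ.indicator f) (Φ J)‖ₑ ^ 2) := Finset.sum_le_sum hsplit
    _ = 2 * (∑ J ∈ F, ‖pairing ((triple P).indicator f) (Φ J)‖ₑ ^ 2 +
          ∑ J ∈ F, ‖pairing ((triple P)ᶜ.indicator f) (Φ J)‖ₑ ^ 2) := by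
        rw [← Finset.mul_sum, Finset.sum_add_distrib]
    _ ≤ 2 * (B₂ * (2 ^ 5 * I) + (B 5 * 3 ^ 5) ^ 2 * wtSum * twoPow P.k * I *
          (geomConst 2 * twoPow (-P.k))) := by
        gcongr
        · exact (sum_enorm_pairing_sq_le h hF hfnear).trans (by gcongr)
        · refine (Finset.sum_le_sum hfar).trans ?_
          rw [← Finset.mul_sum]
          gcongr
          exact sum_scale_decay_le_of_below hP
    _ = 2 * (B₂ * 2 ^ 5 + C₂ * (twoPow P.k * twoPow (-P.k))) * I := by rw [hC₂]; ring
    _ = 2 * (B₂ * 2 ^ 5 + C₂) * I := by rw [twoPow_mul_neg, mul_one]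
    _ ≤ _ := by gcongr; exact le_self_add

/-! ### The shifted square function for `p ≥ 2` -/

open Classical in
/-- The maximal elements of a finite family of dyadic intervals. -/
def maxFinset (F : Finset DyadicInterval) : Finset DyadicInterval :=
  F.filter fun P => P ∈ maximals (F : Set DyadicInterval)

lemma coe_maxFinset (F : Finset DyadicInterval) :
    (maxFinset F : Set DyadicInterval) = maximals (F : Set DyadicInterval) := by
  ext P
  simp only [maxFinset, Finset.coe_filter, Set.mem_ofPred_eq, and_iff_right_iff_imp]
  exact fun h => h.1

lemma mem_maxFinset {F : Finset DyadicInterval} {P : DyadicInterval} :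
    P ∈ maxFinset F ↔ P ∈ maximals (F : Set DyadicInterval) := by
  rw [← Finset.mem_coe, coe_maxFinset]

lemma sum_lintegral_maxFinset (F : Finset DyadicInterval) (g : ℝ → ℝ≥0∞) :
    ∑ P ∈ maxFinset F, ∫⁻ x in dset P, g x = ∫⁻ x in dUnion F, g x := by
  obtain ⟨K, hK⟩ := exists_k_le F
  rw [← dUnion_maximals hK, ← coe_maxFinset, dUnion]
  simp only [Finset.mem_coe]
  rw [lintegral_biUnion_finset _ fun J _ => measurableSet_dset J]
  rw [coe_maxFinset]
  exact pairwiseDisjoint_maximals _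

lemma sum_twoPow_maxFinset (F : Finset DyadicInterval) :
    ∑ P ∈ maxFinset F, twoPow P.k = volume (dUnion F) := by
  simpa [volume_dset] using sum_lintegral_maxFinset F fun _ => 1

open Classical in
lemma biUnion_maxFinset (F : Finset DyadicInterval) :
    (maxFinset F).biUnion (fun P => F.filter fun J => Below J P) = F := by
  obtain ⟨K, hK⟩ := exists_k_le F
  ext J
  simp only [Finset.mem_biUnion, Finset.mem_filter]
  constructor
  · rintro ⟨P, -, h, -⟩; exact h
  · intro hJ
    obtain ⟨P, hP, hJP⟩ := exists_maximals hK (Finset.mem_coe.2 hJ)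
    exact ⟨P, mem_maxFinset.2 hP, hJ, hJP⟩

/-- A Carleson packing estimate. The family is grouped below its maximal members `P`, which are
disjoint. The local bound at `P` is `|P|` times a weighted mean of `‖f‖²`, and this mean is at most
the maximal function at every point of `P`. -/
lemma exists_sum_pairing_sq_le_tailMax (B : ℕ → ℝ≥0) {B₂ : ℝ≥0∞} (hB₂ : B₂ ≠ ⊤) :
    ∃ C : ℝ≥0∞, C ≠ ⊤ ∧ ∀ (D : Finset DyadicInterval) (Φ : DyadicInterval → ℝ → ℂ),
      IsMoleculeFamily B B₂ D Φ → ∀ f : ℝ → ℂ, AEStronglyMeasurable f →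
      (∀ J ∈ D, Integrable fun x => f x * conj (Φ J x)) → ∀ F ⊆ D,
        ∑ J ∈ F, ‖pairing f (Φ J)‖ₑ ^ 2 ≤
          C * ∫⁻ x in dUnion F, tailMax D 0 (fun y => ‖f y‖ₑ ^ 2) x := by
  classical
  obtain ⟨C, hC, hloc⟩ := exists_sum_pairing_sq_le_local B hB₂
  refine ⟨C, hC, fun D Φ h f hf hint F hF => ?_⟩
  calc ∑ J ∈ F, ‖pairing f (Φ J)‖ₑ ^ 2
      = ∑ J ∈ (maxFinset F).biUnion (fun P => F.filter fun J => Below J P),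
          ‖pairing f (Φ J)‖ₑ ^ 2 := by rw [biUnion_maxFinset]
    _ ≤ ∑ P ∈ maxFinset F, ∑ J ∈ F.filter (fun J => Below J P), ‖pairing f (Φ J)‖ₑ ^ 2 :=
        apply_biUnion_le_sum (X := fun G => ∑ J ∈ G, ‖pairing f (Φ J)‖ₑ ^ 2) (by simp)
          (fun F G => sum_union_le F G _) _ _
    _ ≤ ∑ P ∈ maxFinset F, C * ∫⁻ x in dset P, tailMax D 0 (fun y => ‖f y‖ₑ ^ 2) x := by
        refine Finset.sum_le_sum fun P hP => ?_
        have hPD : P ∈ (D : Set DyadicInterval) :=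
          Finset.mem_coe.2 (hF (Finset.mem_coe.1 (mem_maxFinset.1 hP).1))
        refine (hloc D Φ h f hf hint P _ ((Finset.filter_subset _ _).trans hF)
          fun J hJ => (Finset.mem_filter.1 hJ).2).trans ?_
        refine mul_le_mul_right ?_ _
        set I := ∫⁻ x, ‖f x‖ₑ ^ 2 * wtAt P x ^ 5 with hI
        calc I = ∫⁻ x in dset P, twoPow (-P.k) * I := by
              rw [setLIntegral_const, volume_dset, mul_right_comm, ← twoPow_add, neg_add_cancel,
                twoPow_zero, one_mul]
          _ ≤ _ := by
              refine setLIntegral_mono' (measurableSet_dset P) fun x hx => ?_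
              refine le_trans (le_of_eq ?_) (le_tailMax hPD hx)
              rw [shift_zero]
    _ = _ := by rw [← Finset.mul_sum, sum_lintegral_maxFinset]

/-- The coefficients of the square function. -/
def coeffSq (f : ℝ → ℂ) (Φ : DyadicInterval → ℝ → ℂ) (J : DyadicInterval) : ℝ≥0∞ :=
  ‖pairing f (Φ J)‖ₑ ^ 2 * twoPow (-J.k)

lemma coeffSq_ne_top (f : ℝ → ℂ) (Φ : DyadicInterval → ℝ → ℂ) (J : DyadicInterval) :
    coeffSq f Φ J ≠ ⊤ :=
  ENNReal.mul_ne_top (ENNReal.pow_ne_top enorm_ne_top) (twoPow_ne_top _)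

lemma coeffSq_mul_twoPow (f : ℝ → ℂ) (Φ : DyadicInterval → ℝ → ℂ) (J : DyadicInterval) :
    coeffSq f Φ J * twoPow J.k = ‖pairing f (Φ J)‖ₑ ^ 2 := by
  rw [coeffSq, mul_assoc, ← twoPow_add, neg_add_cancel, twoPow_zero, mul_one]

/-- A Carleson embedding estimate for the shifted square function. -/
lemma exists_lintegral_shiftSum_mul_le (B : ℕ → ℝ≥0) {B₂ : ℝ≥0∞} (hB₂ : B₂ ≠ ⊤) :
    ∃ C : ℝ≥0∞, C ≠ ⊤ ∧ ∀ (D : Finset DyadicInterval) (Φ : DyadicInterval → ℝ → ℂ),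
      IsMoleculeFamily B B₂ D Φ → ∀ f : ℝ → ℂ, AEStronglyMeasurable f →
      (∀ J ∈ D, Integrable fun x => f x * conj (Φ J x)) → ∀ (n : ℤ) (w : ℝ → ℝ≥0∞),
      Measurable w → ∫⁻ x, shiftSum D n (coeffSq f Φ) x * w x ≤
          C * ∫⁻ x, tailMax D 0 (fun y => ‖f y‖ₑ ^ 2) x * maxFn D n w x := by
  classical
  obtain ⟨C, hC, hloc⟩ := exists_sum_pairing_sq_le_tailMax B hB₂
  refine ⟨2 * C * geomConst 1, ENNReal.mul_ne_top (ENNReal.mul_ne_top (by norm_num) hC)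
    (geomConst_ne_top one_pos), fun D Φ h f hf hint n w hw => ?_⟩
  set M := tailMax D 0 (fun y => ‖f y‖ₑ ^ 2) with hM
  have hMm : Measurable M := measurable_tailMax _ _ _
  set a : DyadicInterval → ℝ≥0∞ := fun J => twoPow (-J.k) * ∫⁻ x in dset (J.shift n), w x with ha
  set d : DyadicInterval → ℝ≥0∞ := fun J => ‖pairing f (Φ J)‖ₑ ^ 2 with hd
  have hset : ∀ k : ℤ, dUnion ((D.filter fun J => twoPow k < a J : Finset DyadicInterval) :
      Set DyadicInterval) = {x | twoPow k < maxFn D n w x} := fun k => by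
    ext x
    rw [Set.mem_ofPred_eq, lt_maxFn_iff, Finset.coe_filter]
    rfl
  calc ∫⁻ x, shiftSum D n (coeffSq f Φ) x * w x
      = ∑ J ∈ D, d J * a J := by
        rw [lintegral_shiftSum_mul _ _ _ hw]
        refine Finset.sum_congr rfl fun J _ => ?_
        rw [coeffSq, mul_assoc]
    -- Each mean `a J` is resolved into dyadic levels. The intervals with `a J > 2 ^ k` fill exactly
    -- the superlevel set of the shifted maximal function, where the packing estimate applies.
    _ ≤ ∑ J ∈ D, d J * (2 * ∑' k : ℤ, (if twoPow k < a J then twoPow k else 0)) := by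
        gcongr with J hJ
        simpa [twoPow_one] using le_tsum_level one_pos (a J)
    _ = 2 * ∑' k : ℤ, twoPow k * ∑ J ∈ D.filter (fun J => twoPow k < a J), d J := by
        simp only [Finset.mul_sum, ← ENNReal.tsum_mul_left]
        rw [← Summable.tsum_finsetSum fun _ _ => ENNReal.summable]
        refine tsum_congr fun k => ?_
        rw [Finset.sum_filter]
        refine Finset.sum_congr rfl fun J _ => ?_
        split_ifs <;> ring
    _ ≤ 2 * ∑' k : ℤ, twoPow k * (C * ∫⁻ x in {x | twoPow k < maxFn D n w x}, M x) := by
        gcongr with k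
        rw [← hset]
        exact hloc D Φ h f hf hint _ (Finset.filter_subset _ _)
    _ = 2 * C * ∫⁻ x, M x * ∑' k : ℤ, (if twoPow k < maxFn D n w x then twoPow k else 0) := by
        simp only [← ENNReal.tsum_mul_left]
        rw [lintegral_tsum, ← ENNReal.tsum_mul_left]
        · refine tsum_congr fun k => ?_
          have hm : MeasurableSet {x | twoPow k < maxFn D n w x} :=
            measurableSet_lt measurable_const (measurable_maxFn _ _ _)
          rw [← lintegral_indicator hm]
          have : ∫⁻ x, M x * (if twoPow k < maxFn D n w x then twoPow k else 0) =
              twoPow k * ∫⁻ x, {x | twoPow k < maxFn D n w x}.indicator M x := by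
            rw [← lintegral_const_mul' _ _ (twoPow_ne_top _)]
            refine lintegral_congr fun x => ?_
            by_cases hx : twoPow k < maxFn D n w x
            · simp [hx, mul_comm]
            · simp [hx]
          rw [this]; ring
        · intro k
          exact (hMm.mul (Measurable.ite (measurableSet_lt measurable_const
            (measurable_maxFn _ _ _)) measurable_const measurable_const)).aemeasurable
    _ ≤ 2 * C * ∫⁻ x, M x * (geomConst 1 * maxFn D n w x) := by
        gcongr with x
        simpa using tsum_level_lt_le one_pos (maxFn D n w x)
    _ = _ := by
        rw [mul_assoc (2 * C), ← lintegral_const_mul' _ _ (geomConst_ne_top one_pos)]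
        congr 2 with x
        ring

lemma shiftSum_le_sum (D : Finset DyadicInterval) (n : ℤ) (c : DyadicInterval → ℝ≥0∞) (x : ℝ) :
    shiftSum D n c x ≤ ∑ J ∈ D, c J :=
  Finset.sum_le_sum fun _ _ => Set.indicator_le_self _ _ x

lemma lintegral_shiftSum_rpow_ne_top {D : Finset DyadicInterval} {c : DyadicInterval → ℝ≥0∞}
    (hc : ∀ J ∈ D, c J ≠ ⊤) (n : ℤ) {s : ℝ} (hs : 0 < s) :
    ∫⁻ x, shiftSum D n c x ^ s ≠ ⊤ := by
  set E := dUnion ((D.image fun J => J.shift n : Finset DyadicInterval) : Set DyadicInterval)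
  have hE : volume E ≠ ⊤ := volume_dUnion_ne_top _
  refine ne_top_of_le_ne_top (ENNReal.mul_ne_top
    (ENNReal.rpow_ne_top_of_nonneg hs.le (ENNReal.sum_ne_top.2 hc)) hE) ?_
  rw [← lintegral_indicator_const (measurableSet_dUnion _)]
  refine lintegral_mono fun x => ?_
  by_cases hx : x ∈ E
  · rw [Set.indicator_of_mem hx]
    gcongr
    exact shiftSum_le_sum D n c x
  · have : shiftSum D n c x = 0 := Finset.sum_eq_zero fun J hJ => Set.indicator_of_notMem
      (fun h => hx (dset_subset_dUnion (Finset.mem_coe.2 (Finset.mem_image_of_mem _ hJ)) h)) _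
    rw [this, ENNReal.zero_rpow_of_pos hs]
    exact zero_le

lemma lg_rpow_le {a b : ℝ} (h : a ≤ b) (n : ℤ) : lg n ^ a ≤ lg n ^ b :=
  ENNReal.rpow_le_rpow_of_exponent_le (one_le_lg n) h

/-- The shifted square function estimate for `p > 2`. -/
lemma exists_lintegral_square_le_of_two_lt (B : ℕ → ℝ≥0) {B₂ : ℝ≥0∞} (hB₂ : B₂ ≠ ⊤) {p : ℝ}
    (hp : 2 < p) :
    ∃ C : ℝ≥0∞, C ≠ ⊤ ∧ ∀ (D : Finset DyadicInterval) (Φ : DyadicInterval → ℝ → ℂ),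
      IsMoleculeFamily B B₂ D Φ → ∀ f : ℝ → ℂ, Measurable f →
      (∀ J ∈ D, Integrable fun x => f x * conj (Φ J x)) → ∀ n : ℤ,
      ∫⁻ x, shiftSum D n (coeffSq f Φ) x ^ (p / 2) ≤ C * lg n ^ p * ∫⁻ x, ‖f x‖ₑ ^ p := by
  set u := p / 2 with hu
  have hu1 : 1 < u := by rw [hu]; linarith
  have hu0 : 0 < u := by linarith
  set v := u / (u - 1) with hv
  have hv1 : 1 < v := by rw [hv, one_lt_div (by linarith)]; linarith
  obtain ⟨C₀, hC₀, h₀⟩ := exists_lintegral_shiftSum_mul_le B hB₂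
  obtain ⟨C₁, hC₁, h₁⟩ := exists_lintegral_tailMax_rpow_le hu1
  set C₂ := twoPow (2 * v) * 5 * geomConst (v - 1) with hC₂
  have hC₂t : C₂ ≠ ⊤ := ENNReal.mul_ne_top (ENNReal.mul_ne_top (twoPow_ne_top _) (by norm_num))
    (geomConst_ne_top (by linarith))
  refine ⟨C₀ ^ u * C₁ * C₂ ^ (u - 1), ENNReal.mul_ne_top (ENNReal.mul_ne_top
    (ENNReal.rpow_ne_top_of_nonneg hu0.le hC₀) hC₁)
    (ENNReal.rpow_ne_top_of_nonneg (by linarith) hC₂t), fun D Φ h f hf hint n => ?_⟩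
  set V := shiftSum D n (coeffSq f Φ) with hV
  have hVm : Measurable V := measurable_shiftSum _ _ _
  set Y := ∫⁻ x, V x ^ u with hY
  set X := ∫⁻ x, ‖f x‖ₑ ^ p with hX
  -- Finiteness comes from `D` being finite and permits the final absorption.
  have hYt : Y ≠ ⊤ := lintegral_shiftSum_rpow_ne_top (fun J _ => coeffSq_ne_top f Φ J) n hu0
  have hVw : ∀ x, V x ^ u = V x * V x ^ (u - 1) := fun x => by
    conv_rhs => rw [← ENNReal.rpow_one (V x), ← ENNReal.rpow_mul, one_mul]
    rw [← ENNReal.rpow_add_of_nonneg _ _ (by norm_num) (by linarith)]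
    congr 1; ring
  have hθ : (1 : ℝ) - 1 / u = 1 / v := by rw [hv]; field_simp
  -- The dual function is `V ^ (u - 1)`, whose `v`-th power is `V ^ u`. Thus the maximal theorem on
  -- `L^v` returns a power of `Y` itself.
  have hmain : Y ≤ (C₀ ^ u * C₁ * C₂ ^ (u - 1) * lg n ^ (u - 1) * X) ^ (1 / u) *
      Y ^ (1 - 1 / u) := by
    have h2 : Y ≤ C₀ * ∫⁻ x, tailMax D 0 (fun y => ‖f y‖ₑ ^ 2) x *
        maxFn D n (fun x => V x ^ (u - 1)) x := by
      rw [hY, lintegral_congr hVw]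
      exact h₀ D Φ h f hf.aestronglyMeasurable hint n _ (hVm.pow_const _)
    have h3 := h₁ D 0 (fun y => ‖f y‖ₑ ^ 2) (hf.enorm.pow_const 2)
    have h4 := lintegral_maxFn_rpow_le hv1 (D : Set DyadicInterval) n
      (h := fun x => V x ^ (u - 1)) (hVm.pow_const _)
    have h5 : ∫⁻ x, (‖f x‖ₑ ^ 2) ^ u = X := by
      refine lintegral_congr fun x => ?_
      rw [← ENNReal.rpow_natCast, ← ENNReal.rpow_mul]
      congr 1; rw [hu]; push_cast; ring
    have h6 : ∫⁻ x, (V x ^ (u - 1)) ^ v = Y := by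
      refine lintegral_congr fun x => ?_
      rw [← ENNReal.rpow_mul]
      congr 1; rw [hv, mul_div_cancel₀ _ (by linarith)]
    rw [h5, lg_zero, mul_one] at h3
    rw [h6] at h4
    have h7 := lintegral_mul_le_rpow (a := u) (b := v) (θ := 1 / u)
      (measurable_tailMax D 0 (fun y => ‖f y‖ₑ ^ 2)).aemeasurable
      (measurable_maxFn D n (fun x => V x ^ (u - 1))).aemeasurable (by positivity)
      (by rw [div_le_one hu0]; exact hu1.le) (by field_simp)
      (by rw [hθ]; field_simp)
    calc Y ≤ C₀ * ((C₁ * X) ^ (1 / u) * (C₂ * lg n * Y) ^ (1 - 1 / u)) := by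
          refine h2.trans ?_
          gcongr
          refine h7.trans ?_
          have : 0 ≤ 1 - 1 / u := by rw [hθ]; positivity
          gcongr
      _ = _ := by
          have e0 : 0 ≤ 1 / u := by positivity
          have e1 : 0 ≤ 1 - 1 / u := by rw [hθ]; positivity
          have e2 : 1 - 1 / u = (u - 1) * (1 / u) := by field_simp
          rw [ENNReal.mul_rpow_of_nonneg _ _ e1, ENNReal.mul_rpow_of_nonneg _ _ e1,
            ENNReal.mul_rpow_of_nonneg _ _ e0, ENNReal.mul_rpow_of_nonneg _ _ e0,
            ENNReal.mul_rpow_of_nonneg _ _ e0, ENNReal.mul_rpow_of_nonneg _ _ e0,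
            ENNReal.mul_rpow_of_nonneg _ _ e0, ← ENNReal.rpow_mul C₀, ← ENNReal.rpow_mul C₂,
            ← ENNReal.rpow_mul (lg n), ← e2, mul_one_div_cancel hu0.ne', ENNReal.rpow_one]
          ring
  refine (le_of_le_rpow_mul_rpow (by positivity) (by rw [div_le_one hu0]; exact hu1.le) hYt
    hmain).trans ?_
  -- The argument yields the power `u - 1` of the logarithm; it is relaxed to `p` so that all
  -- exponents share one form.
  have hup : u - 1 ≤ p := by rw [hu]; linarith
  exact mul_le_mul_left (mul_le_mul_right (lg_rpow_le hup n) _) _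

lemma lintegral_square_le_two {B : ℕ → ℝ≥0} {B₂ : ℝ≥0∞} {D : Finset DyadicInterval}
    {Φ : DyadicInterval → ℝ → ℂ} (h : IsMoleculeFamily B B₂ D Φ) {f : ℝ → ℂ} (hf : MemLp f 2)
    (n : ℤ) : ∫⁻ x, shiftSum D n (coeffSq f Φ) x ≤ B₂ * ∫⁻ x, ‖f x‖ₑ ^ 2 := by
  rw [lintegral_shiftSum]
  simp only [coeffSq_mul_twoPow]
  exact sum_enorm_pairing_sq_le h subset_rfl hf

/-! ### The Calderón–Zygmund decomposition -/

lemma closedBall_ae_eq_dset (J : DyadicInterval) :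
    Metric.closedBall ((2 : ℝ) ^ J.k * (J.m + 1 / 2)) ((2 : ℝ) ^ J.k / 2) =ᵐ[volume] dset J := by
  rw [dset_eq, Real.closedBall_eq_Icc]
  have h1 : (2 : ℝ) ^ J.k * (J.m + 1 / 2) - 2 ^ J.k / 2 = 2 ^ J.k * J.m := by ring
  have h2 : (2 : ℝ) ^ J.k * (J.m + 1 / 2) + 2 ^ J.k / 2 = 2 ^ J.k * (J.m + 1) := by ring
  rw [h1, h2]
  exact Ico_ae_eq_Icc.symm

/-- The Lebesgue differentiation theorem along dyadic intervals. -/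
lemma ae_enorm_le_maxFn {f : ℝ → ℂ} (hf : LocallyIntegrable f) :
    ∀ᵐ x, ‖f x‖ₑ ≤ maxFn Set.univ 0 (fun y => ‖f y‖ₑ) x := by
  have hn : LocallyIntegrable fun y => ‖f y‖ := fun x => (hf x).norm
  -- Up to a null set, the dyadic interval of length `2 ^ (-j)` around `x` is a ball containing `x`,
  -- though not centred there; the differentiation theorem allows such balls.
  filter_upwards [IsUnifLocDoublingMeasure.ae_tendsto_average volume hn 1] with x hx
  set P : ℕ → DyadicInterval := fun j => ⟨-j, idx (-j) x⟩ with hP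
  have hxP : ∀ j, x ∈ dset (P j) := fun j => rfl
  have hδ : ∀ j, (2 : ℝ) ^ (P j).k / 2 = (1 / 2) ^ j * (1 / 2) := fun j => by
    simp only [hP]
    rw [zpow_neg, zpow_natCast, one_div_pow]; ring
  have hlim : Filter.Tendsto (fun j : ℕ => (2 : ℝ) ^ (P j).k / 2) Filter.atTop
      (nhdsWithin 0 (Set.Ioi 0)) := by
    refine tendsto_nhdsWithin_iff.2 ⟨?_, Filter.Eventually.of_forall fun j => ?_⟩
    · simp only [hδ]
      have := (tendsto_pow_atTop_nhds_zero_of_lt_one (r := (1 / 2 : ℝ))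
        (by norm_num) (by norm_num)).mul_const (1 / 2)
      rwa [zero_mul] at this
    · rw [hδ]; exact Set.mem_Ioi.2 (by positivity)
  have hmem : ∀ᶠ j in Filter.atTop, x ∈ Metric.closedBall ((2 : ℝ) ^ (P j).k * ((P j).m + 1 / 2))
      (1 * ((2 : ℝ) ^ (P j).k / 2)) := Filter.Eventually.of_forall fun j => by
    obtain ⟨h1, h2⟩ := idx_eq_iff.1 (hxP j)
    rw [one_mul, Real.closedBall_eq_Icc]
    constructor <;> linarith
  have ht := hx _ _ hlim hmem
  have ht' := (ENNReal.continuous_ofReal.tendsto _).comp ht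
  rw [ofReal_norm] at ht'
  refine le_of_tendsto ht' (Filter.Eventually.of_forall fun j => ?_)
  have hint : IntegrableOn (fun y => ‖f y‖) (dset (P j)) := by
    rw [dset_eq]
    exact (hn.integrableOn_isCompact isCompact_Icc).mono_set Set.Ico_subset_Icc_self
  refine le_trans (le_of_eq ?_) (le_maxFn (Set.mem_univ (P j)) (hxP j))
  simp only [Function.comp]
  rw [setAverage_congr (closedBall_ae_eq_dset (P j)), setAverage_eq, smul_eq_mul,
    ENNReal.ofReal_mul (by positivity), ofReal_integral_eq_lintegral_ofReal hint
      (Filter.Eventually.of_forall fun y => norm_nonneg _), shift_zero, measureReal_def,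
    volume_dset, ← ENNReal.toReal_inv, twoPow_inv, ENNReal.ofReal_toReal (twoPow_ne_top _)]
  simp only [ofReal_norm]

/-- The parent of a dyadic interval. -/
def parent (P : DyadicInterval) : DyadicInterval := ⟨P.k + 1, P.m / 2⟩

lemma below_parent (P : DyadicInterval) : Below P (parent P) := by
  refine below_of_mem (by simp [parent]) (left_mem_dset P) ?_
  have := idx_add P.k 1 ((2 : ℝ) ^ P.k * P.m)
  rw [mem_dset.1 (left_mem_dset P)] at this
  simpa [mem_dset, parent] using this

lemma parent_ne (P : DyadicInterval) : parent P ≠ P := fun h => by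
  have := congrArg DyadicInterval.k h
  simp [parent] at this

/-- The dyadic intervals over which the mean of `h` exceeds `2 ^ k`. -/
def largeMean (h : ℝ → ℝ≥0∞) (k : ℤ) : Set DyadicInterval :=
  {P | twoPow k < twoPow (-P.k) * ∫⁻ y in dset P, h y}

lemma dUnion_largeMean (h : ℝ → ℝ≥0∞) (k : ℤ) :
    dUnion (largeMean h k) = {x | twoPow k < maxFn Set.univ 0 h x} := by
  ext x
  rw [Set.mem_ofPred_eq, lt_maxFn_iff]
  simp only [largeMean, Set.mem_univ, true_and, shift_zero]

/-- By Hölder, the mean over `J` is at most the `L^p` norm times `|J| ^ (-1 / p)`, so long intervals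
cannot have large mean. This supplies the maximal intervals of the Calderón-Zygmund decomposition.
-/
lemma exists_k_le_of_largeMean {p : ℝ} (hp : 1 < p) {h : ℝ → ℝ≥0∞} (hh : Measurable h)
    (hfin : ∫⁻ x, h x ^ p ≠ ⊤) (k : ℤ) : ∃ K : ℤ, ∀ J ∈ largeMean h k, J.k ≤ K := by
  have hp0 : 0 < p := by linarith
  obtain ⟨S, hS⟩ := exists_int_le_twoPow hfin
  refine ⟨⌈S - k * p⌉, fun J hJ => ?_⟩
  have h1 : ∫⁻ y in dset J, h y ≤ twoPow S ^ (1 / p) * twoPow J.k ^ (1 - 1 / p) := by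
    have := lintegral_mul_le_rpow (u := h) (v := (dset J).indicator 1) hh.aemeasurable
      (measurable_one.indicator (measurableSet_dset J)).aemeasurable (a := p) (b := p / (p - 1))
      (θ := 1 / p) (by positivity) (by rw [div_le_one hp0]; exact hp.le) (by field_simp)
      (by
        have : p - 1 ≠ 0 := by linarith
        field_simp)
    have h2 : ∀ x, ((dset J).indicator 1 x : ℝ≥0∞) ^ (p / (p - 1)) = (dset J).indicator 1 x := by
      intro x
      by_cases hx : x ∈ dset J
      · simp [hx]
      · simp only [Set.indicator_of_notMem hx]
        exact ENNReal.zero_rpow_of_pos (div_pos hp0 (by linarith))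
    simp only [h2] at this
    rw [lintegral_indicator_one (measurableSet_dset J), volume_dset] at this
    calc ∫⁻ y in dset J, h y = ∫⁻ x, h x * (dset J).indicator 1 x := by
          rw [← lintegral_indicator (measurableSet_dset J)]
          refine lintegral_congr fun x => ?_
          by_cases hx : x ∈ dset J <;> simp [hx]
      _ ≤ _ := this
      _ ≤ _ := by gcongr
  have h2 : twoPow k < twoPow (-J.k) * (twoPow S ^ (1 / p) * twoPow J.k ^ (1 - 1 / p)) :=
    lt_of_lt_of_le hJ (by gcongr)
  rw [twoPow_rpow, twoPow_rpow, ← twoPow_add, ← twoPow_add, twoPow_lt] at h2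
  have h3 : (k : ℝ) * p < S - J.k := by
    have h4 : -(J.k : ℝ) + (S * (1 / p) + J.k * (1 - 1 / p)) = (S - J.k) / p := by
      field_simp; ring
    rw [h4, lt_div_iff₀ hp0] at h2
    exact h2
  have h5 := Int.le_ceil ((S : ℝ) - k * p)
  exact_mod_cast (by linarith : (J.k : ℝ) ≤ (⌈(S : ℝ) - k * p⌉ : ℝ))

/-- The stopping time argument: the parent of a maximal interval was not selected, and passing to
the parent doubles the length. -/
lemma lintegral_maximals_largeMean_le {h : ℝ → ℝ≥0∞} {k : ℤ} {P : DyadicInterval}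
    (hP : P ∈ maximals (largeMean h k)) :
    twoPow (-P.k) * ∫⁻ y in dset P, h y ≤ 2 * twoPow k := by
  have h1 : parent P ∉ largeMean h k := fun h' =>
    parent_ne P (hP.2 _ h' (below_parent P))
  have h2 : twoPow (-(parent P).k) * ∫⁻ y in dset (parent P), h y ≤ twoPow k := not_lt.1 h1
  calc twoPow (-P.k) * ∫⁻ y in dset P, h y
      ≤ twoPow (-P.k) * ∫⁻ y in dset (parent P), h y := by
        gcongr
        exact (below_parent P).2
    _ = 2 * (twoPow (-(parent P).k) * ∫⁻ y in dset (parent P), h y) := by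
        rw [← mul_assoc, ← twoPow_one, ← twoPow_add]
        congr 2
        simp only [parent]; push_cast; ring
    _ ≤ _ := by gcongr

/-- The Calderón–Zygmund decomposition of `f` at height `2 ^ k`. -/
lemma exists_good_function {p : ℝ} (hp : 1 < p) {f : ℝ → ℂ} (hf : Measurable f)
    (hfin : ∫⁻ x, ‖f x‖ₑ ^ p ≠ ⊤) (k : ℤ) :
    ∃ g : ℝ → ℂ, Measurable g ∧
      (∀ x ∉ dUnion (largeMean (fun y => ‖f y‖ₑ) k), g x = f x) ∧
      (∀ x ∈ dUnion (largeMean (fun y => ‖f y‖ₑ) k), ‖g x‖ₑ ≤ 2 * twoPow k) ∧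
      ∀ P ∈ maximals (largeMean (fun y => ‖f y‖ₑ) k),
        IntegrableOn (fun x => f x - g x) (dset P) ∧ ∫ x in dset P, (f x - g x) = 0 ∧
        ∫⁻ x in dset P, ‖f x - g x‖ₑ ≤ 2 * ∫⁻ x in dset P, ‖f x‖ₑ := by
  set L := largeMean (fun y => ‖f y‖ₑ) k with hL
  obtain ⟨K, hK⟩ := exists_k_le_of_largeMean hp hf.enorm hfin k
  have hU : dUnion (maximals L) = dUnion L := dUnion_maximals hK
  set avg : DyadicInterval → ℂ := fun P => ((2 : ℝ) ^ (-P.k) : ℝ) * ∫ x in dset P, f x with havg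
  -- The index `none` stands for the complement, where `g = f`; the others stand for the selected
  -- intervals, where `g` is the mean of `f`.
  let t : Option (maximals L) → Set ℝ := fun o => o.elim (dUnion L)ᶜ fun P => dset P
  let v : Option (maximals L) → ℝ → ℂ := fun o => o.elim f fun P _ => avg P
  obtain ⟨g, hgm, hg⟩ := exists_measurable_piecewise t
    (by
      rintro (_ | P)
      · exact (measurableSet_dUnion L).compl
      · exact measurableSet_dset _) v
    (by
      rintro (_ | P)
      · exact hf
      · exact measurable_const)
    (by
      rintro (_ | P) (_ | Q) hne
      · exact absurd rfl hne
      · rintro x ⟨h1, h2⟩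
        exact absurd (dset_subset_dUnion Q.2.1 h2) h1
      · rintro x ⟨h1, h2⟩
        exact absurd (dset_subset_dUnion P.2.1 h1) h2
      · rintro x ⟨h1, h2⟩
        by_contra hPQ
        have hPQ' : (P : DyadicInterval) ≠ Q := fun h => hPQ (by simp only [v]; simp [h])
        exact Set.disjoint_left.1 (pairwiseDisjoint_maximals L P.2 Q.2 hPQ') h1 h2)
  have hgP : ∀ P ∈ maximals L, ∀ x ∈ dset P, g x = avg P := fun P hP x hx =>
    hg (some ⟨P, hP⟩) hx
  have hfP : ∀ P ∈ maximals L, IntegrableOn f (dset P) := fun P hP => by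
    refine ⟨hf.aestronglyMeasurable, ?_⟩
    have h1 := lintegral_maximals_largeMean_le hP
    refine lt_top_iff_ne_top.2 fun h => ?_
    rw [h, ENNReal.mul_top (twoPow_ne_zero _)] at h1
    exact ENNReal.mul_ne_top (by norm_num) (twoPow_ne_top _) (top_le_iff.1 h1)
  have havg_le : ∀ P, ‖avg P‖ₑ ≤ twoPow (-P.k) * ∫⁻ x in dset P, ‖f x‖ₑ := fun P => by
    simp only [havg, enorm_mul]
    gcongr
    · rw [← ofReal_norm, Complex.norm_real, Real.norm_of_nonneg (by positivity), twoPow_eq_ofReal,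
        ← Real.rpow_intCast]
      push_cast; rfl
    · exact enorm_integral_le_lintegral_enorm _
  refine ⟨g, hgm, fun x hx => hg none hx, fun x hx => ?_, fun P hP => ?_⟩
  · rw [← hU] at hx
    obtain ⟨P, hP, hxP⟩ := mem_dUnion.1 hx
    rw [hgP P hP x hxP]
    exact (havg_le P).trans (lintegral_maximals_largeMean_le hP)
  · have hfin' : volume (dset P) ≠ ⊤ := by rw [volume_dset]; exact twoPow_ne_top _
    have hconst : IntegrableOn (fun _ : ℝ => avg P) (dset P) := integrableOn_const hfin'
    have hsub : Set.EqOn (fun x => f x - g x) (fun x => f x - avg P) (dset P) := fun x hx => by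
      simp only [hgP P hP x hx]
    refine ⟨((hfP P hP).sub hconst).congr_fun hsub.symm (measurableSet_dset P), ?_, ?_⟩
    · rw [setIntegral_congr_fun (measurableSet_dset P) hsub, integral_sub (hfP P hP) hconst,
        setIntegral_const, measureReal_def, volume_dset, twoPow_intCast,
        ENNReal.toReal_ofReal (by positivity)]
      simp only [havg, Complex.real_smul, ← mul_assoc, ← Complex.ofReal_mul]
      rw [← zpow_add₀ (by norm_num), add_neg_cancel, zpow_zero]
      simp
    · calc ∫⁻ x in dset P, ‖f x - g x‖ₑ
          ≤ ∫⁻ x in dset P, (‖f x‖ₑ + ‖avg P‖ₑ) := by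
            refine setLIntegral_mono' (measurableSet_dset P) fun x hx => ?_
            rw [hgP P hP x hx]
            exact enorm_sub_le
        _ = (∫⁻ x in dset P, ‖f x‖ₑ) + ‖avg P‖ₑ * twoPow P.k := by
            rw [lintegral_add_left hf.enorm, setLIntegral_const, volume_dset]
        _ ≤ (∫⁻ x in dset P, ‖f x‖ₑ) + (twoPow (-P.k) * ∫⁻ x in dset P, ‖f x‖ₑ) * twoPow P.k := by
            gcongr; exact havg_le P
        _ = _ := by
            rw [mul_right_comm, ← twoPow_add, neg_add_cancel, twoPow_zero, one_mul, two_mul]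

/-! ### Cancellation against molecules -/

/-- The interval `Q` is the ancestor of `J` at the scale of `P`; either it is `P` or a neighbour of
`P`, or the two are separated by a full interval. -/
lemma subset_triple_or_disjoint {J P : DyadicInterval} (h : J.k ≤ P.k) :
    dset J ⊆ triple P ∨ ∃ Q : DyadicInterval, Q.k = P.k ∧ Below J Q ∧ dset P ⊆ (triple Q)ᶜ := by
  set Q : DyadicInterval := ⟨P.k, idx P.k ((2 : ℝ) ^ J.k * J.m)⟩ with hQ
  have hJQ : Below J Q := below_of_mem h (left_mem_dset J) rfl
  by_cases hc : |Q.m - P.m| ≤ 1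
  · left
    intro x hx
    have := hJQ.2 hx
    rw [mem_dset] at this
    simp only [triple, Set.mem_ofPred_eq]
    rw [← this] at hc
    exact hc
  · right
    refine ⟨Q, rfl, hJQ, fun x hx hxQ => hc ?_⟩
    rw [mem_dset] at hx
    simp only [triple, Set.mem_ofPred_eq] at hxQ
    rw [← abs_neg, neg_sub, ← hx]
    exact hxQ

/-- For molecules shorter than `P` decay alone suffices. Since `J` is separated from `P`, one of
three powers of the weight yields the ratio `|J| / |P|`; two remain for summing over positions. -/
lemma kernel_le_small {B : ℕ → ℝ≥0} {J P : DyadicInterval} {Φ : ℝ → ℂ} (hΦ : IsMolecule B J Φ)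
    (h : J.k ≤ P.k) (hJP : ¬ dset J ⊆ triple P) (b : ℝ → ℂ) :
    twoPow (J.k / 2) * ‖∫ x in dset P, b x * conj (Φ x)‖ₑ ≤
      3 * B 3 * twoPow (J.k - P.k) * ∫⁻ x in dset P, ‖b x‖ₑ * wtAt J x ^ 2 := by
  obtain ⟨Q, hQk, hJQ, hPQ⟩ := (subset_triple_or_disjoint h).resolve_left hJP
  have h1 : ‖∫ x in dset P, b x * conj (Φ x)‖ₑ ≤
      ∫⁻ x in dset P, (B 3 * twoPow (-(J.k / 2)) * (3 * twoPow (J.k - P.k))) *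
        (‖b x‖ₑ * wtAt J x ^ 2) := by
    refine (enorm_integral_le_lintegral_enorm _).trans
      (setLIntegral_mono' (measurableSet_dset P) fun x hx => ?_)
    have h2 : wtAt J x ≤ 3 * twoPow (J.k - P.k) := by
      have := wtAt_le_of_below hJQ (hPQ hx)
      rw [hQk] at this
      exact this.trans (mul_le_of_le_one_right' (wtAt_le_one _ _))
    rw [enorm_mul, enorm_conj]
    calc ‖b x‖ₑ * ‖Φ x‖ₑ ≤ ‖b x‖ₑ * (B 3 * twoPow (-(J.k / 2)) * wtAt J x ^ 3) := by
          gcongr; exact hΦ.decay 3 x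
      _ = B 3 * twoPow (-(J.k / 2)) * wtAt J x * (‖b x‖ₑ * wtAt J x ^ 2) := by ring
      _ ≤ _ := by gcongr
  rw [lintegral_const_mul' _ _ (ENNReal.mul_ne_top (ENNReal.mul_ne_top ENNReal.coe_ne_top
    (twoPow_ne_top _)) (ENNReal.mul_ne_top (by norm_num) (twoPow_ne_top _)))] at h1
  refine (mul_le_mul_right h1 _).trans_eq ?_
  calc _ = 3 * B 3 * twoPow (J.k - P.k) * (∫⁻ x in dset P, ‖b x‖ₑ * wtAt J x ^ 2) *
        (twoPow (J.k / 2) * twoPow (-(J.k / 2))) := by ring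
    _ = _ := by rw [twoPow_mul_neg, mul_one]

/-- For molecules at least as long as `P` the mean zero condition is used: `Φ` is replaced by its
difference from a value on `P`, and the Lipschitz bound gains `|P| / |J|`. It applies because `P`
lies in one cell of the scale of `J`. -/
lemma kernel_le_large {B : ℕ → ℝ≥0} {J P : DyadicInterval} {Φ : ℝ → ℂ} (hΦ : IsMolecule B J Φ)
    (h : P.k ≤ J.k) {b : ℝ → ℂ} (hb : IntegrableOn b (dset P)) (hb0 : ∫ x in dset P, b x = 0) :
    twoPow (J.k / 2) * ‖∫ x in dset P, b x * conj (Φ x)‖ₑ ≤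
      B 2 * twoPow (P.k - J.k) * ∫⁻ x in dset P, ‖b x‖ₑ * wtAt J x ^ 2 := by
  set c := (2 : ℝ) ^ P.k * P.m with hc
  have hcP : c ∈ dset P := left_mem_dset P
  have hlip : ∀ x ∈ dset P, ‖Φ x - Φ c‖ₑ ≤
      B 2 * twoPow (-(J.k / 2)) * twoPow (P.k - J.k) * wtAt J x ^ 2 := by
    intro x hx
    refine (hΦ.lipschitz x c (idx_congr h (hx.trans hcP.symm))).trans ?_
    have h0 : twoPow (P.k - J.k) = twoPow (-J.k) * twoPow P.k := by
      rw [← twoPow_add]; congr 1; ring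
    rw [h0]
    have h1 : ENNReal.ofReal |x - c| ≤ twoPow P.k := by
      rw [twoPow_intCast]
      refine ENNReal.ofReal_le_ofReal ?_
      obtain ⟨h2, h3⟩ := idx_eq_iff.1 hx
      rw [abs_of_nonneg (by linarith)]
      linarith
    gcongr
  have hsub : ∫ x in dset P, b x * conj (Φ x) = ∫ x in dset P, b x * conj (Φ x - Φ c) := by
    have h1 : IntegrableOn (fun x => b x * conj (Φ x)) (dset P) := by
      refine Integrable.mul_bdd (c := ((B 2 * twoPow (-(J.k / 2)) : ℝ≥0∞)).toReal) hb
        (Complex.continuous_conj.comp hΦ.continuous).aestronglyMeasurable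
        (Filter.Eventually.of_forall fun x => ?_)
      rw [← toReal_enorm, enorm_conj]
      refine ENNReal.toReal_mono (ENNReal.mul_ne_top ENNReal.coe_ne_top (twoPow_ne_top _)) ?_
      exact (hΦ.decay 2 x).trans (mul_le_of_le_one_right' (pow_le_one' (wtAt_le_one _ _) _))
    have h2 : IntegrableOn (fun x => b x * conj (Φ c)) (dset P) := hb.mul_const _
    simp only [map_sub, mul_sub]
    rw [integral_sub h1 h2, integral_mul_const, hb0]
    simp
  have h1 : ‖∫ x in dset P, b x * conj (Φ x)‖ₑ ≤
      ∫⁻ x in dset P, (B 2 * twoPow (-(J.k / 2)) * twoPow (P.k - J.k)) *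
        (‖b x‖ₑ * wtAt J x ^ 2) := by
    rw [hsub]
    refine (enorm_integral_le_lintegral_enorm _).trans
      (setLIntegral_mono' (measurableSet_dset P) fun x hx => ?_)
    rw [enorm_mul, enorm_conj]
    calc ‖b x‖ₑ * ‖Φ x - Φ c‖ₑ ≤
          ‖b x‖ₑ * (B 2 * twoPow (-(J.k / 2)) * twoPow (P.k - J.k) * wtAt J x ^ 2) := by
          gcongr; exact hlip x hx
      _ = _ := by ring
  rw [lintegral_const_mul' _ _ (ENNReal.mul_ne_top (ENNReal.mul_ne_top ENNReal.coe_ne_top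
    (twoPow_ne_top _)) (twoPow_ne_top _))] at h1
  refine (mul_le_mul_right h1 _).trans_eq ?_
  calc _ = B 2 * twoPow (P.k - J.k) * (∫⁻ x in dset P, ‖b x‖ₑ * wtAt J x ^ 2) *
        (twoPow (J.k / 2) * twoPow (-(J.k / 2))) := by ring
    _ = _ := by rw [twoPow_mul_neg, mul_one]

/-- The part of the square function of a function with mean zero over `P` that lives away from
`P`. -/
lemma sum_kernel_le {B : ℕ → ℝ≥0} {D : Finset DyadicInterval} {Φ : DyadicInterval → ℝ → ℂ}
    (hΦ : ∀ J ∈ D, IsMolecule B J (Φ J)) {P : DyadicInterval}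
    (hD : ∀ J ∈ D, ¬ dset J ⊆ triple P) {b : ℝ → ℂ} (hb : IntegrableOn b (dset P))
    (hb0 : ∫ x in dset P, b x = 0) :
    ∑ J ∈ D, twoPow (J.k / 2) * ‖∫ x in dset P, b x * conj (Φ J x)‖ₑ ≤
      (3 * B 3 + B 2) * wtSum * (2 * geomConst 1) * ∫⁻ x in dset P, ‖b x‖ₑ := by
  set I := ∫⁻ x in dset P, ‖b x‖ₑ with hI
  -- This majorizes `2 ^ (-|k - P.k|)`: one half for molecules shorter than `P`, the other, in terms
  -- of `-k`, for longer ones. Both are series of the type in `tsum_int_le`.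
  set r : ℤ → ℝ≥0∞ := fun k => (if k ≤ P.k then twoPow (k * 1) else 0) * twoPow (-P.k) +
    (if -k ≤ -P.k then twoPow ((-k : ℤ) * 1) else 0) * twoPow P.k with hr
  have hscale : ∀ k : ℤ, ∑ J ∈ D.filter (fun J => J.k = k),
      twoPow (J.k / 2) * ‖∫ x in dset P, b x * conj (Φ J x)‖ₑ ≤
      (3 * B 3 + B 2) * r k * (wtSum * I) := by
    intro k
    calc _ ≤ ∑ J ∈ D.filter (fun J => J.k = k),
          (3 * B 3 + B 2) * r k * ∫⁻ x in dset P, ‖b x‖ₑ * wtAt J x ^ 2 := by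
          refine Finset.sum_le_sum fun J hJ => ?_
          obtain ⟨hJD, rfl⟩ := Finset.mem_filter.1 hJ
          rcases le_total J.k P.k with hk | hk
          · refine (kernel_le_small (hΦ J hJD) hk (hD J hJD) b).trans ?_
            gcongr
            · exact le_self_add
            · simp only [hr]
              rw [if_pos hk, mul_one, ← twoPow_add, ← sub_eq_add_neg]
              exact le_self_add
          · refine (kernel_le_large (hΦ J hJD) hk hb hb0).trans ?_
            gcongr
            · exact le_add_self
            · simp only [hr]
              have h0 : twoPow (P.k - J.k) = twoPow (((-J.k : ℤ) : ℝ) * 1) * twoPow P.k := by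
                rw [← twoPow_add]; congr 1; push_cast; ring
              rw [if_pos (neg_le_neg hk), h0]
              exact le_add_self
      _ = (3 * B 3 + B 2) * r k * ∫⁻ x in dset P, ‖b x‖ₑ *
            ∑ J ∈ D.filter (fun J => J.k = k), wtAt J x ^ 2 := by
          rw [← Finset.mul_sum]
          congr 1
          simp only [Finset.mul_sum]
          rw [lintegral_finsetSum' _ fun J _ => by
            exact hb.1.enorm.mul ((measurable_wtAt J).pow_const 2).aemeasurable]
      _ ≤ (3 * B 3 + B 2) * r k * (wtSum * I) := by
          refine mul_le_mul_right ?_ _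
          rw [hI, mul_comm, ← lintegral_mul_const' _ _ wtSum_ne_top]
          refine lintegral_mono fun x => ?_
          gcongr
          exact sum_filter_wtAt_le D k x
  rw [sum_eq_tsum_scale]
  refine (ENNReal.tsum_le_tsum hscale).trans ?_
  rw [ENNReal.tsum_mul_right, ENNReal.tsum_mul_left]
  have hr' : ∑' k, r k = 2 * geomConst 1 := by
    simp only [hr]
    have hneg : ∑' k : ℤ, (if -k ≤ -P.k then twoPow (((-k : ℤ) : ℝ) * 1) else 0) =
        ∑' k : ℤ, (if k ≤ -P.k then twoPow (k * 1) else 0) :=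
      (Equiv.neg ℤ).tsum_eq (fun k : ℤ => if k ≤ -P.k then twoPow (k * 1) else 0)
    rw [ENNReal.tsum_add, ENNReal.tsum_mul_right, ENNReal.tsum_mul_right, tsum_int_le, hneg,
      tsum_int_le]
    push_cast
    rw [mul_one, mul_one]
    calc _ = geomConst 1 * (twoPow P.k * twoPow (-P.k)) +
          geomConst 1 * (twoPow P.k * twoPow (-P.k)) := by ring
      _ = _ := by rw [twoPow_mul_neg]; ring
  rw [hr']
  exact le_of_eq (by ring)

/-! ### The square function for exponents below two -/

lemma memLp_of_lintegral_rpow_ne_top {s : ℝ} (hs : 0 < s) {f : ℝ → ℂ}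
    (hf : AEStronglyMeasurable f) (h : ∫⁻ x, ‖f x‖ₑ ^ s ≠ ⊤) : MemLp f (ENNReal.ofReal s) := by
  refine ⟨hf, ?_⟩
  rw [eLpNorm_lt_top_iff_lintegral_rpow_enorm_lt_top (by simpa using hs) ENNReal.ofReal_ne_top,
    ENNReal.toReal_ofReal hs.le]
  exact h.lt_top

lemma IsMolecule.integrable_mul {B : ℕ → ℝ≥0} {J : DyadicInterval} {Φ : ℝ → ℂ}
    (h : IsMolecule B J Φ) {p : ℝ} (hp : 1 < p) {f : ℝ → ℂ} (hf : Measurable f)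
    (hfin : ∫⁻ x, ‖f x‖ₑ ^ p ≠ ⊤) : Integrable fun x => f x * conj (Φ x) := by
  have hp0 : 0 < p := by linarith
  have hp1 : 0 < p - 1 := by linarith
  refine ⟨(hf.mul (Complex.continuous_conj.measurable.comp h.measurable)).aestronglyMeasurable, ?_⟩
  have h1 := lintegral_mul_le_rpow (u := fun x => ‖f x‖ₑ) (v := fun x => ‖Φ x‖ₑ)
    hf.enorm.aemeasurable h.measurable.enorm.aemeasurable (a := p) (b := p / (p - 1))
    (θ := 1 / p) (by positivity) (by rw [div_le_one hp0]; exact hp.le) (by field_simp)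
    (by field_simp)
  have h2 : (0 : ℝ) ≤ 1 - 1 / p := by rw [sub_nonneg, div_le_one hp0]; exact hp.le
  rw [hasFiniteIntegral_iff_enorm]
  simp only [enorm_mul, enorm_conj]
  exact h1.trans_lt (ENNReal.mul_lt_top (ENNReal.rpow_lt_top_of_nonneg (by positivity) hfin)
    (ENNReal.rpow_lt_top_of_nonneg h2 (h.lintegral_rpow_lt_top (by positivity)).ne))

lemma enorm_integral_le_tsum_maximals {L : Set DyadicInterval} {u : ℝ → ℂ} (hu : Integrable u)
    (h0 : ∀ x ∉ dUnion (maximals L), u x = 0) :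
    ‖∫ x, u x‖ₑ ≤ ∑' P : maximals L, ‖∫ x in dset P, u x‖ₑ := by
  have h1 : dUnion (maximals L) = ⋃ P : maximals L, dset P := by
    rw [dUnion, Set.biUnion_eq_iUnion]
  have h2 := hasSum_integral_iUnion (μ := volume) (f := u) (s := fun P : maximals L => dset P)
    (fun P => measurableSet_dset _)
    (fun P Q hPQ => pairwiseDisjoint_maximals L P.2 Q.2 (fun h => hPQ (Subtype.ext h)))
    hu.integrableOn
  rw [← h1, setIntegral_eq_integral_of_forall_compl_eq_zero h0] at h2
  rw [← h2.tsum_eq]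
  exact enorm_tsum_le_tsum_enorm

lemma volume_iUnion_triple_le (L : Set DyadicInterval) :
    volume (⋃ P ∈ maximals L, triple P) ≤ 3 * volume (dUnion (maximals L)) := by
  rw [volume_dUnion_maximals, ← ENNReal.tsum_mul_left, Set.biUnion_eq_iUnion]
  exact (measure_iUnion_le _).trans (ENNReal.tsum_le_tsum fun P => volume_triple_le _)

/-- The `ℓ²` norm is at most the `ℓ¹` norm. The square function of the bad part is thereby bounded
by a linear expression, which can be integrated in `L¹`. -/
lemma dsum_sq_le (D : Finset DyadicInterval) (c : DyadicInterval → ℝ≥0∞) (x : ℝ) :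
    dsum D (fun J => c J ^ 2) x ≤ dsum D c x ^ 2 := by
  rw [sq (dsum D c x)]
  nth_rewrite 2 [dsum]
  rw [Finset.sum_mul]
  refine Finset.sum_le_sum fun J hJ => ?_
  by_cases hx : x ∈ dset J
  · simp only [Set.indicator_of_mem hx]
    rw [sq]
    exact mul_le_mul_right (le_dsum hJ hx) _
  · simp [Set.indicator_of_notMem hx]

lemma dsum_add (D : Finset DyadicInterval) (c d : DyadicInterval → ℝ≥0∞) (x : ℝ) :
    dsum D (fun J => c J + d J) x = dsum D c x + dsum D d x := by
  simp only [dsum, ← Finset.sum_add_distrib]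
  refine Finset.sum_congr rfl fun J _ => ?_
  by_cases hx : x ∈ dset J <;> simp [hx]

lemma dsum_le_dsum {D : Finset DyadicInterval} {c d : DyadicInterval → ℝ≥0∞}
    (h : ∀ J ∈ D, c J ≤ d J) (x : ℝ) : dsum D c x ≤ dsum D d x :=
  Finset.sum_le_sum fun J hJ => Set.indicator_le_indicator (h J hJ)

lemma dsum_const_mul (D : Finset DyadicInterval) (a : ℝ≥0∞) (c : DyadicInterval → ℝ≥0∞) (x : ℝ) :
    dsum D (fun J => a * c J) x = a * dsum D c x := by
  simp only [dsum, Finset.mul_sum]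
  refine Finset.sum_congr rfl fun J _ => ?_
  by_cases hx : x ∈ dset J <;> simp [hx]

/-- The weak type estimate for the square function at a single height. -/
lemma volume_lt_dsum_coeffSq_le {B : ℕ → ℝ≥0} {B₂ : ℝ≥0∞} {D : Finset DyadicInterval}
    {Φ : DyadicInterval → ℝ → ℂ} (h : IsMoleculeFamily B B₂ D Φ) {p : ℝ} (hp : 1 < p) (hp2 : p < 2)
    {f : ℝ → ℂ} (hf : Measurable f) (hfin : ∫⁻ x, ‖f x‖ₑ ^ p ≠ ⊤) (k : ℤ) {m : ℝ → ℝ≥0∞}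
    (hm : m = maxFn Set.univ 0 (fun y => ‖f y‖ₑ)) :
    volume {x | twoPow (2 * (k + 1)) < dsum D (coeffSq f Φ) x} ≤
      (3 + 4 * B₂) * volume {x | twoPow k < m x} +
      B₂ * (twoPow (-(2 * k)) * ∫⁻ x, {x | m x ≤ twoPow k}.indicator (fun x => m x ^ 2) x) +
      (3 * B 3 + B 2) * wtSum * (2 * geomConst 1) * 2 *
        (twoPow (-k) * ∫⁻ x, {x | twoPow k < m x}.indicator m x) := by
  classical
  have hp0 : 0 < p := by linarith
  have hmm : Measurable m := by rw [hm]; exact measurable_maxFn _ _ _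
  obtain ⟨g, hgm, hgf, hgL, hgP⟩ := exists_good_function hp hf hfin k
  set L := largeMean (fun y => ‖f y‖ₑ) k with hL
  obtain ⟨K, hK⟩ := exists_k_le_of_largeMean hp hf.enorm hfin k
  have hU : dUnion (maximals L) = dUnion L := dUnion_maximals hK
  have hΩ : dUnion L = {x | twoPow k < m x} := by rw [hm]; exact dUnion_largeMean _ k
  set Ω := {x | twoPow k < m x} with hΩdef
  have hΩm : MeasurableSet Ω := measurableSet_lt measurable_const hmm
  have hΩc : {x | m x ≤ twoPow k} = Ωᶜ := by ext x; simp [hΩdef]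
  have hfm : ∀ᵐ x, ‖f x‖ₑ ≤ m x := by
    rw [hm]
    refine ae_enorm_le_maxFn ((memLp_of_lintegral_rpow_ne_top hp0 hf.aestronglyMeasurable
      hfin).locallyIntegrable ?_)
    rw [← ENNReal.ofReal_one]
    exact ENNReal.ofReal_le_ofReal hp.le
  have hmfin : ∫⁻ x, m x ^ p ≠ ⊤ := by
    rw [hm]
    refine ne_top_of_le_ne_top ?_ (lintegral_maxFn_rpow_le hp Set.univ 0 hf.enorm)
    exact ENNReal.mul_ne_top (ENNReal.mul_ne_top (ENNReal.mul_ne_top (ENNReal.mul_ne_top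
      (twoPow_ne_top _) (by norm_num)) (geomConst_ne_top (by linarith))) (lg_ne_top _)) hfin
  have hΩfin : volume Ω ≠ ⊤ := by
    have h1 : twoPow (k * p) * volume Ω ≤ geomConst p * ∫⁻ x, m x ^ p :=
      (ENNReal.le_tsum k).trans (tsum_le_lintegral_rpow (μ := volume) hmm hp0)
    intro hv
    rw [hv, ENNReal.mul_top (twoPow_ne_zero _)] at h1
    exact ENNReal.mul_ne_top (geomConst_ne_top hp0) hmfin (top_le_iff.1 h1)
  set Z := ∫⁻ x, {x | m x ≤ twoPow k}.indicator (fun x => m x ^ 2) x with hZ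
  have hZfin : Z ≠ ⊤ := by
    -- On `{m ≤ 2 ^ k}` one has `m ^ 2 = m ^ (2 - p) * m ^ p` with `2 - p > 0`, so the first factor
    -- is bounded.
    refine ne_top_of_le_ne_top (ENNReal.mul_ne_top
      (ENNReal.rpow_ne_top_of_nonneg (by linarith : 0 ≤ 2 - p) (twoPow_ne_top k)) hmfin) ?_
    rw [← lintegral_const_mul _ (hmm.pow_const p)]
    refine lintegral_mono fun x => ?_
    by_cases hx : m x ≤ twoPow k
    · rw [Set.indicator_of_mem (by exact hx), ← ENNReal.rpow_natCast,
        (by push_cast; ring : ((2 : ℕ) : ℝ) = (2 - p) + p),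
        ENNReal.rpow_add_of_nonneg _ _ (by linarith) hp0.le]
      gcongr
    · rw [Set.indicator_of_notMem (by exact hx)]
      exact zero_le
  -- Off `Ω` the good function equals `f`, which is at most `m` almost everywhere; on `Ω` it is at
  -- most `2 * 2 ^ k`.
  have hg2 : ∫⁻ x, ‖g x‖ₑ ^ 2 ≤ Z + 4 * twoPow (2 * k) * volume Ω := by
    rw [← lintegral_indicator_const hΩm, hZ, ← lintegral_add_left
      ((hmm.pow_const 2).indicator (measurableSet_le hmm measurable_const))]
    refine lintegral_mono_ae ?_
    filter_upwards [hfm] with x hx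
    by_cases hxΩ : x ∈ Ω
    · rw [Set.indicator_of_mem hxΩ]
      refine le_add_left ?_
      calc ‖g x‖ₑ ^ 2 ≤ (2 * twoPow k) ^ 2 := by
            gcongr; exact hgL x (by rw [hΩ]; exact hxΩ)
        _ = _ := by
            rw [mul_pow, twoPow_pow, mul_comm (k : ℝ)]; norm_num
    · rw [hΩc, Set.indicator_of_mem (by exact hxΩ), hgf x (by rw [hΩ]; exact hxΩ)]
      refine le_add_right ?_
      gcongr
  have hgLp : MemLp g 2 := by
    have := memLp_of_lintegral_rpow_ne_top two_pos hgm.aestronglyMeasurable (f := g) (by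
      simp only [ENNReal.rpow_two]
      exact ne_top_of_le_ne_top (ENNReal.add_ne_top.2 ⟨hZfin, ENNReal.mul_ne_top
        (ENNReal.mul_ne_top (by norm_num) (twoPow_ne_top _)) hΩfin⟩) hg2)
    simpa using this
  have hgfin : ∫⁻ x, ‖g x‖ₑ ^ (2 : ℝ) ≠ ⊤ := by
    simp only [ENNReal.rpow_two]
    exact ne_top_of_le_ne_top (ENNReal.add_ne_top.2 ⟨hZfin, ENNReal.mul_ne_top
        (ENNReal.mul_ne_top (by norm_num) (twoPow_ne_top _)) hΩfin⟩) hg2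
  -- Intervals inside the triple of a selected interval affect the square function only on the union
  -- of the triples, which is discarded as an exceptional set.
  set D' := D.filter fun J => ∀ P ∈ maximals L, ¬ dset J ⊆ triple P with hD'
  set β : DyadicInterval → ℝ≥0∞ := fun J =>
    ∑' P : maximals L, ‖∫ x in dset P, (f x - g x) * conj (Φ J x)‖ₑ with hβ
  set U : ℝ → ℝ≥0∞ := dsum D' fun J => twoPow (-(J.k / 2)) * β J with hUdef
  have hUm : Measurable U := measurable_dsum _ _
  have hpair : ∀ J ∈ D, ‖pairing f (Φ J)‖ₑ ≤ ‖pairing g (Φ J)‖ₑ + β J := fun J hJ => by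
    have hJ' := h.isMolecule J hJ
    have i1 := hJ'.integrable_mul hp hf hfin
    have i2 := hJ'.integrable_mul one_lt_two hgm hgfin
    have e1 : pairing f (Φ J) = pairing g (Φ J) + ∫ x, (f x - g x) * conj (Φ J x) := by
      simp only [sub_mul]
      rw [integral_sub i1 i2, pairing, pairing]; ring
    rw [e1]
    refine (enorm_add_le _ _).trans ?_
    gcongr
    refine enorm_integral_le_tsum_maximals ?_ fun x hx => ?_
    · simp only [sub_mul]; exact i1.sub i2
    · rw [hgf x (by rwa [← hU]), sub_self, zero_mul]
  have hcoeff : ∀ J ∈ D', coeffSq f Φ J ≤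
      2 * (coeffSq g Φ J + (twoPow (-(J.k / 2)) * β J) ^ 2) := fun J hJ => by
    calc coeffSq f Φ J ≤ (‖pairing g (Φ J)‖ₑ + β J) ^ 2 * twoPow (-J.k) := by
          rw [coeffSq]
          gcongr
          exact hpair J (Finset.mem_filter.1 hJ).1
      _ ≤ 2 * (‖pairing g (Φ J)‖ₑ ^ 2 + β J ^ 2) * twoPow (-J.k) := by
          gcongr; exact add_sq_le_two_mul _ _
      _ = _ := by
          rw [coeffSq, mul_pow, twoPow_pow, (by push_cast; ring :
            -((J.k : ℝ) / 2) * ((2 : ℕ) : ℝ) = -J.k)]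
          ring
  have hS : ∀ x ∉ ⋃ P ∈ maximals L, triple P,
      dsum D (coeffSq f Φ) x ≤ 2 * (dsum D (coeffSq g Φ) x + U x ^ 2) := by
    intro x hx
    have e1 : dsum D (coeffSq f Φ) x = dsum D' (coeffSq f Φ) x := by
      refine (Finset.sum_subset (Finset.filter_subset _ _) fun J hJ hJ' => ?_).symm
      refine Set.indicator_of_notMem (fun hxJ => hJ' (Finset.mem_filter.2 ⟨hJ, ?_⟩)) _
      exact fun P hP hJP => hx (Set.mem_iUnion₂.2 ⟨P, hP, hJP hxJ⟩)
    rw [e1]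
    refine (dsum_le_dsum hcoeff x).trans ?_
    rw [dsum_const_mul, dsum_add]
    gcongr
    · exact dsum_mono (Finset.filter_subset _ _) _ x
    · exact dsum_sq_le _ _ x
  have hsub : {x | twoPow (2 * (k + 1)) < dsum D (coeffSq f Φ) x} ⊆
      (⋃ P ∈ maximals L, triple P) ∪ ({x | twoPow (2 * k) ≤ dsum D (coeffSq g Φ) x} ∪
        {x | twoPow k ≤ U x}) := by
    intro x hx
    by_contra hne
    simp only [Set.mem_union, not_or] at hne
    obtain ⟨h1, h2, h3⟩ := hne
    have h2' : dsum D (coeffSq g Φ) x < twoPow (2 * k) := not_le.1 h2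
    have h3' : U x < twoPow k := not_le.1 h3
    have hlt : twoPow (2 * (k + 1)) < dsum D (coeffSq f Φ) x := hx
    refine absurd hlt (not_lt.2 ((hS x h1).trans ?_))
    -- The two thresholds `2 ^ (2k)` and `2 ^ k` are chosen so that their contributions add up
    -- exactly to `2 ^ (2(k + 1))`.
    calc 2 * (dsum D (coeffSq g Φ) x + U x ^ 2) ≤ 2 * (twoPow (2 * k) + twoPow k ^ 2) := by
          gcongr
      _ = twoPow (2 * (k + 1)) := by
          rw [twoPow_pow, (by push_cast; ring : (k : ℝ) * ((2 : ℕ) : ℝ) = 2 * k),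
            (by ring : (2 : ℝ) * (k + 1) = 1 + (1 + 2 * k)), twoPow_add 1, twoPow_add 1, twoPow_one]
          ring
  have hv1 : volume (⋃ P ∈ maximals L, triple P) ≤ 3 * volume Ω := by
    have := volume_iUnion_triple_le L
    rwa [hU, hΩ] at this
  have hv2 : volume {x | twoPow (2 * k) ≤ dsum D (coeffSq g Φ) x} ≤
      twoPow (-(2 * k)) * (B₂ * (Z + 4 * twoPow (2 * k) * volume Ω)) := by
    have h1 := mul_meas_ge_le_lintegral (μ := volume) (measurable_dsum D (coeffSq g Φ))
      (twoPow (2 * k))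
    have h2 : ∫⁻ x, dsum D (coeffSq g Φ) x ≤ B₂ * (Z + 4 * twoPow (2 * k) * volume Ω) := by
      have := lintegral_square_le_two h hgLp 0
      rw [shiftSum_zero] at this
      exact this.trans (by gcongr)
    calc _ = twoPow (-(2 * k)) * (twoPow (2 * k) *
          volume {x | twoPow (2 * k) ≤ dsum D (coeffSq g Φ) x}) := by
          rw [← mul_assoc, mul_comm (twoPow (-_)), twoPow_mul_neg, one_mul]
      _ ≤ _ := mul_le_mul_right (h1.trans h2) _
  have hUint : ∫⁻ x, U x ≤ (3 * B 3 + B 2) * wtSum * (2 * geomConst 1) * 2 *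
      ∫⁻ x, Ω.indicator m x := by
    calc ∫⁻ x, U x = ∑ J ∈ D', ∑' P : maximals L, twoPow (J.k / 2) *
          ‖∫ x in dset P, (f x - g x) * conj (Φ J x)‖ₑ := by
          rw [hUdef, lintegral_dsum]
          refine Finset.sum_congr rfl fun J _ => ?_
          rw [ENNReal.tsum_mul_left, mul_right_comm, ← twoPow_add]
          congr 2; ring
      _ = ∑' P : maximals L, ∑ J ∈ D', twoPow (J.k / 2) *
          ‖∫ x in dset P, (f x - g x) * conj (Φ J x)‖ₑ :=
          (Summable.tsum_finsetSum fun _ _ => ENNReal.summable).symm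
      _ ≤ ∑' P : maximals L, (3 * B 3 + B 2) * wtSum * (2 * geomConst 1) * 2 *
            ∫⁻ x in dset P, ‖f x‖ₑ := by
          refine ENNReal.tsum_le_tsum fun P => ?_
          obtain ⟨c1, c2, c3⟩ := hgP P P.2
          refine (sum_kernel_le (B := B) (D := D') (fun J hJ => h.isMolecule J (Finset.mem_filter.1 hJ).1)
            (fun J hJ => (Finset.mem_filter.1 hJ).2 P P.2) c1 c2).trans ?_
          rw [mul_assoc _ (2 : ℝ≥0∞)]
          exact mul_le_mul_right c3 _
      _ = (3 * B 3 + B 2) * wtSum * (2 * geomConst 1) * 2 * ∫⁻ x in Ω, ‖f x‖ₑ := by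
          rw [ENNReal.tsum_mul_left, ← lintegral_dUnion_maximals, hU, hΩ]
      _ ≤ _ := by
          rw [lintegral_indicator hΩm]
          exact mul_le_mul_right (lintegral_mono_ae (ae_restrict_of_ae hfm)) _
  have hv3 : volume {x | twoPow k ≤ U x} ≤ twoPow (-k) *
      ((3 * B 3 + B 2) * wtSum * (2 * geomConst 1) * 2 * ∫⁻ x, Ω.indicator m x) := by
    have h1 := mul_meas_ge_le_lintegral (μ := volume) hUm (twoPow k)
    calc _ = twoPow (-k) * (twoPow k * volume {x | twoPow k ≤ U x}) := by
          rw [← mul_assoc, mul_comm (twoPow (-_)), twoPow_mul_neg, one_mul]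
      _ ≤ _ := mul_le_mul_right (h1.trans hUint) _
  calc _ ≤ volume (⋃ P ∈ maximals L, triple P) +
        (volume {x | twoPow (2 * k) ≤ dsum D (coeffSq g Φ) x} + volume {x | twoPow k ≤ U x}) :=
        (measure_mono hsub).trans ((measure_union_le _ _).trans (by
          gcongr; exact measure_union_le _ _))
    _ ≤ 3 * volume Ω + (twoPow (-(2 * k)) * (B₂ * (Z + 4 * twoPow (2 * k) * volume Ω)) +
        twoPow (-k) *
          ((3 * B 3 + B 2) * wtSum * (2 * geomConst 1) * 2 * ∫⁻ x, Ω.indicator m x)) := by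
        gcongr
    _ = 3 * volume Ω + 4 * B₂ * volume Ω * (twoPow (2 * k) * twoPow (-(2 * k))) +
        B₂ * (twoPow (-(2 * k)) * Z) + (3 * B 3 + B 2) * wtSum * (2 * geomConst 1) * 2 *
        (twoPow (-k) * ∫⁻ x, Ω.indicator m x) := by ring
    _ = _ := by rw [twoPow_mul_neg]; ring

/-- The square function estimate for `1 < p < 2`. -/
lemma exists_lintegral_dsum_le_of_lt_two (B : ℕ → ℝ≥0) {B₂ : ℝ≥0∞} (hB₂ : B₂ ≠ ⊤) {p : ℝ}
    (hp : 1 < p) (hp2 : p < 2) :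
    ∃ C : ℝ≥0∞, C ≠ ⊤ ∧ ∀ (D : Finset DyadicInterval) (Φ : DyadicInterval → ℝ → ℂ),
      IsMoleculeFamily B B₂ D Φ → ∀ f : ℝ → ℂ, Measurable f → ∫⁻ x, ‖f x‖ₑ ^ p ≠ ⊤ →
      ∫⁻ x, dsum D (coeffSq f Φ) x ^ (p / 2) ≤ C * ∫⁻ x, ‖f x‖ₑ ^ p := by
  have hp0 : 0 < p := by linarith
  set C₁ : ℝ≥0∞ := (3 * B 3 + B 2) * wtSum * (2 * geomConst 1) * 2 with hC₁
  have hC₁t : C₁ ≠ ⊤ := by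
    refine ENNReal.mul_ne_top (ENNReal.mul_ne_top (ENNReal.mul_ne_top (ENNReal.add_ne_top.2
      ⟨ENNReal.mul_ne_top (by norm_num) ENNReal.coe_ne_top, ENNReal.coe_ne_top⟩) wtSum_ne_top)
      (ENNReal.mul_ne_top (by norm_num) (geomConst_ne_top one_pos))) (by norm_num)
  set C₂ : ℝ≥0∞ := (3 + 4 * B₂) * geomConst p + B₂ * geomConst (2 - p) +
    C₁ * geomConst (p - 1) with hC₂
  have hC₂t : C₂ ≠ ⊤ := ENNReal.add_ne_top.2 ⟨ENNReal.add_ne_top.2 ⟨ENNReal.mul_ne_top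
    (ENNReal.add_ne_top.2 ⟨by norm_num, ENNReal.mul_ne_top (by norm_num) hB₂⟩)
    (geomConst_ne_top hp0), ENNReal.mul_ne_top hB₂ (geomConst_ne_top (by linarith))⟩,
    ENNReal.mul_ne_top hC₁t (geomConst_ne_top (by linarith))⟩
  refine ⟨twoPow p * (twoPow p * (C₂ * (twoPow (2 * p) * 5 * geomConst (p - 1)))),
    ENNReal.mul_ne_top (twoPow_ne_top _) (ENNReal.mul_ne_top (twoPow_ne_top _)
    (ENNReal.mul_ne_top hC₂t (ENNReal.mul_ne_top (ENNReal.mul_ne_top (twoPow_ne_top _)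
    (by norm_num)) (geomConst_ne_top (by linarith))))), fun D Φ h f hf hfin => ?_⟩
  set m := maxFn Set.univ 0 (fun y => ‖f y‖ₑ) with hm
  have hmm : Measurable m := measurable_maxFn _ _ _
  set S := dsum D (coeffSq f Φ) with hS
  have hSm : Measurable S := measurable_dsum _ _
  set Y := ∫⁻ x, m x ^ p with hY
  have hYle : Y ≤ twoPow (2 * p) * 5 * geomConst (p - 1) * ∫⁻ x, ‖f x‖ₑ ^ p := by
    have := lintegral_maxFn_rpow_le hp Set.univ 0 hf.enorm
    rwa [lg_zero, mul_one] at this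
  have hlev : ∀ k : ℤ, {x | twoPow k < S x ^ (1 / 2 : ℝ)} = {x | twoPow (2 * k) < S x} := by
    intro k
    ext x
    simp only [Set.mem_ofPred_eq]
    rw [← ENNReal.rpow_lt_rpow_iff (z := 2) two_pos, twoPow_rpow, ← ENNReal.rpow_mul,
      mul_comm (k : ℝ)]
    norm_num
  -- The three terms of the single height estimate all involve level sets of the maximal function
  -- `m`, so summing over heights bounds each by `∫ m ^ p`. The second series converges because `p <
  -- 2`, the third because `p > 1`.
  set a₁ : ℤ → ℝ≥0∞ := fun k => twoPow (k * p) * volume {x | twoPow k < m x} with ha₁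
  set a₂ : ℤ → ℝ≥0∞ := fun k => twoPow (k * p) * (twoPow (-(2 * k)) *
    ∫⁻ x, {x | m x ≤ twoPow k}.indicator (fun x => m x ^ 2) x) with ha₂
  set a₃ : ℤ → ℝ≥0∞ := fun k => twoPow (k * p) * (twoPow (-k) *
    ∫⁻ x, {x | twoPow k < m x}.indicator m x) with ha₃
  have hs₁ : ∑' k, a₁ k ≤ geomConst p * Y := tsum_le_lintegral_rpow hmm hp0
  have hs₂ : ∑' k, a₂ k ≤ geomConst (2 - p) * Y := by
    calc ∑' k, a₂ k = ∑' k : ℤ, ∫⁻ x, m x ^ 2 *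
          (if m x ≤ twoPow k then twoPow (-(k * (2 - p))) else 0) := by
          refine tsum_congr fun k => ?_
          simp only [ha₂]
          rw [← mul_assoc, ← twoPow_add, ← lintegral_const_mul' _ _ (twoPow_ne_top _)]
          refine lintegral_congr fun x => ?_
          by_cases hx : m x ≤ twoPow k
          · rw [Set.indicator_of_mem (by exact hx), if_pos hx, mul_comm]
            congr 2; ring
          · rw [Set.indicator_of_notMem (by exact hx), if_neg hx, mul_zero, mul_zero]
      _ = ∫⁻ x, ∑' k : ℤ, m x ^ 2 *
          (if m x ≤ twoPow k then twoPow (-(k * (2 - p))) else 0) :=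
          (lintegral_tsum fun k => ((hmm.pow_const 2).mul (Measurable.ite
            (measurableSet_le hmm measurable_const) measurable_const
            measurable_const)).aemeasurable).symm
      _ ≤ ∫⁻ x, geomConst (2 - p) * m x ^ p := by
          refine lintegral_mono fun x => ?_
          rw [ENNReal.tsum_mul_left]
          refine (mul_le_mul_right (tsum_level_neg_le (by linarith)) _).trans ?_
          rw [mul_left_comm]
          refine mul_le_mul_right ?_ _
          rcases eq_or_ne (m x) 0 with h0 | h0
          · rw [h0]; simp
          rcases eq_or_ne (m x) ⊤ with ht | ht
          · rw [ht, ENNReal.top_rpow_of_pos hp0]; exact le_top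
          rw [← ENNReal.rpow_natCast, ← ENNReal.rpow_add _ _ h0 ht]
          refine le_of_eq ?_
          congr 1; push_cast; ring
      _ = _ := lintegral_const_mul _ (hmm.pow_const _)
  have hs₃ : ∑' k, a₃ k ≤ geomConst (p - 1) * Y := by
    calc ∑' k, a₃ k = ∑' k : ℤ, ∫⁻ x, m x *
          (if twoPow k < m x then twoPow (k * (p - 1)) else 0) := by
          refine tsum_congr fun k => ?_
          simp only [ha₃]
          rw [← mul_assoc, ← twoPow_add, ← lintegral_const_mul' _ _ (twoPow_ne_top _)]
          refine lintegral_congr fun x => ?_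
          by_cases hx : twoPow k < m x
          · rw [Set.indicator_of_mem (by exact hx), if_pos hx, mul_comm]
            congr 2; ring
          · rw [Set.indicator_of_notMem (by exact hx), if_neg hx, mul_zero, mul_zero]
      _ = ∫⁻ x, ∑' k : ℤ, m x *
          (if twoPow k < m x then twoPow (k * (p - 1)) else 0) :=
          (lintegral_tsum fun k => (hmm.mul (Measurable.ite
            (measurableSet_lt measurable_const hmm) measurable_const
            measurable_const)).aemeasurable).symm
      _ ≤ ∫⁻ x, geomConst (p - 1) * m x ^ p := by
          refine lintegral_mono fun x => ?_
          rw [ENNReal.tsum_mul_left]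
          refine (mul_le_mul_right (tsum_level_lt_le (by linarith) _) _).trans ?_
          rw [mul_left_comm]
          refine mul_le_mul_right (le_of_eq ?_) _
          nth_rewrite 1 [← ENNReal.rpow_one (m x)]
          rw [← ENNReal.rpow_add_of_nonneg _ _ (by norm_num) (by linarith)]
          congr 1; ring
      _ = _ := lintegral_const_mul _ (hmm.pow_const _)
  have hterm : ∀ k : ℤ, twoPow (((k + 1 : ℤ) : ℝ) * p) *
      volume {x | twoPow ((k + 1 : ℤ) : ℝ) < S x ^ (1 / 2 : ℝ)} ≤
      twoPow p * ((3 + 4 * B₂) * a₁ k + B₂ * a₂ k + C₁ * a₃ k) := by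
    intro k
    have h1 := volume_lt_dsum_coeffSq_le h hp hp2 hf hfin k hm
    rw [hlev, Int.cast_add, Int.cast_one]
    refine (mul_le_mul_right h1 _).trans (le_of_eq ?_)
    rw [add_mul, twoPow_add, one_mul]
    simp only [ha₁, ha₂, ha₃, hC₁]
    ring
  calc ∫⁻ x, S x ^ (p / 2) = ∫⁻ x, (S x ^ (1 / 2 : ℝ)) ^ p := by
        refine lintegral_congr fun x => ?_
        rw [← ENNReal.rpow_mul]; congr 1; ring
    _ ≤ twoPow p * ∑' k : ℤ, twoPow (k * p) * volume {x | twoPow k < S x ^ (1 / 2 : ℝ)} :=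
        lintegral_rpow_le_tsum (hSm.pow_const _) hp0
    _ = twoPow p * ∑' k : ℤ, twoPow (((k + 1 : ℤ) : ℝ) * p) *
          volume {x | twoPow ((k + 1 : ℤ) : ℝ) < S x ^ (1 / 2 : ℝ)} := by
        congr 1
        exact ((Equiv.addRight (1 : ℤ)).tsum_eq (fun k : ℤ => twoPow (k * p) *
          volume {x | twoPow k < S x ^ (1 / 2 : ℝ)})).symm
    _ ≤ twoPow p * ∑' k : ℤ, twoPow p * ((3 + 4 * B₂) * a₁ k + B₂ * a₂ k + C₁ * a₃ k) :=
        mul_le_mul_right (ENNReal.tsum_le_tsum hterm) _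
    _ = twoPow p * (twoPow p * ((3 + 4 * B₂) * ∑' k, a₁ k + B₂ * ∑' k, a₂ k +
          C₁ * ∑' k, a₃ k)) := by
        rw [ENNReal.tsum_mul_left, ENNReal.tsum_add, ENNReal.tsum_add, ENNReal.tsum_mul_left,
          ENNReal.tsum_mul_left, ENNReal.tsum_mul_left]
    _ ≤ twoPow p * (twoPow p * ((3 + 4 * B₂) * (geomConst p * Y) + B₂ * (geomConst (2 - p) * Y) +
          C₁ * (geomConst (p - 1) * Y))) := by gcongr
    _ = twoPow p * (twoPow p * (C₂ * Y)) := by rw [hC₂]; ring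
    _ ≤ twoPow p * (twoPow p * (C₂ * (twoPow (2 * p) * 5 * geomConst (p - 1) *
          ∫⁻ x, ‖f x‖ₑ ^ p))) := by gcongr
    _ = _ := by ring

/-- The shifted square function is bounded on `L^p` with norm `O(log ⟨n⟩)`. -/
lemma exists_lintegral_shiftSum_coeffSq_le (B : ℕ → ℝ≥0) {B₂ : ℝ≥0∞} (hB₂ : B₂ ≠ ⊤) {p : ℝ}
    (hp : 1 < p) :
    ∃ C : ℝ≥0∞, C ≠ ⊤ ∧ ∀ (D : Finset DyadicInterval) (Φ : DyadicInterval → ℝ → ℂ),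
      IsMoleculeFamily B B₂ D Φ → ∀ f : ℝ → ℂ, Measurable f → ∫⁻ x, ‖f x‖ₑ ^ p ≠ ⊤ → ∀ n : ℤ,
      ∫⁻ x, shiftSum D n (coeffSq f Φ) x ^ (p / 2) ≤ C * lg n ^ p * ∫⁻ x, ‖f x‖ₑ ^ p := by
  rcases lt_trichotomy p 2 with hp2 | rfl | hp2
  -- Here `p / 2 < 1`, so the shift can be inserted afterwards by `lintegral_shiftSum_rpow_le`.
  · obtain ⟨C, hC, h⟩ := exists_lintegral_dsum_le_of_lt_two B hB₂ hp hp2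
    refine ⟨2 * 4 ^ (p / 2) * geomConst (p / 2) * 5 * C, ENNReal.mul_ne_top (ENNReal.mul_ne_top
      (ENNReal.mul_ne_top (ENNReal.mul_ne_top (by norm_num)
      (ENNReal.rpow_ne_top_of_nonneg (by linarith) (by norm_num)))
      (geomConst_ne_top (by linarith))) (by norm_num)) hC, fun D Φ hΦ f hf hfin n => ?_⟩
    calc _ ≤ 2 * 4 ^ (p / 2) * geomConst (p / 2) * (5 * lg n) *
          ∫⁻ x, dsum D (coeffSq f Φ) x ^ (p / 2) :=
          lintegral_shiftSum_rpow_le (by linarith) (by linarith) D n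
            fun J _ => coeffSq_ne_top f Φ J
      _ ≤ 2 * 4 ^ (p / 2) * geomConst (p / 2) * (5 * lg n ^ p) * (C * ∫⁻ x, ‖f x‖ₑ ^ p) := by
          gcongr
          · have := lg_rpow_le hp.le n
            rwa [ENNReal.rpow_one] at this
          · exact h D Φ hΦ f hf hfin
      _ = _ := by ring
  · refine ⟨B₂, hB₂, fun D Φ hΦ f hf hfin n => ?_⟩
    have h1 : MemLp f 2 := by
      simpa using memLp_of_lintegral_rpow_ne_top two_pos hf.aestronglyMeasurable hfin
    have h2 := lintegral_square_le_two hΦ h1 n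
    have h3 : 1 ≤ lg n ^ (2 : ℝ) := by
      have := lg_rpow_le (zero_le_two (α := ℝ)) n
      rwa [ENNReal.rpow_zero] at this
    simp only [div_self (two_ne_zero (α := ℝ)), ENNReal.rpow_one]
    simp only [ENNReal.rpow_two] at h3 ⊢
    refine h2.trans ?_
    gcongr
    exact le_mul_of_one_le_right' h3
  · obtain ⟨C, hC, h⟩ := exists_lintegral_square_le_of_two_lt B hB₂ hp2
    exact ⟨C, hC, fun D Φ hΦ f hf hfin n => h D Φ hΦ f hf
      (fun J hJ => (hΦ.isMolecule J hJ).integrable_mul hp hf hfin) n⟩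

/-! ### The synthesis estimate in `L^r` -/

lemma sum_mul_le_sqrt_mul_sqrt {ι : Type*} (s : Finset ι) (u v : ι → ℝ≥0∞) :
    ∑ i ∈ s, u i * v i ≤ (∑ i ∈ s, u i ^ 2) ^ (1 / 2 : ℝ) * (∑ i ∈ s, v i ^ 2) ^ (1 / 2 : ℝ) := by
  have := ENNReal.inner_le_Lp_mul_Lq s u v (p := 2) (q := 2) ⟨by norm_num, by norm_num, by norm_num⟩
  simpa only [ENNReal.rpow_two] using this

lemma sum_rpow_mul_rpow_le {ι : Type*} (T : Finset ι) (u v : ι → ℝ≥0∞) {s : ℝ} (hs : 0 < s)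
    (hs1 : s < 1) :
    ∑ i ∈ T, u i ^ (1 - s) * v i ^ s ≤ (∑ i ∈ T, u i) ^ (1 - s) * (∑ i ∈ T, v i) ^ s := by
  have hs' : 0 < 1 - s := by linarith
  have := ENNReal.inner_le_Lp_mul_Lq T (fun i => u i ^ (1 - s)) (fun i => v i ^ s)
    (p := (1 - s)⁻¹) (q := s⁻¹) ⟨by rw [inv_inv, inv_inv]; norm_num, by positivity, by positivity⟩
  simp only [← ENNReal.rpow_mul, mul_inv_cancel₀ hs.ne', mul_inv_cancel₀ hs'.ne',
    ENNReal.rpow_one, one_div, inv_inv] at this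
  exact this

/-- The `L^r` bound for a synthesis over intervals contained in a fixed interval. -/
lemma exists_lintegral_sum_rpow_le_of_below (B : ℕ → ℝ≥0) {B₂ : ℝ≥0∞} (hB₂ : B₂ ≠ ⊤) {s : ℝ}
    (hs : 0 < s) (hs1 : s < 1) :
    ∃ C : ℝ≥0∞, C ≠ ⊤ ∧ ∀ (D : Finset DyadicInterval) (Φ : DyadicInterval → ℝ → ℂ),
      IsMoleculeFamily B B₂ D Φ → ∀ (a : DyadicInterval → ℂ) (P : DyadicInterval), ∀ F ⊆ D,
      (∀ J ∈ F, Below J P) → ∫⁻ x, ‖∑ J ∈ F, a J * Φ J x‖ₑ ^ (2 * s) ≤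
        C * twoPow P.k ^ (1 - s) * (∑ J ∈ F, ‖a J‖ₑ ^ 2) ^ s := by
  -- The decay order must satisfy `N * 2s ≥ 2` for the tail to be integrable, and `N ≥ 2` for
  -- `wtAt_pow_le_of_below`.
  obtain ⟨N₀, hN₀⟩ := exists_nat_gt (1 / s)
  set N := max N₀ 2 with hN
  have hN2 : 2 ≤ N := le_max_right _ _
  have hNs : 2 ≤ (N : ℝ) * (2 * s) := by
    have h1 : (N₀ : ℝ) ≤ N := by exact_mod_cast le_max_left N₀ 2
    have h2 : 1 < N₀ * s := by rwa [div_lt_iff₀ hs] at hN₀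
    nlinarith
  have hs' : 0 ≤ 1 - s := by linarith
  set C₁ : ℝ≥0∞ := 3 ^ (1 - s) * B₂ ^ s with hC₁
  set C₂ : ℝ≥0∞ := (B N * 3 ^ N) ^ (2 * s) * geomConst 2 ^ s * wtSum with hC₂
  refine ⟨C₁ + C₂, ENNReal.add_ne_top.2 ⟨ENNReal.mul_ne_top
    (ENNReal.rpow_ne_top_of_nonneg hs' (by norm_num)) (ENNReal.rpow_ne_top_of_nonneg hs.le hB₂),
    ENNReal.mul_ne_top (ENNReal.mul_ne_top (ENNReal.rpow_ne_top_of_nonneg (by linarith)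
    (ENNReal.mul_ne_top ENNReal.coe_ne_top (by finiteness)))
    (ENNReal.rpow_ne_top_of_nonneg hs.le (geomConst_ne_top two_pos))) wtSum_ne_top⟩,
    fun D Φ h a P F hF hP => ?_⟩
  set A := ∑ J ∈ F, ‖a J‖ₑ ^ 2 with hA
  set G : ℝ → ℂ := fun x => ∑ J ∈ F, a J * Φ J x with hG
  have hGm : Measurable G := Finset.measurable_fun_sum _ fun J hJ =>
    (h.isMolecule J (hF hJ)).measurable.const_mul _
  have hTm := measurableSet_triple P
  have hrw : ∀ x, ‖G x‖ₑ ^ (2 * s) = (‖G x‖ₑ ^ 2) ^ s := fun x => by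
    rw [ENNReal.rpow_mul, ENNReal.rpow_two]
  -- Near `P`, Hölder lowers the exponent from `2` to `2s` at the cost of a power of `|P|`, and the
  -- `L²` synthesis bound applies.
  have hnear : ∫⁻ x in triple P, ‖G x‖ₑ ^ (2 * s) ≤ C₁ * twoPow P.k ^ (1 - s) * A ^ s := by
    have h1 := lintegral_rpow_le_of_support hs hs1 hTm
      (v := (triple P).indicator fun x => ‖G x‖ₑ ^ 2)
      ((hGm.enorm.pow_const 2).indicator hTm).aemeasurable
      (fun x hx => Set.indicator_of_notMem hx _)
    calc ∫⁻ x in triple P, ‖G x‖ₑ ^ (2 * s)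
        = ∫⁻ x, ((triple P).indicator (fun x => ‖G x‖ₑ ^ 2) x) ^ s := by
          rw [← lintegral_indicator hTm]
          refine lintegral_congr fun x => ?_
          by_cases hx : x ∈ triple P
          · rw [Set.indicator_of_mem hx, Set.indicator_of_mem hx, hrw]
          · rw [Set.indicator_of_notMem hx, Set.indicator_of_notMem hx,
              ENNReal.zero_rpow_of_pos hs]
      _ ≤ _ := h1
      _ ≤ (3 * twoPow P.k) ^ (1 - s) * (B₂ * A) ^ s := by
          gcongr
          · exact volume_triple_le P
          · refine le_trans (lintegral_mono fun x => ?_) (h.synthesis F hF a)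
            exact Set.indicator_le_self _ _ x
      _ = _ := by
          rw [ENNReal.mul_rpow_of_nonneg _ _ hs', ENNReal.mul_rpow_of_nonneg _ _ hs.le]
          ring
  -- Away from `P` the superposition is bounded pointwise by decay, with Cauchy-Schwarz over the
  -- intervals.
  have hfar : ∫⁻ x in (triple P)ᶜ, ‖G x‖ₑ ^ (2 * s) ≤ C₂ * twoPow P.k ^ (1 - s) * A ^ s := by
    set T := ∑ J ∈ F, ‖a J‖ₑ * (twoPow (-(J.k / 2)) * twoPow (2 * (J.k - P.k))) with hT
    have hT2 : T ^ (2 * s) ≤ (A * (geomConst 2 * twoPow (-P.k))) ^ s := by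
      rw [ENNReal.rpow_mul]
      refine ENNReal.rpow_le_rpow ?_ hs.le
      have h1 := sum_mul_le_sqrt_mul_sqrt F (fun J => ‖a J‖ₑ)
        (fun J => twoPow (-(J.k / 2)) * twoPow (2 * (J.k - P.k)))
      have h2 : ∑ J ∈ F, (twoPow (-(J.k / 2)) * twoPow (2 * (J.k - P.k))) ^ 2 ≤
          geomConst 2 * twoPow (-P.k) := by
        refine le_trans (Finset.sum_le_sum fun J _ => le_of_eq ?_) (sum_scale_decay_le_of_below hP)
        rw [mul_pow, twoPow_pow, twoPow_pow, show -((J.k : ℝ) / 2) * (2 : ℕ) = -J.k by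
          push_cast; ring, show 2 * ((J.k : ℝ) - P.k) * (2 : ℕ) = 4 * (J.k - P.k) by
          push_cast; ring]
      calc T ^ (2 : ℝ) ≤ (A ^ (1 / 2 : ℝ) * (geomConst 2 * twoPow (-P.k)) ^ (1 / 2 : ℝ)) ^ (2 : ℝ) := by
            refine ENNReal.rpow_le_rpow (h1.trans ?_) zero_le_two
            gcongr
        _ = _ := by
            rw [← ENNReal.mul_rpow_of_nonneg _ _ (by norm_num), ← ENNReal.rpow_mul]
            norm_num
    have hpt : ∀ x ∈ (triple P)ᶜ, ‖G x‖ₑ ^ (2 * s) ≤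
        (B N * 3 ^ N) ^ (2 * s) * T ^ (2 * s) * wtAt P x ^ 2 := by
      intro x hx
      have h1 : ‖G x‖ₑ ≤ B N * 3 ^ N * T * wtAt P x ^ N := by
        calc ‖G x‖ₑ ≤ ∑ J ∈ F, ‖a J * Φ J x‖ₑ := enorm_sum_le _ _
          _ ≤ ∑ J ∈ F, B N * 3 ^ N * (‖a J‖ₑ *
              (twoPow (-(J.k / 2)) * twoPow (2 * (J.k - P.k)))) * wtAt P x ^ N := by
              refine Finset.sum_le_sum fun J hJ => ?_
              rw [enorm_mul]
              calc ‖a J‖ₑ * ‖Φ J x‖ₑ ≤ ‖a J‖ₑ * (B N * twoPow (-(J.k / 2)) *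
                    (3 ^ N * twoPow (2 * (J.k - P.k)) * wtAt P x ^ N)) := by
                    gcongr
                    refine ((h.isMolecule J (hF hJ)).decay N x).trans ?_
                    gcongr
                    exact wtAt_pow_le_of_below (hP J hJ) hx N hN2
                _ = _ := by ring
          _ = _ := by rw [← Finset.sum_mul, ← Finset.mul_sum]
      have h2s : 0 ≤ 2 * s := by linarith
      refine (ENNReal.rpow_le_rpow h1 h2s).trans ?_
      rw [ENNReal.mul_rpow_of_nonneg _ _ h2s, ENNReal.mul_rpow_of_nonneg _ _ h2s,
        ← ENNReal.rpow_natCast (wtAt P x) N, ← ENNReal.rpow_mul]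
      gcongr
      rw [← ENNReal.rpow_two]
      exact ENNReal.rpow_le_rpow_of_exponent_ge (wtAt_le_one _ _) hNs
    calc ∫⁻ x in (triple P)ᶜ, ‖G x‖ₑ ^ (2 * s)
        ≤ ∫⁻ x in (triple P)ᶜ, (B N * 3 ^ N) ^ (2 * s) * T ^ (2 * s) * wtAt P x ^ 2 :=
          setLIntegral_mono' hTm.compl hpt
      _ ≤ ∫⁻ x, (B N * 3 ^ N) ^ (2 * s) * T ^ (2 * s) * wtAt P x ^ 2 := setLIntegral_le_lintegral _ _
      _ = (B N * 3 ^ N) ^ (2 * s) * T ^ (2 * s) * (wtSum * twoPow P.k) := by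
          rw [lintegral_const_mul _ ((measurable_wtAt P).pow_const 2), lintegral_wtAt_sq]
      _ ≤ (B N * 3 ^ N) ^ (2 * s) * (A * (geomConst 2 * twoPow (-P.k))) ^ s *
          (wtSum * twoPow P.k) := by gcongr
      _ = C₂ * (twoPow (-P.k) ^ s * twoPow P.k) * A ^ s := by
          rw [ENNReal.mul_rpow_of_nonneg _ _ hs.le, ENNReal.mul_rpow_of_nonneg _ _ hs.le]
          ring
      _ = _ := by
          rw [twoPow_rpow, twoPow_rpow, ← twoPow_add]
          congr 3; ring
  calc ∫⁻ x, ‖G x‖ₑ ^ (2 * s) = (∫⁻ x in triple P, ‖G x‖ₑ ^ (2 * s)) +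
        ∫⁻ x in (triple P)ᶜ, ‖G x‖ₑ ^ (2 * s) := (lintegral_add_compl _ hTm).symm
    _ ≤ C₁ * twoPow P.k ^ (1 - s) * A ^ s + C₂ * twoPow P.k ^ (1 - s) * A ^ s :=
        add_le_add hnear hfar
    _ = _ := by ring

/-- The square function of a sequence of coefficients. -/
def sizeSq (a : DyadicInterval → ℂ) (J : DyadicInterval) : ℝ≥0∞ := ‖a J‖ₑ ^ 2 * twoPow (-J.k)

lemma sizeSq_ne_top (a : DyadicInterval → ℂ) (J : DyadicInterval) : sizeSq a J ≠ ⊤ :=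
  ENNReal.mul_ne_top (ENNReal.pow_ne_top enorm_ne_top) (twoPow_ne_top _)

lemma sizeSq_mul_twoPow (a : DyadicInterval → ℂ) (J : DyadicInterval) :
    sizeSq a J * twoPow J.k = ‖a J‖ₑ ^ 2 := by
  rw [sizeSq, mul_assoc, ← twoPow_add, neg_add_cancel, twoPow_zero, mul_one]

/-- For `r ≤ 1` duality is unavailable, but `∫ |·| ^ r` is subadditive. The local bound below each
maximal interval and Hölder over those intervals give the hypothesis of `level_decomposition` with
`s = r / 2`. -/
lemma exists_lintegral_synthesis_le_of_le_one (B : ℕ → ℝ≥0) {B₂ : ℝ≥0∞} (hB₂ : B₂ ≠ ⊤) {r : ℝ}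
    (hr : 0 < r) (hr1 : r ≤ 1) :
    ∃ C : ℝ≥0∞, C ≠ ⊤ ∧ ∀ (D : Finset DyadicInterval) (Φ : DyadicInterval → ℝ → ℂ),
      IsMoleculeFamily B B₂ D Φ → ∀ a : DyadicInterval → ℂ,
      ∫⁻ x, ‖∑ J ∈ D, a J * Φ J x‖ₑ ^ r ≤ C * ∫⁻ x, dsum D (sizeSq a) x ^ (r / 2) := by
  classical
  set s := r / 2 with hs
  have hs0 : 0 < s := by rw [hs]; linarith
  have hs1 : s < 1 := by rw [hs]; linarith
  have hrs : r = 2 * s := by rw [hs]; ring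
  obtain ⟨C₀, hC₀, h₀⟩ := exists_lintegral_sum_rpow_le_of_below B hB₂ hs0 hs1
  refine ⟨2 * 4 ^ s * geomConst s * C₀, ENNReal.mul_ne_top (ENNReal.mul_ne_top (ENNReal.mul_ne_top
    (by norm_num) (ENNReal.rpow_ne_top_of_nonneg hs0.le (by norm_num))) (geomConst_ne_top hs0)) hC₀,
    fun D Φ h a => ?_⟩
  -- The supremum over subfamilies makes the functional monotone. Overlapping families can then be
  -- split as `F` and the rest of `G`; intersecting with `D` makes it meaningful for every `F`.
  set X : Finset DyadicInterval → ℝ≥0∞ := fun F =>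
    ⨆ E : Finset DyadicInterval, ⨆ _ : E ⊆ F ∩ D, ∫⁻ x, ‖∑ J ∈ E, a J * Φ J x‖ₑ ^ r with hX
  have hXle : ∀ {E F : Finset DyadicInterval}, E ⊆ F ∩ D →
      ∫⁻ x, ‖∑ J ∈ E, a J * Φ J x‖ₑ ^ r ≤ X F := fun {E F} hE =>
    le_iSup₂_of_le (f := fun (E : Finset DyadicInterval) (_ : E ⊆ F ∩ D) =>
      ∫⁻ x, ‖∑ J ∈ E, a J * Φ J x‖ₑ ^ r) E hE le_rfl
  have hX0 : X ∅ = 0 := by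
    refine le_antisymm (iSup₂_le fun E hE => ?_) zero_le
    rw [Finset.empty_inter, Finset.subset_empty] at hE
    simp [hE, ENNReal.zero_rpow_of_pos hr]
  have hXadd : ∀ F G, X (F ∪ G) ≤ X F + X G := by
    refine fun F G => iSup₂_le fun E hE => ?_
    have hm : Measurable fun x => ‖∑ J ∈ E ∩ F, a J * Φ J x‖ₑ ^ r :=
      (Finset.measurable_fun_sum _ fun J hJ => (h.isMolecule J (Finset.mem_inter.1
        (hE (Finset.mem_inter.1 hJ).1)).2).measurable.const_mul _).enorm.pow_const _
    calc ∫⁻ x, ‖∑ J ∈ E, a J * Φ J x‖ₑ ^ r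
        ≤ ∫⁻ x, (‖∑ J ∈ E ∩ F, a J * Φ J x‖ₑ ^ r + ‖∑ J ∈ E \ F, a J * Φ J x‖ₑ ^ r) := by
          refine lintegral_mono fun x => ?_
          rw [← Finset.sum_inter_add_sum_sdiff E F]
          exact (ENNReal.rpow_le_rpow (enorm_add_le _ _) hr.le).trans
            (ENNReal.rpow_add_le_add_rpow _ _ hr.le hr1)
      _ = _ := lintegral_add_left hm _
      _ ≤ X F + X G := by
          refine add_le_add (hXle fun J hJ => ?_) (hXle fun J hJ => ?_)
          · have h1 := Finset.mem_inter.1 hJ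
            exact Finset.mem_inter.2 ⟨h1.2, (Finset.mem_inter.1 (hE h1.1)).2⟩
          · have h1 := Finset.mem_sdiff.1 hJ
            have h2 := Finset.mem_inter.1 (hE h1.1)
            exact Finset.mem_inter.2 ⟨(Finset.mem_union.1 h2.1).resolve_left h1.2, h2.2⟩
  have hXbelow : ∀ P, ∀ F ⊆ D, (∀ J ∈ F, Below J P) →
      X F ≤ C₀ * (twoPow P.k ^ (1 - s) * (∑ J ∈ F, ‖a J‖ₑ ^ 2) ^ s) := by
    refine fun P F hF hP => iSup₂_le fun E hE => ?_
    have hEF : E ⊆ F := hE.trans Finset.inter_subset_left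
    have h1 := h₀ D Φ h a P E (hEF.trans hF) fun J hJ => hP J (hEF hJ)
    rw [hrs, ← mul_assoc]
    refine h1.trans ?_
    gcongr
  have hB : ∀ F ⊆ D, X F ≤ C₀ * volume (dUnion F) ^ (1 - s) *
      (∑ J ∈ F, sizeSq a J * twoPow J.k) ^ s := by
    intro F hF
    set below : DyadicInterval → Finset DyadicInterval := fun P => F.filter fun J => Below J P
    have hdisj : ((maxFinset F : Finset DyadicInterval) : Set DyadicInterval).PairwiseDisjoint
        below := by
      intro P hP Q hQ hPQ
      rw [coe_maxFinset] at hP hQ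
      refine Finset.disjoint_left.2 fun J hJP hJQ => ?_
      exact Set.disjoint_left.1 (pairwiseDisjoint_maximals _ hP hQ hPQ)
        ((Finset.mem_filter.1 hJP).2.2 (left_mem_dset J))
        ((Finset.mem_filter.1 hJQ).2.2 (left_mem_dset J))
    calc X F = X ((maxFinset F).biUnion below) := by rw [biUnion_maxFinset]
      _ ≤ ∑ P ∈ maxFinset F, X (below P) := apply_biUnion_le_sum hX0 hXadd _ _
      _ ≤ ∑ P ∈ maxFinset F, C₀ * (twoPow P.k ^ (1 - s) * (∑ J ∈ below P, ‖a J‖ₑ ^ 2) ^ s) :=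
          Finset.sum_le_sum fun P _ => hXbelow P _ ((Finset.filter_subset _ _).trans hF)
            fun J hJ => (Finset.mem_filter.1 hJ).2
      _ ≤ C₀ * ((∑ P ∈ maxFinset F, twoPow P.k) ^ (1 - s) *
            (∑ P ∈ maxFinset F, ∑ J ∈ below P, ‖a J‖ₑ ^ 2) ^ s) := by
          rw [← Finset.mul_sum]
          exact mul_le_mul_right (sum_rpow_mul_rpow_le _ _ _ hs0 hs1) _
      _ = _ := by
          rw [sum_twoPow_maxFinset, ← Finset.sum_biUnion hdisj, biUnion_maxFinset, mul_assoc]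
          simp only [sizeSq_mul_twoPow]
  calc ∫⁻ x, ‖∑ J ∈ D, a J * Φ J x‖ₑ ^ r ≤ X D := hXle (by simp)
    _ ≤ _ := level_decomposition hs0 hs1 D (fun J _ => sizeSq_ne_top a J) hXadd hB

/-- Duality with the unshifted square function bound for the conjugate exponent: `G` is tested
against its own extremal function, and a power of `∫ |G| ^ r` is absorbed. -/
lemma exists_lintegral_synthesis_le_of_one_lt (B : ℕ → ℝ≥0) {B₂ : ℝ≥0∞} (hB₂ : B₂ ≠ ⊤) {r : ℝ}
    (hr : 1 < r) :
    ∃ C : ℝ≥0∞, C ≠ ⊤ ∧ ∀ (D : Finset DyadicInterval) (Φ : DyadicInterval → ℝ → ℂ),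
      IsMoleculeFamily B B₂ D Φ → ∀ a : DyadicInterval → ℂ,
      ∫⁻ x, ‖∑ J ∈ D, a J * Φ J x‖ₑ ^ r ≤ C * ∫⁻ x, dsum D (sizeSq a) x ^ (r / 2) := by
  have hr0 : 0 < r := by linarith
  have hr1 : 0 < r - 1 := by linarith
  set q := r / (r - 1) with hq
  have hq1 : 1 < q := by rw [hq, one_lt_div hr1]; linarith
  obtain ⟨C₀, hC₀, h₀⟩ := exists_lintegral_shiftSum_coeffSq_le B hB₂ hq1
  refine ⟨C₀ ^ (r - 1), ENNReal.rpow_ne_top_of_nonneg hr1.le hC₀, fun D Φ h a => ?_⟩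
  set G : ℝ → ℂ := fun x => ∑ J ∈ D, a J * Φ J x with hG
  have hGm : Measurable G := Finset.measurable_fun_sum _ fun J hJ =>
    (h.isMolecule J hJ).measurable.const_mul _
  set Y := ∫⁻ x, ‖G x‖ₑ ^ r with hY
  have hYt : Y ≠ ⊤ := by
    have hGL : MemLp G (ENNReal.ofReal r) := memLp_finsetSum _ fun J hJ =>
      ((h.isMolecule J hJ).memLp hr0).const_mul _
    have := hGL.2
    rw [eLpNorm_lt_top_iff_lintegral_rpow_enorm_lt_top (by simpa using hr0) ENNReal.ofReal_ne_top,
      ENNReal.toReal_ofReal hr0.le] at this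
    exact this.ne
  -- This function satisfies `H * conj G = |G| ^ r` and `|H| ^ q = |G| ^ r`, hence attains equality
  -- in Hölder's inequality.
  set H : ℝ → ℂ := fun x => ((‖G x‖ ^ (r - 2) : ℝ) : ℂ) * G x with hH
  have hHm : Measurable H :=
    (Complex.measurable_ofReal.comp (hGm.norm.pow_const _)).mul hGm
  have hHn : ∀ x, ‖H x‖ₑ = ‖G x‖ₑ ^ (r - 1) := by
    intro x
    rcases eq_or_ne (G x) 0 with h0 | h0
    · simp [hH, h0, ENNReal.zero_rpow_of_pos hr1]
    · have h1 : 0 < ‖G x‖ := norm_pos_iff.2 h0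
      rw [← ofReal_norm, ← ofReal_norm, ENNReal.ofReal_rpow_of_pos h1]
      congr 1
      simp only [hH]
      rw [norm_mul, Complex.norm_real, Real.norm_of_nonneg (by positivity)]
      nth_rewrite 2 [← Real.rpow_one ‖G x‖]
      rw [← Real.rpow_add h1]
      congr 1; ring
  have hHG : ∀ x, H x * conj (G x) = ((‖G x‖ ^ r : ℝ) : ℂ) := by
    intro x
    rcases eq_or_ne (G x) 0 with h0 | h0
    · simp [hH, h0, Real.zero_rpow hr0.ne']
    · have h1 : 0 < ‖G x‖ := norm_pos_iff.2 h0
      simp only [hH]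
      rw [mul_assoc, Complex.mul_conj, ← Complex.ofReal_mul, Complex.normSq_eq_norm_sq,
        ← Real.rpow_two, ← Real.rpow_add h1]
      congr 2; ring
  have hHq : ∫⁻ x, ‖H x‖ₑ ^ q = Y := by
    refine lintegral_congr fun x => ?_
    rw [hHn, ← ENNReal.rpow_mul, hq, mul_div_cancel₀ _ hr1.ne']
  have hHfin : ∫⁻ x, ‖H x‖ₑ ^ q ≠ ⊤ := by rw [hHq]; exact hYt
  have hpair : ∑ J ∈ D, conj (a J) * pairing H (Φ J) = ((∫ x, ‖G x‖ ^ r : ℝ) : ℂ) := by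
    rw [sum_conj_mul_pairing (fun J hJ => (h.isMolecule J hJ).integrable_mul hq1 hHm hHfin),
      ← integral_complex_ofReal]
    exact integral_congr_ae (Filter.Eventually.of_forall hHG)
  have hYeq : Y = ENNReal.ofReal (∫ x, ‖G x‖ ^ r) := by
    rw [integral_eq_lintegral_of_nonneg_ae
      (Filter.Eventually.of_forall fun x => by positivity)
      (hGm.norm.pow_const r).aestronglyMeasurable]
    simp only [← ENNReal.ofReal_rpow_of_nonneg (norm_nonneg _) hr0.le, ofReal_norm]
    rw [ENNReal.ofReal_toReal hYt]
  have hY1 : Y ≤ ∑ J ∈ D, ‖a J‖ₑ * ‖pairing H (Φ J)‖ₑ := by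
    calc Y = ‖((∫ x, ‖G x‖ ^ r : ℝ) : ℂ)‖ₑ := by
          rw [hYeq, ← ofReal_norm, Complex.norm_real, Real.norm_of_nonneg
            (integral_nonneg fun x => by positivity)]
      _ ≤ _ := by
          rw [← hpair]
          refine (enorm_sum_le _ _).trans (le_of_eq (Finset.sum_congr rfl fun J _ => ?_))
          rw [enorm_mul, enorm_conj]
  have hY2 : Y ≤ ∫⁻ x, dsum D (sizeSq a) x ^ (1 / 2 : ℝ) *
      dsum D (coeffSq H Φ) x ^ (1 / 2 : ℝ) := by
    have h1 : ∑ J ∈ D, ‖a J‖ₑ * ‖pairing H (Φ J)‖ₑ =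
        ∫⁻ x, dsum D (fun J => ‖a J‖ₑ * ‖pairing H (Φ J)‖ₑ * twoPow (-J.k)) x := by
      rw [lintegral_dsum]
      refine Finset.sum_congr rfl fun J _ => ?_
      rw [mul_assoc _ (twoPow _), ← twoPow_add, neg_add_cancel, twoPow_zero, mul_one]
    rw [h1] at hY1
    refine hY1.trans (lintegral_mono fun x => ?_)
    have h2 := sum_mul_le_sqrt_mul_sqrt D
      (fun J => (dset J).indicator (fun _ => ‖a J‖ₑ * twoPow (-(J.k / 2))) x)
      (fun J => (dset J).indicator (fun _ => ‖pairing H (Φ J)‖ₑ * twoPow (-(J.k / 2))) x)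
    have e : ∀ J : DyadicInterval, twoPow (-(J.k / 2)) * twoPow (-(J.k / 2)) = twoPow (-J.k) :=
      fun J => by rw [← twoPow_add]; congr 1; ring
    refine le_trans (le_of_eq ?_) (h2.trans (le_of_eq ?_))
    · refine Finset.sum_congr rfl fun J _ => ?_
      by_cases hx : x ∈ dset J
      · simp only [Set.indicator_of_mem hx]; rw [← e J]; ring
      · simp [Set.indicator_of_notMem hx]
    · congr 2
      · refine Finset.sum_congr rfl fun J _ => ?_
        by_cases hx : x ∈ dset J
        · simp only [Set.indicator_of_mem hx]; rw [sizeSq, ← e J]; ring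
        · simp [Set.indicator_of_notMem hx]
      · refine Finset.sum_congr rfl fun J _ => ?_
        by_cases hx : x ∈ dset J
        · simp only [Set.indicator_of_mem hx]; rw [coeffSq, ← e J]; ring
        · simp [Set.indicator_of_notMem hx]
  have hθ0 : (0 : ℝ) < 1 / r := by positivity
  have hθ1 : 1 / r ≤ 1 := by rw [div_le_one hr0]; exact hr.le
  have hθ : 1 - 1 / r = (r - 1) * (1 / r) := by field_simp
  refine le_of_le_rpow_mul_rpow hθ0 hθ1 hYt ?_
  calc Y ≤ _ := hY2
    _ ≤ (∫⁻ x, (dsum D (sizeSq a) x ^ (1 / 2 : ℝ)) ^ r) ^ (1 / r) *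
        (∫⁻ x, (dsum D (coeffSq H Φ) x ^ (1 / 2 : ℝ)) ^ q) ^ (1 - 1 / r) :=
        lintegral_mul_le_rpow ((measurable_dsum _ _).pow_const _).aemeasurable
          ((measurable_dsum _ _).pow_const _).aemeasurable hθ0.le hθ1 (by field_simp)
          (by rw [hθ, hq]; field_simp)
    _ = (∫⁻ x, dsum D (sizeSq a) x ^ (r / 2)) ^ (1 / r) *
        (∫⁻ x, dsum D (coeffSq H Φ) x ^ (q / 2)) ^ (1 - 1 / r) := by
        simp only [← ENNReal.rpow_mul]
        rw [show 1 / 2 * r = r / 2 by ring, show 1 / 2 * q = q / 2 by ring]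
    _ ≤ (∫⁻ x, dsum D (sizeSq a) x ^ (r / 2)) ^ (1 / r) * (C₀ * Y) ^ (1 - 1 / r) := by
        refine mul_le_mul_right (ENNReal.rpow_le_rpow ?_ (by linarith)) _
        have := h₀ D Φ h H hHm hHfin 0
        rwa [shiftSum_zero, lg_zero, ENNReal.one_rpow, mul_one, hHq] at this
    _ = _ := by
        rw [ENNReal.mul_rpow_of_nonneg _ _ hθ0.le, ENNReal.mul_rpow_of_nonneg C₀ Y (by linarith),
          ← ENNReal.rpow_mul C₀, ← hθ]
        ring

/-- The `L^r` norm of a synthesis is controlled by its square function, for all `r > 0`. -/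
lemma exists_lintegral_synthesis_le (B : ℕ → ℝ≥0) {B₂ : ℝ≥0∞} (hB₂ : B₂ ≠ ⊤) {r : ℝ}
    (hr : 0 < r) :
    ∃ C : ℝ≥0∞, C ≠ ⊤ ∧ ∀ (D : Finset DyadicInterval) (Φ : DyadicInterval → ℝ → ℂ),
      IsMoleculeFamily B B₂ D Φ → ∀ a : DyadicInterval → ℂ,
      ∫⁻ x, ‖∑ J ∈ D, a J * Φ J x‖ₑ ^ r ≤ C * ∫⁻ x, dsum D (sizeSq a) x ^ (r / 2) := by
  rcases le_or_gt r 1 with h | h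
  · exact exists_lintegral_synthesis_le_of_le_one B hB₂ hr h
  · exact exists_lintegral_synthesis_le_of_one_lt B hB₂ h

/-! ### The bilinear operator -/

/-- The image of a collection of dyadic intervals under a shift. -/
def shiftImage (D : Finset DyadicInterval) (n : ℤ) : Finset DyadicInterval :=
  D.image fun I => I.shift n

lemma mem_shiftImage {D : Finset DyadicInterval} {n : ℤ} {I : DyadicInterval} (h : I ∈ D) :
    I.shift n ∈ shiftImage D n := Finset.mem_image_of_mem _ h

lemma coe_shiftImage (D : Finset DyadicInterval) (n : ℤ) :
    (shiftImage D n : Set DyadicInterval) = (fun I => I.shift n) '' (D : Set DyadicInterval) :=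
  Finset.coe_image

lemma shiftSum_shiftImage (D : Finset DyadicInterval) (n i : ℤ) (c : DyadicInterval → ℝ≥0∞)
    (x : ℝ) : shiftSum (shiftImage D n) i c x =
      ∑ I ∈ D, (dset (I.shift (n + i))).indicator (fun _ => c (I.shift n)) x := by
  rw [shiftSum, shiftImage, Finset.sum_image (fun I _ J _ h => shift_injective n h)]
  simp only [shift_shift]

/-- A square function in which the indicator functions are replaced by decaying weights. -/
def tailSquare (D : Finset DyadicInterval) (n : ℤ) (c : DyadicInterval → ℝ≥0∞) (x : ℝ) : ℝ≥0∞ :=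
  ∑ I ∈ D, c (I.shift n) * wtAt I x ^ 16

lemma measurable_tailSquare (D : Finset DyadicInterval) (n : ℤ) (c : DyadicInterval → ℝ≥0∞) :
    Measurable (tailSquare D n c) :=
  Finset.measurable_fun_sum _ fun I _ => ((measurable_wtAt I).pow_const 16).const_mul _

/-- Each weight is resolved into indicators of translates. The coefficients belong to `I.shift n`,
so the shift `-n + m` takes that interval to `I.shift m`. -/
lemma tailSquare_eq_tsum (D : Finset DyadicInterval) (n : ℤ) (c : DyadicInterval → ℝ≥0∞) (x : ℝ) :
    tailSquare D n c x = ∑' m : ℤ, wt m ^ (2 + 14) * shiftSum (shiftImage D n) (-n + m) c x := by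
  have h1 : ∀ I : DyadicInterval, c (I.shift n) * wtAt I x ^ 16 =
      ∑' m : ℤ, wt m ^ (2 + 14) * (dset (I.shift m)).indicator (fun _ => c (I.shift n)) x := by
    intro I
    have hx : x ∈ dset (I.shift (I.m - idx I.k x)) := by
      rw [mem_dset, shift_k, shift_m]; ring
    rw [tsum_eq_single (I.m - idx I.k x)]
    · rw [Set.indicator_of_mem hx, wtAt_of_mem_shift hx, mul_comm]
    · intro m hm
      rw [Set.indicator_of_notMem, mul_zero]
      intro hx'
      rw [mem_dset, shift_k, shift_m] at hx'
      exact hm (by rw [hx']; ring)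
  rw [tailSquare, Finset.sum_congr rfl fun I _ => h1 I,
    ← Summable.tsum_finsetSum fun _ _ => ENNReal.summable]
  refine tsum_congr fun m => ?_
  rw [shiftSum_shiftImage, Finset.mul_sum]
  simp only [add_neg_cancel_left]

/-- The tails are averages of shifted square functions over the shifts `-n + m`; decay in `m`
absorbs the growth of the logarithm. -/
lemma exists_lintegral_tailSquare_le (B : ℕ → ℝ≥0) {B₂ : ℝ≥0∞} (hB₂ : B₂ ≠ ⊤) {p : ℝ}
    (hp : 1 < p) :
    ∃ C : ℝ≥0∞, C ≠ ⊤ ∧ ∀ (D : Finset DyadicInterval) (n : ℤ) (Φ : DyadicInterval → ℝ → ℂ),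
      IsMoleculeFamily B B₂ (shiftImage D n) Φ → ∀ f : ℝ → ℂ, Measurable f →
      ∫⁻ x, ‖f x‖ₑ ^ p ≠ ⊤ →
      ∫⁻ x, tailSquare D n (coeffSq f Φ) x ^ (p / 2) ≤ C * lg n ^ p * ∫⁻ x, ‖f x‖ₑ ^ p := by
  have hp0 : 0 < p := by linarith
  obtain ⟨C₀, hC₀, h₀⟩ := exists_lintegral_shiftSum_coeffSq_le B hB₂ hp
  refine ⟨wtSum ^ (p / 2) * (C₀ * 2 ^ p * wtSum), ENNReal.mul_ne_top
    (ENNReal.rpow_ne_top_of_nonneg (by linarith) wtSum_ne_top) (ENNReal.mul_ne_top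
    (ENNReal.mul_ne_top hC₀ (ENNReal.rpow_ne_top_of_nonneg hp0.le (by norm_num))) wtSum_ne_top),
    fun D n Φ h f hf hfin => ?_⟩
  set X := ∫⁻ x, ‖f x‖ₑ ^ p with hX
  have hterm : ∀ m : ℤ, (wt m ^ 14) ^ (p / 2) * (C₀ * lg (-n + m) ^ p * X) ≤
      C₀ * 2 ^ p * lg n ^ p * X * wt m ^ 2 := by
    intro m
    -- The power `p` pays for `lg_add_le`, which enters with exponent `p`; the remaining `6 * p ≥ 2`
    -- gives summability in `m`.
    have h1 : (wt m ^ 14) ^ (p / 2) = wt m ^ (6 * p) * wt m ^ p := by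
      rw [← ENNReal.rpow_natCast, ← ENNReal.rpow_mul,
        ← ENNReal.rpow_add _ _ (wt_ne_zero m) (wt_ne_top m)]
      congr 1; push_cast; ring
    have h2 : wt m ^ p * lg (-n + m) ^ p ≤ 2 ^ p * lg n ^ p := by
      rw [← ENNReal.mul_rpow_of_nonneg _ _ hp0.le, ← ENNReal.mul_rpow_of_nonneg _ _ hp0.le]
      refine ENNReal.rpow_le_rpow ?_ hp0.le
      refine (mul_le_mul_right (lg_add_le (-n) m) _).trans (le_of_eq ?_)
      rw [lg_neg, mul_comm, mul_assoc, ENNReal.inv_mul_cancel (wt_ne_zero m) (wt_ne_top m), mul_one]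
    have h3 : wt m ^ (6 * p) ≤ wt m ^ 2 := by
      rw [← ENNReal.rpow_two]
      exact ENNReal.rpow_le_rpow_of_exponent_ge (wt_le_one m) (by linarith)
    calc _ = C₀ * X * wt m ^ (6 * p) * (wt m ^ p * lg (-n + m) ^ p) := by rw [h1]; ring
      _ ≤ C₀ * X * wt m ^ 2 * (2 ^ p * lg n ^ p) := by gcongr
      _ = _ := by ring
  calc ∫⁻ x, tailSquare D n (coeffSq f Φ) x ^ (p / 2)
      ≤ ∫⁻ x, wtSum ^ (p / 2) * ∑' m : ℤ, (wt m ^ 14) ^ (p / 2) *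
          shiftSum (shiftImage D n) (-n + m) (coeffSq f Φ) x ^ (p / 2) := by
        refine lintegral_mono fun x => ?_
        rw [tailSquare_eq_tsum]
        exact rpow_tsum_wt_le (by linarith) 14 _
    _ = wtSum ^ (p / 2) * ∑' m : ℤ, (wt m ^ 14) ^ (p / 2) *
          ∫⁻ x, shiftSum (shiftImage D n) (-n + m) (coeffSq f Φ) x ^ (p / 2) := by
        rw [lintegral_const_mul' _ _ (ENNReal.rpow_ne_top_of_nonneg (by linarith) wtSum_ne_top),
          lintegral_tsum fun m =>
            (((measurable_shiftSum _ _ _).pow_const _).const_mul _).aemeasurable]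
        congr 1
        exact tsum_congr fun m => lintegral_const_mul _ ((measurable_shiftSum _ _ _).pow_const _)
    _ ≤ wtSum ^ (p / 2) * ∑' m : ℤ, C₀ * 2 ^ p * lg n ^ p * X * wt m ^ 2 := by
        refine mul_le_mul_right (ENNReal.tsum_le_tsum fun m => ?_) _
        exact (mul_le_mul_right (h₀ _ Φ h f hf hfin _) _).trans (hterm m)
    _ = _ := by
        rw [ENNReal.tsum_mul_left]
        change _ * (_ * wtSum) = _
        ring

/-- Hölder's inequality in the form in which it is used for the bilinear operator. -/
lemma lintegral_rpow_mul_rpow_le {p q r : ℝ} (hp : 0 < p) (hq : 0 < q) (hr : 0 < r)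
    (hpqr : 1 / p + 1 / q = 1 / r) {u v : ℝ → ℝ≥0∞} (hu : Measurable u) (hv : Measurable v)
    {C₁ C₂ L₁ L₂ X₁ X₂ : ℝ≥0∞} (h₁ : ∫⁻ x, u x ^ p ≤ C₁ * L₁ ^ p * X₁)
    (h₂ : ∫⁻ x, v x ^ q ≤ C₂ * L₂ ^ q * X₂) :
    ∫⁻ x, (u x * v x) ^ r ≤
      (C₁ ^ (1 / p) * C₂ ^ (1 / q) * (L₁ * L₂) * (X₁ ^ (1 / p) * X₂ ^ (1 / q))) ^ r := by
  have hsum : r / p + r / q = 1 := by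
    have : r * (1 / p + 1 / q) = 1 := by rw [hpqr]; field_simp
    rw [← this]; ring
  have hθ0 : 0 < r / p := by positivity
  have hθ1 : 0 < r / q := by positivity
  have hθ : 1 - r / p = r / q := by linarith
  have h := lintegral_mul_le_rpow (hu.pow_const r).aemeasurable (hv.pow_const r).aemeasurable
    (a := p / r) (b := q / r) (θ := r / p) hθ0.le (by linarith) (by field_simp)
    (by rw [hθ]; field_simp)
  simp only [← ENNReal.rpow_mul, mul_div_cancel₀ _ hr.ne', hθ] at h
  simp only [ENNReal.mul_rpow_of_nonneg _ _ hr.le]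
  refine h.trans ?_
  calc _ ≤ (C₁ * L₁ ^ p * X₁) ^ (r / p) * (C₂ * L₂ ^ q * X₂) ^ (r / q) := by gcongr
    _ = _ := by
        simp only [ENNReal.mul_rpow_of_nonneg _ _ hθ0.le, ENNReal.mul_rpow_of_nonneg _ _ hθ1.le,
          ← ENNReal.rpow_mul, mul_div_cancel₀ _ hp.ne', mul_div_cancel₀ _ hq.ne',
          one_div_mul_eq_div]
        ring

lemma enorm_modelOperator_term (I : DyadicInterval) (z w : ℂ) :
    ‖((I.length ^ (-(1 / 2) : ℝ) : ℝ) : ℂ) * z * w‖ₑ = twoPow (-(I.k / 2)) * ‖z‖ₑ * ‖w‖ₑ := by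
  rw [enorm_mul, enorm_mul, enorm_ofReal_rpow]

/-- The estimate for the bilinear operator when the first two families are of `ψ` type. -/
lemma exists_lintegral_modelOperator_le (B : ℕ → ℝ≥0) {B₂ : ℝ≥0∞} (hB₂ : B₂ ≠ ⊤) {p q r : ℝ}
    (hp : 1 < p) (hq : 1 < q) (hr : 0 < r) (hpqr : 1 / p + 1 / q = 1 / r) :
    ∃ C : ℝ≥0∞, C ≠ ⊤ ∧ ∀ (D : Finset DyadicInterval) (n₁ n₂ : ℤ)
      (Φ₁ Φ₂ Φ₃ : DyadicInterval → ℝ → ℂ), IsMoleculeFamily B B₂ (shiftImage D n₁) Φ₁ →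
      IsMoleculeFamily B B₂ (shiftImage D n₂) Φ₂ → (∀ I ∈ D, IsMolecule B I (Φ₃ I)) →
      ∀ f g : ℝ → ℂ, Measurable f → Measurable g → ∫⁻ x, ‖f x‖ₑ ^ p ≠ ⊤ →
      ∫⁻ x, ‖g x‖ₑ ^ q ≠ ⊤ →
      ∫⁻ x, ‖modelOperator D n₁ n₂ Φ₁ Φ₂ Φ₃ f g x‖ₑ ^ r ≤ (C * (lg n₁ * lg n₂) *
        ((∫⁻ x, ‖f x‖ₑ ^ p) ^ (1 / p) * (∫⁻ x, ‖g x‖ₑ ^ q) ^ (1 / q))) ^ r := by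
  obtain ⟨C₁, hC₁, h₁⟩ := exists_lintegral_tailSquare_le B hB₂ hp
  obtain ⟨C₂, hC₂, h₂⟩ := exists_lintegral_tailSquare_le B hB₂ hq
  have hp0 : 0 < p := by linarith
  have hq0 : 0 < q := by linarith
  refine ⟨B 16 * (C₁ ^ (1 / p) * C₂ ^ (1 / q)), ENNReal.mul_ne_top ENNReal.coe_ne_top
    (ENNReal.mul_ne_top (ENNReal.rpow_ne_top_of_nonneg (by positivity) hC₁)
    (ENNReal.rpow_ne_top_of_nonneg (by positivity) hC₂)),
    fun D n₁ n₂ Φ₁ Φ₂ Φ₃ hΦ₁ hΦ₂ hΦ₃ f g hf hg hfin hgin => ?_⟩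
  set u : ℝ → ℝ≥0∞ := fun x => tailSquare D n₁ (coeffSq f Φ₁) x ^ (1 / 2 : ℝ) with hu
  set v : ℝ → ℝ≥0∞ := fun x => tailSquare D n₂ (coeffSq g Φ₂) x ^ (1 / 2 : ℝ) with hv
  have hpt : ∀ x, ‖modelOperator D n₁ n₂ Φ₁ Φ₂ Φ₃ f g x‖ₑ ≤ B 16 * (u x * v x) := by
    intro x
    have e : ∀ I : DyadicInterval, twoPow (-(I.k / 2)) ^ 2 = twoPow (-I.k) := fun I => by
      rw [twoPow_pow]; congr 1; push_cast; ring
    -- The sixteen powers of decay of `Φ₃` are split evenly between the two factors, and squaring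
    -- restores sixteen in each `tailSquare`.
    have h3 := sum_mul_le_sqrt_mul_sqrt D
      (fun I => twoPow (-(I.k / 2)) * ‖pairing f (Φ₁ (I.shift n₁))‖ₑ * wtAt I x ^ 8)
      (fun I => twoPow (-(I.k / 2)) * ‖pairing g (Φ₂ (I.shift n₂))‖ₑ * wtAt I x ^ 8)
    have h4 : ‖modelOperator D n₁ n₂ Φ₁ Φ₂ Φ₃ f g x‖ₑ ≤
        B 16 * ∑ I ∈ D, (twoPow (-(I.k / 2)) * ‖pairing f (Φ₁ (I.shift n₁))‖ₑ * wtAt I x ^ 8) *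
          (twoPow (-(I.k / 2)) * ‖pairing g (Φ₂ (I.shift n₂))‖ₑ * wtAt I x ^ 8) := by
      refine (enorm_sum_le _ _).trans ?_
      rw [Finset.mul_sum]
      refine Finset.sum_le_sum fun I hI => ?_
      rw [enorm_mul, enorm_modelOperator_term]
      refine (mul_le_mul_right ((hΦ₃ I hI).decay 16 x) _).trans (le_of_eq ?_)
      ring
    refine h4.trans (mul_le_mul_right (h3.trans (le_of_eq ?_)) _)
    simp only [hu, hv, tailSquare, coeffSq, shift_k]
    congr 2 <;>
    · refine Finset.sum_congr rfl fun I _ => ?_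
      rw [mul_pow, mul_pow, e]; ring
  have hum : Measurable u := (measurable_tailSquare _ _ _).pow_const _
  have hvm : Measurable v := (measurable_tailSquare _ _ _).pow_const _
  have hup : ∫⁻ x, u x ^ p ≤ C₁ * lg n₁ ^ p * ∫⁻ x, ‖f x‖ₑ ^ p := by
    simp only [hu, ← ENNReal.rpow_mul, one_div_mul_eq_div]
    exact h₁ D n₁ Φ₁ hΦ₁ f hf hfin
  have hvq : ∫⁻ x, v x ^ q ≤ C₂ * lg n₂ ^ q * ∫⁻ x, ‖g x‖ₑ ^ q := by
    simp only [hv, ← ENNReal.rpow_mul, one_div_mul_eq_div]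
    exact h₂ D n₂ Φ₂ hΦ₂ g hg hgin
  have h5 := lintegral_rpow_mul_rpow_le hp0 hq0 hr hpqr hum hvm hup hvq
  calc _ ≤ ∫⁻ x, (B 16 : ℝ≥0∞) ^ r * (u x * v x) ^ r := by
        refine lintegral_mono fun x => ?_
        rw [← ENNReal.mul_rpow_of_nonneg _ _ hr.le]
        exact ENNReal.rpow_le_rpow (hpt x) hr.le
    _ = (B 16 : ℝ≥0∞) ^ r * ∫⁻ x, (u x * v x) ^ r :=
        lintegral_const_mul' _ _ (ENNReal.rpow_ne_top_of_nonneg hr.le ENNReal.coe_ne_top)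
    _ ≤ (B 16 : ℝ≥0∞) ^ r * _ := mul_le_mul_right h5 _
    _ = _ := by
        rw [← ENNReal.mul_rpow_of_nonneg _ _ hr.le]
        congr 1; ring

/-- The estimate for the bilinear operator when the first and third families are of `ψ` type. -/
lemma exists_lintegral_modelOperator_le' (B : ℕ → ℝ≥0) {B₂ : ℝ≥0∞} (hB₂ : B₂ ≠ ⊤) {p q r : ℝ}
    (hp : 1 < p) (hq : 1 < q) (hr : 0 < r) (hpqr : 1 / p + 1 / q = 1 / r) :
    ∃ C : ℝ≥0∞, C ≠ ⊤ ∧ ∀ (D : Finset DyadicInterval) (n₁ n₂ : ℤ)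
      (Φ₁ Φ₂ Φ₃ : DyadicInterval → ℝ → ℂ), IsMoleculeFamily B B₂ (shiftImage D n₁) Φ₁ →
      (∀ J ∈ shiftImage D n₂, IsMolecule B J (Φ₂ J)) → IsMoleculeFamily B B₂ D Φ₃ →
      ∀ f g : ℝ → ℂ, Measurable f → Measurable g → ∫⁻ x, ‖f x‖ₑ ^ p ≠ ⊤ →
      ∫⁻ x, ‖modelOperator D n₁ n₂ Φ₁ Φ₂ Φ₃ f g x‖ₑ ^ r ≤ (C * (lg n₁ * lg n₂) *
        ((∫⁻ x, ‖f x‖ₑ ^ p) ^ (1 / p) * (∫⁻ x, ‖g x‖ₑ ^ q) ^ (1 / q))) ^ r := by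
  obtain ⟨C₀, hC₀, h₀⟩ := exists_lintegral_synthesis_le B hB₂ hr
  obtain ⟨C₁, hC₁, h₁⟩ := exists_lintegral_shiftSum_coeffSq_le B hB₂ hp
  obtain ⟨C₂, hC₂, h₂⟩ := exists_lintegral_tailMax_rpow_le hq
  have hp0 : 0 < p := by linarith
  have hq0 : 0 < q := by linarith
  refine ⟨C₀ ^ (1 / r) * (C₁ ^ (1 / p) * (B 5 ^ q * C₂) ^ (1 / q)), ENNReal.mul_ne_top
    (ENNReal.rpow_ne_top_of_nonneg (by positivity) hC₀)
    (ENNReal.mul_ne_top (ENNReal.rpow_ne_top_of_nonneg (by positivity) hC₁)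
    (ENNReal.rpow_ne_top_of_nonneg (by positivity) (ENNReal.mul_ne_top
    (ENNReal.rpow_ne_top_of_nonneg hq0.le ENNReal.coe_ne_top) hC₂))),
    fun D n₁ n₂ Φ₁ Φ₂ Φ₃ hΦ₁ hΦ₂ hΦ₃ f g hf hg hfin => ?_⟩
  -- Shifting by `-n₁` places the coefficient of `f` at `I.shift n₁` over the interval `I` itself,
  -- where the output molecule lives.
  set V := shiftSum (shiftImage D n₁) (-n₁) (coeffSq f Φ₁) with hV
  set u : ℝ → ℝ≥0∞ := fun x => V x ^ (1 / 2 : ℝ) with hu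
  set v : ℝ → ℝ≥0∞ := fun x => B 5 * tailMax D n₂ (fun y => ‖g y‖ₑ) x with hv
  set a : DyadicInterval → ℂ := fun I => ((I.length ^ (-(1 / 2) : ℝ) : ℝ) : ℂ) *
    pairing f (Φ₁ (I.shift n₁)) * pairing g (Φ₂ (I.shift n₂)) with ha
  have hum : Measurable u := (measurable_shiftSum _ _ _).pow_const _
  have hvm : Measurable v := (measurable_tailMax _ _ _).const_mul _
  have hup : ∫⁻ x, u x ^ p ≤ C₁ * lg n₁ ^ p * ∫⁻ x, ‖f x‖ₑ ^ p := by
    simp only [hu, ← ENNReal.rpow_mul, one_div_mul_eq_div]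
    have := h₁ _ Φ₁ hΦ₁ f hf hfin (-n₁)
    rwa [lg_neg] at this
  have hvq : ∫⁻ x, v x ^ q ≤ (B 5 ^ q * C₂) * lg n₂ ^ q * ∫⁻ x, ‖g x‖ₑ ^ q := by
    simp only [hv, ENNReal.mul_rpow_of_nonneg _ _ hq0.le]
    rw [lintegral_const_mul' _ _ (ENNReal.rpow_ne_top_of_nonneg hq0.le ENNReal.coe_ne_top)]
    calc _ ≤ (B 5 : ℝ≥0∞) ^ q * (C₂ * lg n₂ * ∫⁻ x, ‖g x‖ₑ ^ q) :=
          mul_le_mul_right (h₂ D n₂ _ hg.enorm) _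
      _ ≤ (B 5 : ℝ≥0∞) ^ q * (C₂ * lg n₂ ^ q * ∫⁻ x, ‖g x‖ₑ ^ q) := by
          gcongr
          have := lg_rpow_le hq.le n₂
          rwa [ENNReal.rpow_one] at this
      _ = _ := by ring
  have hpt : ∀ x, dsum D (sizeSq a) x ^ (r / 2) ≤ (u x * v x) ^ r := by
    intro x
    -- For `x` in `I`, the normalized coefficient of `g` is at most the shifted maximal function at
    -- `x`; it leaves the sum over `I` as a common factor.
    have h3 : dsum D (sizeSq a) x ≤ V x * v x ^ 2 := by
      rw [hV, shiftSum_shiftImage, Finset.sum_mul]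
      refine Finset.sum_le_sum fun I hI => ?_
      rw [add_neg_cancel, shift_zero]
      by_cases hx : x ∈ dset I
      · simp only [Set.indicator_of_mem hx]
        have h4 : twoPow (-(I.k / 2)) * ‖pairing g (Φ₂ (I.shift n₂))‖ₑ ≤ v x := by
          calc _ ≤ twoPow (-(I.k / 2)) * ∫⁻ y, ‖g y‖ₑ * (B 5 * twoPow (-(I.k / 2)) *
                wtAt (I.shift n₂) y ^ 5) := by
                refine mul_le_mul_right ((enorm_pairing_le _ _).trans
                  (lintegral_mono fun y => ?_)) _
                exact mul_le_mul_right ((hΦ₂ _ (mem_shiftImage hI)).decay 5 y) _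
            _ = B 5 * (twoPow (-I.k) * ∫⁻ y, ‖g y‖ₑ * wtAt (I.shift n₂) y ^ 5) := by
                have e1 : ∀ y, ‖g y‖ₑ * (B 5 * twoPow (-(I.k / 2)) * wtAt (I.shift n₂) y ^ 5) =
                    (B 5 * twoPow (-(I.k / 2))) * (‖g y‖ₑ * wtAt (I.shift n₂) y ^ 5) :=
                  fun y => by ring
                simp only [e1]
                rw [lintegral_const_mul' _ _ (ENNReal.mul_ne_top ENNReal.coe_ne_top
                  (twoPow_ne_top _)), show twoPow (-I.k) =
                  twoPow (-(I.k / 2)) * twoPow (-(I.k / 2)) by rw [← twoPow_add]; congr 1; ring]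
                ring
            _ ≤ _ := mul_le_mul_right (le_tailMax (Finset.mem_coe.2 hI) hx) _
        calc sizeSq a I = coeffSq f Φ₁ (I.shift n₁) *
              (twoPow (-(I.k / 2)) * ‖pairing g (Φ₂ (I.shift n₂))‖ₑ) ^ 2 := by
              simp only [sizeSq, ha, enorm_modelOperator_term, coeffSq, shift_k]
              ring
          _ ≤ _ := by gcongr
      · simp [Set.indicator_of_notMem hx]
    calc _ ≤ (V x * v x ^ 2) ^ (r / 2) := ENNReal.rpow_le_rpow h3 (by linarith)
      _ = _ := by
          simp only [hu]
          rw [ENNReal.mul_rpow_of_nonneg _ _ (by linarith), ENNReal.mul_rpow_of_nonneg _ _ hr.le,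
            ← ENNReal.rpow_two, ← ENNReal.rpow_mul, ← ENNReal.rpow_mul]
          congr 2 <;> ring
  have h5 := lintegral_rpow_mul_rpow_le hp0 hq0 hr hpqr hum hvm hup hvq
  have h6 : C₀ = (C₀ ^ (1 / r)) ^ r := by
    rw [← ENNReal.rpow_mul, one_div_mul_cancel hr.ne', ENNReal.rpow_one]
  calc _ ≤ C₀ * ∫⁻ x, dsum D (sizeSq a) x ^ (r / 2) := h₀ D Φ₃ hΦ₃ a
    _ ≤ C₀ * ∫⁻ x, (u x * v x) ^ r := mul_le_mul_right (lintegral_mono hpt) _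
    _ ≤ C₀ * _ := mul_le_mul_right h5 _
    _ = _ := by
        nth_rewrite 1 [h6]
        rw [← ENNReal.mul_rpow_of_nonneg _ _ hr.le]
        congr 1; ring

lemma modelOperator_swap (D : Finset DyadicInterval) (n₁ n₂ : ℤ)
    (Φ₁ Φ₂ Φ₃ : DyadicInterval → ℝ → ℂ) (f g : ℝ → ℂ) :
    modelOperator D n₁ n₂ Φ₁ Φ₂ Φ₃ f g = modelOperator D n₂ n₁ Φ₂ Φ₁ Φ₃ g f := by
  ext x
  exact Finset.sum_congr rfl fun I _ => by ring

lemma pairing_congr {f g : ℝ → ℂ} (h : f =ᵐ[volume] g) (Φ : ℝ → ℂ) :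
    pairing f Φ = pairing g Φ :=
  integral_congr_ae (h.mono fun x hx => by simp only [hx])

lemma modelOperator_congr {f f' g g' : ℝ → ℂ} (hf : f =ᵐ[volume] f') (hg : g =ᵐ[volume] g')
    (D : Finset DyadicInterval) (n₁ n₂ : ℤ) (Φ₁ Φ₂ Φ₃ : DyadicInterval → ℝ → ℂ) :
    modelOperator D n₁ n₂ Φ₁ Φ₂ Φ₃ f g = modelOperator D n₁ n₂ Φ₁ Φ₂ Φ₃ f' g' := by
  ext x
  simp only [modelOperator, pairing_congr hf, pairing_congr hg]

lemma eLpNorm_ofReal_eq {s : ℝ} (hs : 0 < s) (f : ℝ → ℂ) :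
    eLpNorm f (ENNReal.ofReal s) volume = (∫⁻ x, ‖f x‖ₑ ^ s) ^ (1 / s) := by
  rw [eLpNorm_eq_lintegral_rpow_enorm_toReal (by simpa using hs) ENNReal.ofReal_ne_top,
    ENNReal.toReal_ofReal hs.le]

lemma lg_mul_lg (n₁ n₂ : ℤ) : lg n₁ * lg n₂ =
    ENNReal.ofReal ((Real.log 2 ^ 2)⁻¹ * Real.log (2 + |(n₁ : ℝ)|) * Real.log (2 + |(n₂ : ℝ)|)) := by
  rw [lg, lg, ← ENNReal.ofReal_mul (zero_le_one.trans (one_le_logb n₁)), Real.logb, Real.logb]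
  congr 1
  field_simp

/-- The common estimate, in terms of molecules, when at least two families are of `ψ` type. -/
lemma exists_eLpNorm_modelOperator_le {M : ℕ} (hM : 1 ≤ M) {p q r : ℝ} (hp : 1 < p) (hq : 1 < q)
    (hr : 0 < r) (hpqr : 1 / p + 1 / q = 1 / r) (C : ℕ → ℕ → ℝ) (A : ℝ) :
    ∃ K : ℝ≥0∞, K ≠ ⊤ ∧
      ∀ (n₁ n₂ : ℤ) (𝓘 : Finset DyadicInterval) (Φ₁ Φ₂ Φ₃ : DyadicInterval → ℝ → ℂ),
        IsL2BumpFamily M C ((fun I => I.shift n₁) '' (𝓘 : Set DyadicInterval)) Φ₁ →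
        IsL2BumpFamily M C ((fun I => I.shift n₂) '' (𝓘 : Set DyadicInterval)) Φ₂ →
        IsL2BumpFamily M C (𝓘 : Set DyadicInterval) Φ₃ →
        ((IsPsiType A ((fun I => I.shift n₁) '' (𝓘 : Set DyadicInterval)) Φ₁ ∧
            IsPsiType A ((fun I => I.shift n₂) '' (𝓘 : Set DyadicInterval)) Φ₂) ∨
          (IsPsiType A ((fun I => I.shift n₁) '' (𝓘 : Set DyadicInterval)) Φ₁ ∧
            IsPsiType A (𝓘 : Set DyadicInterval) Φ₃) ∨
          (IsPsiType A ((fun I => I.shift n₂) '' (𝓘 : Set DyadicInterval)) Φ₂ ∧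
            IsPsiType A (𝓘 : Set DyadicInterval) Φ₃)) →
        ∀ f g : ℝ → ℂ,
          MemLp f (ENNReal.ofReal p) volume → MemLp g (ENNReal.ofReal q) volume →
          MemLp (modelOperator 𝓘 n₁ n₂ Φ₁ Φ₂ Φ₃ f g) (ENNReal.ofReal r) volume ∧
          eLpNorm (modelOperator 𝓘 n₁ n₂ Φ₁ Φ₂ Φ₃ f g) (ENNReal.ofReal r) volume ≤
            K * (lg n₁ * lg n₂) *
              (eLpNorm f (ENNReal.ofReal p) volume * eLpNorm g (ENNReal.ofReal q) volume) := by
  have hp0 : 0 < p := by linarith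
  have hq0 : 0 < q := by linarith
  set B := moleculeConst C with hB
  obtain ⟨B₂, hB₂, hsyn⟩ := exists_synthesisBound A B
  obtain ⟨K₁, hK₁, h₁⟩ := exists_lintegral_modelOperator_le B hB₂ hp hq hr hpqr
  obtain ⟨K₂, hK₂, h₂⟩ := exists_lintegral_modelOperator_le' B hB₂ hp hq hr hpqr
  obtain ⟨K₃, hK₃, h₃⟩ := exists_lintegral_modelOperator_le' B hB₂ hq hp hr
    (by rw [add_comm]; exact hpqr)
  refine ⟨K₁ + K₂ + K₃, ENNReal.add_ne_top.2 ⟨ENNReal.add_ne_top.2 ⟨hK₁, hK₂⟩, hK₃⟩,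
    fun n₁ n₂ 𝓘 Φ₁ Φ₂ Φ₃ hΦ₁ hΦ₂ hΦ₃ hψ f g hf hg => ?_⟩
  rw [← coe_shiftImage, ← coe_shiftImage] at hψ
  rw [← coe_shiftImage] at hΦ₁ hΦ₂
  have m₁ : ∀ J ∈ shiftImage 𝓘 n₁, IsMolecule B J (Φ₁ J) := fun J hJ => IsL2Bump.isMolecule hM (hΦ₁ J hJ)
  have m₂ : ∀ J ∈ shiftImage 𝓘 n₂, IsMolecule B J (Φ₂ J) := fun J hJ => IsL2Bump.isMolecule hM (hΦ₂ J hJ)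
  have m₃ : ∀ J ∈ 𝓘, IsMolecule B J (Φ₃ J) := fun J hJ => IsL2Bump.isMolecule hM (hΦ₃ J hJ)
  have hcont : Continuous (modelOperator 𝓘 n₁ n₂ Φ₁ Φ₂ Φ₃ f g) :=
    continuous_finsetSum _ fun J hJ => continuous_const.mul (m₃ J hJ).continuous
  -- The estimates are stated for measurable functions; the operator depends on `f` and `g` only
  -- almost everywhere.
  set f' := hf.1.mk f with hf'
  set g' := hg.1.mk g with hg'
  have hff' : f =ᵐ[volume] f' := hf.1.ae_eq_mk
  have hgg' : g =ᵐ[volume] g' := hg.1.ae_eq_mk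
  have hf'm : Measurable f' := hf.1.stronglyMeasurable_mk.measurable
  have hg'm : Measurable g' := hg.1.stronglyMeasurable_mk.measurable
  have hf'fin : ∫⁻ x, ‖f' x‖ₑ ^ p ≠ ⊤ := by
    have h := (hf.ae_eq hff').2
    rw [eLpNorm_lt_top_iff_lintegral_rpow_enorm_lt_top (by simpa using hp0) ENNReal.ofReal_ne_top,
      ENNReal.toReal_ofReal hp0.le] at h
    exact h.ne
  have hg'fin : ∫⁻ x, ‖g' x‖ₑ ^ q ≠ ⊤ := by
    have h := (hg.ae_eq hgg').2
    rw [eLpNorm_lt_top_iff_lintegral_rpow_enorm_lt_top (by simpa using hq0) ENNReal.ofReal_ne_top,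
      ENNReal.toReal_ofReal hq0.le] at h
    exact h.ne
  set X := eLpNorm f (ENNReal.ofReal p) volume * eLpNorm g (ENNReal.ofReal q) volume with hX
  have hXeq : X = (∫⁻ x, ‖f' x‖ₑ ^ p) ^ (1 / p) * (∫⁻ x, ‖g' x‖ₑ ^ q) ^ (1 / q) := by
    rw [hX, eLpNorm_congr_ae hff', eLpNorm_congr_ae hgg', eLpNorm_ofReal_eq hp0,
      eLpNorm_ofReal_eq hq0]
  have hle : ∀ K : ℝ≥0∞, K ≤ K₁ + K₂ + K₃ →
      ∫⁻ x, ‖modelOperator 𝓘 n₁ n₂ Φ₁ Φ₂ Φ₃ f g x‖ₑ ^ r ≤ (K * (lg n₁ * lg n₂) * X) ^ r →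
      eLpNorm (modelOperator 𝓘 n₁ n₂ Φ₁ Φ₂ Φ₃ f g) (ENNReal.ofReal r) volume ≤
        (K₁ + K₂ + K₃) * (lg n₁ * lg n₂) * X := by
    intro K hK h
    rw [eLpNorm_ofReal_eq hr]
    calc _ ≤ ((K * (lg n₁ * lg n₂) * X) ^ r) ^ (1 / r) := ENNReal.rpow_le_rpow h (by positivity)
      _ = K * (lg n₁ * lg n₂) * X := by
          rw [← ENNReal.rpow_mul, mul_one_div_cancel hr.ne', ENNReal.rpow_one]
      _ ≤ _ := by gcongr
  have hbound : eLpNorm (modelOperator 𝓘 n₁ n₂ Φ₁ Φ₂ Φ₃ f g) (ENNReal.ofReal r) volume ≤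
      (K₁ + K₂ + K₃) * (lg n₁ * lg n₂) * X := by
    have hT := modelOperator_congr hff' hgg' 𝓘 n₁ n₂ Φ₁ Φ₂ Φ₃
    rcases hψ with ⟨p₁, p₂⟩ | ⟨p₁, p₃⟩ | ⟨p₂, p₃⟩
    · refine hle K₁ (by rw [add_assoc]; exact le_self_add) ?_
      rw [hT, hXeq]
      exact h₁ 𝓘 n₁ n₂ Φ₁ Φ₂ Φ₃ ⟨m₁, hsyn _ _ m₁ p₁⟩ ⟨m₂, hsyn _ _ m₂ p₂⟩ m₃ f' g' hf'm hg'm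
        hf'fin hg'fin
    · refine hle K₂ (by rw [add_assoc, add_left_comm]; exact le_self_add) ?_
      rw [hT, hXeq]
      exact h₂ 𝓘 n₁ n₂ Φ₁ Φ₂ Φ₃ ⟨m₁, hsyn _ _ m₁ p₁⟩ m₂ ⟨m₃, hsyn _ _ m₃ p₃⟩ f' g' hf'm hg'm hf'fin
    · refine hle K₃ le_add_self ?_
      rw [hT, hXeq, modelOperator_swap, mul_comm (lg n₁), mul_comm ((∫⁻ x, ‖f' x‖ₑ ^ p) ^ (1 / p))]
      exact h₃ 𝓘 n₂ n₁ Φ₂ Φ₁ Φ₃ ⟨m₂, hsyn _ _ m₂ p₂⟩ m₁ ⟨m₃, hsyn _ _ m₃ p₃⟩ g' f' hg'm hf'm hg'fin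
  refine ⟨⟨hcont.aestronglyMeasurable, hbound.trans_lt ?_⟩, hbound⟩
  exact ENNReal.mul_lt_top (ENNReal.mul_lt_top (ENNReal.add_lt_top.2 ⟨ENNReal.add_lt_top.2
    ⟨hK₁.lt_top, hK₂.lt_top⟩, hK₃.lt_top⟩) (ENNReal.mul_lt_top (lg_ne_top _).lt_top
    (lg_ne_top _).lt_top)) (ENNReal.mul_lt_top hf.2 hg.2)

end Paraproduct

end

theorem theorem2p3 :
    -- `M` is the number of derivatives of the bumps that have to be controlled
    ∃ M : ℕ, ∀ p q r : ℝ, 1 < p → 1 < q → 0 < r → 1 / p + 1 / q = 1 / r →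
      ∀ (C : ℕ → ℕ → ℝ) (A : ℝ), ∃ K : ℝ, 0 < K ∧
        ∀ (n₁ n₂ : ℤ) (𝓘 : Finset DyadicInterval) (Φ₁ Φ₂ Φ₃ : DyadicInterval → ℝ → ℂ),
          IsL2BumpFamily M C ((fun I => I.shift n₁) '' (𝓘 : Set DyadicInterval)) Φ₁ →
          IsL2BumpFamily M C ((fun I => I.shift n₂) '' (𝓘 : Set DyadicInterval)) Φ₂ →
          IsL2BumpFamily M C (𝓘 : Set DyadicInterval) Φ₃ →
          ((IsPsiType A ((fun I => I.shift n₁) '' (𝓘 : Set DyadicInterval)) Φ₁ ∧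
              IsPsiType A ((fun I => I.shift n₂) '' (𝓘 : Set DyadicInterval)) Φ₂) ∨
            (IsPsiType A ((fun I => I.shift n₁) '' (𝓘 : Set DyadicInterval)) Φ₁ ∧
              IsPsiType A (𝓘 : Set DyadicInterval) Φ₃) ∨
            (IsPsiType A ((fun I => I.shift n₂) '' (𝓘 : Set DyadicInterval)) Φ₂ ∧
              IsPsiType A (𝓘 : Set DyadicInterval) Φ₃)) →
          ∀ f g : ℝ → ℂ,
            MemLp f (ENNReal.ofReal p) volume → MemLp g (ENNReal.ofReal q) volume →
            MemLp (modelOperator 𝓘 n₁ n₂ Φ₁ Φ₂ Φ₃ f g) (ENNReal.ofReal r) volume ∧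
            eLpNorm (modelOperator 𝓘 n₁ n₂ Φ₁ Φ₂ Φ₃ f g) (ENNReal.ofReal r) volume ≤
              ENNReal.ofReal
                  (K * Real.log (2 + |(n₁ : ℝ)|) * Real.log (2 + |(n₂ : ℝ)|)) *
                eLpNorm f (ENNReal.ofReal p) volume * eLpNorm g (ENNReal.ofReal q) volume := by
  refine ⟨1, fun p q r hp hq hr hpqr C A => ?_⟩
  obtain ⟨K, hK, h⟩ := Paraproduct.exists_eLpNorm_modelOperator_le le_rfl hp hq hr hpqr C A
  have hlog : 0 < Real.log 2 := Real.log_pos one_lt_two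
  -- Adding `1` secures positivity, and the power of `Real.log 2` converts both base two logarithms
  -- to natural ones.
  refine ⟨(K.toReal + 1) * (Real.log 2 ^ 2)⁻¹, by positivity,
    fun n₁ n₂ 𝓘 Φ₁ Φ₂ Φ₃ hΦ₁ hΦ₂ hΦ₃ hψ f g hf hg => ?_⟩
  obtain ⟨h₁, h₂⟩ := h n₁ n₂ 𝓘 Φ₁ Φ₂ Φ₃ hΦ₁ hΦ₂ hΦ₃ hψ f g hf hg
  refine ⟨h₁, h₂.trans ?_⟩
  rw [Paraproduct.lg_mul_lg, mul_assoc (ENNReal.ofReal _)]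
  refine mul_le_mul_left ?_ _
  rw [mul_assoc (K.toReal + 1), mul_assoc (K.toReal + 1), ENNReal.ofReal_mul (p := K.toReal + 1) (by positivity)]
  refine mul_le_mul_left ?_ _
  rw [← ENNReal.ofReal_toReal hK]
  exact ENNReal.ofReal_le_ofReal (by simp)
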